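/- **Setting.** Let $\mathfrak g$ be a finite-dimensional simple complex Lie algebra with a nondegenerate invariant bilinear form $\langle\cdot|\cdot\rangle$, let $\mathfrak g=\bigoplus_{i\in\mathbb Z}\mathfrak g_i$ be a $\mathbb Z$-grading of the Lie algebra, and let $e\in\mathfrak g_2$ be good: $\operatorname{ad}e:\mathfrak g_j\to\mathfrak g_{j+2}$ is injective for $j\le -1$. Put $\mathfrak b^{-}=\bigoplus_{i\le 0}\mathfrak g_i$, $\mathfrak b^{+}=\bigoplus_{i\ge 0}\mathfrak g_i$, $\mathfrak n^{-}=\bigoplus_{i\le -1}\mathfrak g_i$, $\mathfrak g^{-}=\bigoplus_{i\le -2}\mathfrak g_i$, $\mathfrak n^{+}=\bigoplus_{i\ge 1}\mathfrak g_i$. Let $\mathcal C=\bigoplus_i(\mathcal C\cap\mathfrak g_i)$ be a graded transversal subspace, $\operatorname{ad}e(\mathfrak g^-)\oplus\mathcal C=\mathfrak b^-$, and let $a\in\mathcal C$ be homogeneous of the minimal degree occurring in $\mathcal C$. For a subspace $V\subset\mathfrak g$ let $LV=C^\infty(S^1,V)$, $S^1=\mathbb R/\mathbb Z$. Put $(u|v)=\int_{S^1}\langle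 u|v\rangle\,dx$ on $L\mathfrak g$ and use it to regard covectors as elements of $L\mathfrak g$. Smooth functionals on an affine subspace are complex-valued functionals, smooth along smooth finite-dimensional families, that have a smooth gradient with values in $L\mathfrak g$ (on a proper affine subspace the gradient is determined modulo the annihilator of the tangent space). On $L\mathfrak g$ let $$P_2(v)=v_x+[q,v],\quad P_1(v)=[a,v],\quad P_\lambda=P_2+\lambda P_1\ (\lambda\in\mathbb C),\quad \{F,H\}_\lambda=(\delta F|P_\lambda\,\delta H).$$ Put $S=e+L\mathfrak b^-$, $Q=e+L\mathcal C$, $D_q=P_2(L\mathfrak n^-)$ at $q\in L\mathfrak g$, $E=D\cap TS$. Let $N^-$ and $G^-\subset N^-$ be the groups generated by $\exp(\operatorname{ad}n)$ with $n\in L\mathfrak n^-$, respectively $n\in L\mathfrak g^-$, acting on operators $\frac d{dx}+q$, $q\in L\mathfrak g$ (gauge action). **Theorem.** The generalized Drinfeld–Sokolov and the generalized bi-Hamiltonian reductions satisfy the hypotheses of the Marsden–Ratiu theorem with the same pencil $P_\lambda$, the same submanifold $S$ and the same distribution $D$, and give the same reduced bi-Hamiltonian structure on $Q$. Precisely: 1.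 $(P_1,P_2)$ is bi-Hamiltonian on $L\mathfrak g$: $P_1$ and all $P_\lambda$ are Poisson tensors. 2. (Bi-Hamiltonian reduction.) The functionals $K_\xi(q)=(q|\xi)$, $\xi\in L\mathfrak n^-$, form a space of Casimirs of $P_1$ that is closed under $\{\cdot,\cdot\}_2$ (the bracket of $P_2$), and the differential of each nonzero $K_\xi$ vanishes at no point; $S$ is a common level set of them, and $D$ consists of the values of the Hamiltonian vector fields $P_2(dK_\xi)$. 3. (Drinfeld–Sokolov reduction as a Marsden–Weinstein reduction.) For every $\lambda$ the action of $N^-$ is Hamiltonian for $P_\lambda$, with $\operatorname{Ad}^*$-equivariant momentum map $J:L\mathfrak g\to L\mathfrak n^+\cong(L\mathfrak n^-)^*$ the projection along $L\mathfrak b^-$; $e$ is a regular value of $J$, $J^{-1}(e)=S$, the tangent distribution to the $N^-$-orbits is $D=P_2(L\mathfrak n^-)=P_\lambda(L\mathfrak n^-)$, and the isotropy group of $e$ in $N^-$ under the coadjoint action is $G^-$. 4. $E=P_2(L\mathfrak g^-)$ on $S$, and $Q\subset S$ is transversal: $T_qS=E_q\oplus T_qQ$ for all $q\in Q$. 5.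 There is a smooth retraction $\pi:S\to Q$ whose fibres are exactly the $G^-$-orbits in $S$, so that $S/G^-\cong Q$, such that for every $\lambda$ the Marsden–Ratiu hypotheses hold for $(P_\lambda,S,D)$: (i) $E$ is an integrable distribution on $S$; (ii) $\pi$ is a submersion whose fibres are the leaves of $E$; (iii) if $F,H$ are constant along $D$ then so is $\{F,H\}_\lambda$ (both when "constant along $D$" is meant on all of $L\mathfrak g$ and when $dF|_D=0$ is required at the points of $S$ only); (iv) $P_\lambda(D^0)\subset TS+D$ on $S$, where $D^0$ is the annihilator of $D$. 6. There is a bi-Hamiltonian structure $(P_1^Q,P_2^Q)$ on $Q$ such that, with $P^Q_\lambda=P^Q_2+\lambda P_1^Q$, for every $\lambda$ and all functionals $f,h$ on $Q$: (a) $\{f,h\}^Q_\lambda\circ\pi=\{F,H\}_\lambda|_S$ for all functionals $F,H$ on $L\mathfrak g$ that extend $f\circ\pi$, $h\circ\pi$ and whose differentials annihilate $D$ along $S$ (reduction to $S/G^-$); (b) $\{f,h\}^Q_\lambda=\{F,H\}_\lambda|_Q$ for all $F,H$ that extend $f,h$ from $Q$ and whose differentials annihilate $D$ along $S$ (reduction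 to the transversal submanifold $Q$). Such extensions exist for every $f$, both in (a) and in (b), and any Poisson tensor on $Q$ with property (a) equals any Poisson tensor on $Q$ with property (b). 7. If $\mathfrak g_{-1}=0$, then for $G^-$-invariant functionals $F,H$ on $S$ whose gradients are taken in $L\mathfrak b^+$ one has $(\delta F|P_\lambda\,\delta H)=\{F|_Q,H|_Q\}^Q_\lambda\circ\pi$ on $S$. -/

import Mathlib

open scoped ContDiff

noncomputable section

namespace LoopReduction

/-! ### The loop algebra -/

section Loops

variable {𝔤 : Type*} [LieRing 𝔤] [LieAlgebra ℂ 𝔤]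

/-- Smoothness of a map from a real normed space into a (finite-dimensional) complex vector space,
expressed through all linear coordinates, so that no norm has to be chosen. -/
def VecSmooth {T : Type*} [NormedAddCommGroup T] [NormedSpace ℝ T] (f : T → 𝔤) : Prop :=
  ∀ φ : Module.Dual ℂ 𝔤, ContDiff ℝ ∞ fun t => φ (f t)

variable (𝔤) in
/-- `L𝔤`: smooth maps from the circle `ℝ/ℤ` to `𝔤`, as smooth `1`-periodic functions on `ℝ`. -/
def loopSpace : Submodule ℂ (ℝ → 𝔤) where
  carrier := {u | (∀ x, u (x + 1) = u x) ∧ VecSmooth u}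
  add_mem' := by
    rintro u v ⟨hu, hu'⟩ ⟨hv, hv'⟩
    refine ⟨fun x => by simp [hu x, hv x], fun φ => ?_⟩
    simpa using (hu' φ).add (hv' φ)
  zero_mem' := ⟨fun _ => rfl, fun φ => by simpa using contDiff_const⟩
  smul_mem' := by
    rintro c u ⟨hu, hu'⟩
    refine ⟨fun x => by simp [hu x], fun φ => ?_⟩
    simpa using contDiff_const.mul (hu' φ)

variable (𝔤) in
/-- The loop algebra `L𝔤`, viewed as a type. -/
abbrev Loop : Type _ := loopSpace 𝔤

instance : CoeFun (Loop 𝔤) (fun _ => ℝ → 𝔤) := ⟨fun u => u.1⟩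

/-- The constant loop. -/
def constLoop (a : 𝔤) : Loop 𝔤 :=
  ⟨fun _ => a, fun _ => rfl, fun _ => contDiff_const⟩

/-- For a subspace `V` of `𝔤`, the subspace `LV` of `L𝔤`. -/
def loopsIn (V : Submodule ℂ 𝔤) : Submodule ℂ (Loop 𝔤) where
  carrier := {u | ∀ x, u x ∈ V}
  add_mem' hu hv x := V.add_mem (hu x) (hv x)
  zero_mem' _ := V.zero_mem
  smul_mem' c _ hu x := V.smul_mem c (hu x)

/-- Apply a linear endomorphism of `𝔤` pointwise to loops. -/
def loopMap (T : 𝔤 →ₗ[ℂ] 𝔤) : Loop 𝔤 →ₗ[ℂ] Loop 𝔤 where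
  toFun u := ⟨fun x => T (u x), fun x => by simp [u.2.1 x], fun φ => u.2.2 (φ ∘ₗ T)⟩
  map_add' u v := by ext x; simp
  map_smul' c u := by ext x; simp

variable [Module.Finite ℂ 𝔤]

theorem contDiff_bilin {T : Type*} [NormedAddCommGroup T] [NormedSpace ℝ T] {f g : T → 𝔤}
    (hf : VecSmooth f) (hg : VecSmooth g) (β : 𝔤 →ₗ[ℂ] 𝔤 →ₗ[ℂ] ℂ) :
    ContDiff ℝ ∞ fun t => β (f t) (g t) := by
  let b := Module.finBasis ℂ 𝔤
  have h : (fun t => β (f t) (g t)) =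
      fun t => ∑ i, ∑ j, b.coord i (f t) * (b.coord j (g t) * β (b i) (b j)) := by
    funext t
    conv_lhs => rw [← b.sum_repr (f t), ← b.sum_repr (g t)]
    simp only [map_sum, map_smul, LinearMap.sum_apply, LinearMap.smul_apply, smul_eq_mul,
      Finset.mul_sum, Module.Basis.coord_apply]
    rw [Finset.sum_comm]
    exact Finset.sum_congr rfl fun i _ => Finset.sum_congr rfl fun j _ => by ring
  rw [h]
  exact ContDiff.sum fun i _ => ContDiff.sum fun j _ =>
    (hf (b.coord i)).mul ((hg (b.coord j)).mul contDiff_const)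

/-- The pointwise Lie bracket of the loop algebra. -/
def loopLie : Loop 𝔤 →ₗ[ℂ] Loop 𝔤 →ₗ[ℂ] Loop 𝔤 :=
  LinearMap.mk₂ ℂ
    (fun u v => ⟨fun x => ⁅u x, v x⁆, fun x => by simp only [u.2.1 x, v.2.1 x],
      fun φ => contDiff_bilin u.2.2 v.2.2
        ((LieModule.toEnd ℂ 𝔤 𝔤 : 𝔤 →ₗ[ℂ] Module.End ℂ 𝔤).compr₂ φ)⟩)
    (fun u u' v => by ext x; simp)
    (fun c u v => by ext x; simp)
    (fun u v v' => by ext x; simp)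
    (fun c u v => by ext x; simp)

/-- The derivative of a function into `𝔤`, computed in coordinates. -/
def vecDeriv (u : ℝ → 𝔤) (x : ℝ) : 𝔤 :=
  ∑ i, deriv (fun y => (Module.finBasis ℂ 𝔤).coord i (u y)) x • Module.finBasis ℂ 𝔤 i

/-- `vecDeriv` does not depend on the coordinates. -/
theorem dual_vecDeriv {u : ℝ → 𝔤} (hu : VecSmooth u) (φ : Module.Dual ℂ 𝔤) (x : ℝ) :
    φ (vecDeriv u x) = deriv (fun y => φ (u y)) x := by
  set b := Module.finBasis ℂ 𝔤 with hb
  have h : (fun y => φ (u y)) = fun y => ∑ i, b.coord i (u y) * φ (b i) := by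
    funext y
    conv_lhs => rw [← b.sum_repr (u y)]
    simp only [map_sum, map_smul, smul_eq_mul, Module.Basis.coord_apply]
  have hd : ∀ i, DifferentiableAt ℝ (fun y => b.coord i (u y)) x := fun i =>
    ((hu (b.coord i)).differentiable (by simp)) x
  rw [h, deriv_fun_sum fun i _ => (hd i).mul_const _]
  simp only [vecDeriv, ← hb, map_sum, map_smul, smul_eq_mul]
  exact Finset.sum_congr rfl fun i _ => (deriv_mul_const (hd i) _).symm

/-- The derivative `u ↦ u_x` on loops. -/
def loopDeriv : Loop 𝔤 →ₗ[ℂ] Loop 𝔤 where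
  toFun u := ⟨vecDeriv (u : ℝ → 𝔤), by
    refine ⟨fun x => ?_, fun φ => ?_⟩
    · refine Finset.sum_congr rfl fun i _ => ?_
      rw [← deriv_comp_add_const]
      simp only [u.2.1]
    · simp only [dual_vecDeriv u.2.2]
      exact (u.2.2 φ).iterate_deriv 1⟩
  map_add' u v := by
    ext x
    have h : ∀ (w : Loop 𝔤) (i), DifferentiableAt ℝ
        (fun y => (Module.finBasis ℂ 𝔤).coord i (w y)) x := fun w i =>
      ((w.2.2 ((Module.finBasis ℂ 𝔤).coord i)).differentiable (by simp)) x
    simp only [vecDeriv, Submodule.coe_add, Pi.add_apply, map_add]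
    rw [← Finset.sum_add_distrib]
    refine Finset.sum_congr rfl fun i _ => ?_
    rw [deriv_fun_add (h u i) (h v i), add_smul]
  map_smul' c u := by
    ext x
    have h : ∀ i, DifferentiableAt ℝ
        (fun y => (Module.finBasis ℂ 𝔤).coord i (u y)) x := fun i =>
      ((u.2.2 ((Module.finBasis ℂ 𝔤).coord i)).differentiable (by simp)) x
    simp only [vecDeriv, Submodule.coe_smul, Pi.smul_apply, map_smul, smul_eq_mul, RingHom.id_apply]
    rw [Finset.smul_sum]
    refine Finset.sum_congr rfl fun i _ => ?_
    rw [deriv_const_mul _ (h i), mul_smul]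

/-- `(u|v) = ∫_{S¹} ⟨u(x)|v(x)⟩ dx`. -/
def pairing (B : LinearMap.BilinForm ℂ 𝔤) : Loop 𝔤 →ₗ[ℂ] Loop 𝔤 →ₗ[ℂ] ℂ :=
  have hi : ∀ u v : Loop 𝔤, IntervalIntegrable (fun x => B (u x) (v x)) MeasureTheory.volume 0 1 :=
    fun u v => (contDiff_bilin u.2.2 v.2.2 B).continuous.intervalIntegrable 0 1
  LinearMap.mk₂ ℂ (fun u v => ∫ x in (0 : ℝ)..1, B (u x) (v x))
    (fun u u' v => by
      rw [← intervalIntegral.integral_add (hi u v) (hi u' v)]; simp)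
    (fun c u v => by
      rw [← intervalIntegral.integral_smul]; simp)
    (fun u v v' => by
      rw [← intervalIntegral.integral_add (hi u v) (hi u v')]; simp)
    (fun c u v => by
      rw [← intervalIntegral.integral_smul]; simp)

/-! ### Smooth maps, functionals and gradients on `L𝔤` -/

/-- A smooth family of loops. -/
def IsPlot {T : Type*} [NormedAddCommGroup T] [NormedSpace ℝ T] (c : T → Loop 𝔤) : Prop :=
  VecSmooth fun p : T × ℝ => c p.1 p.2

/-- A map is smooth on `A` if it sends smooth finite-dimensional families of loops in `A` to
smooth families of loops. -/
def SmoothMapOn (A : Set (Loop 𝔤)) (Φ : Loop 𝔤 → Loop 𝔤) : Prop :=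
  ∀ (k : ℕ) (c : (Fin k → ℝ) → Loop 𝔤), IsPlot c → (∀ t, c t ∈ A) → IsPlot fun t => Φ (c t)

/-- A functional is smooth on `A` if it is smooth along smooth finite-dimensional families. -/
def SmoothFunctionalOn (A : Set (Loop 𝔤)) (F : Loop 𝔤 → ℂ) : Prop :=
  ∀ (k : ℕ) (c : (Fin k → ℝ) → Loop 𝔤), IsPlot c → (∀ t, c t ∈ A) →
    ContDiff ℝ ∞ fun t => F (c t)

/-- The curve `c` in `L𝔤` has velocity `v` at time `0`. -/
def HasVelocity (c : ℝ → Loop 𝔤) (v : Loop 𝔤) : Prop :=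
  ∀ (φ : Module.Dual ℂ 𝔤) (x : ℝ), HasDerivAt (fun t => φ (c t x)) (φ (v x)) 0

/-- `F` is a smooth functional on the affine submanifold `A` of `L𝔤` with smooth gradient `δF`:
`d/dθ F(q + θ s) |_{θ = 0} = (δF(q)|s)` for `q ∈ A` and `s` tangent to `A`. The gradient is a
covector of `A`, i.e. it matters only modulo the annihilator of the tangent space. -/
structure HasGradOn (B : LinearMap.BilinForm ℂ 𝔤) (A : AffineSubspace ℂ (Loop 𝔤))
    (F : Loop 𝔤 → ℂ) (δF : Loop 𝔤 → Loop 𝔤) : Prop where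
  smooth : SmoothFunctionalOn (A : Set (Loop 𝔤)) F
  smooth_grad : SmoothMapOn (A : Set (Loop 𝔤)) δF
  deriv : ∀ q ∈ A, ∀ s ∈ A.direction,
    HasDerivAt (fun θ : ℝ => F (q + (θ : ℂ) • s)) (pairing B (δF q) s) 0

/-- A field of linear maps from covectors to vectors; covectors are loops through `pairing`. -/
abbrev Tensor (𝔤 : Type*) [LieRing 𝔤] [LieAlgebra ℂ 𝔤] : Type _ :=
  Loop 𝔤 → Loop 𝔤 →ₗ[ℂ] Loop 𝔤

/-- The bracket `{F, G} = (dF, P dG)` in terms of gradients. -/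
def bracket (B : LinearMap.BilinForm ℂ 𝔤) (P : Tensor 𝔤) (δF δG : Loop 𝔤 → Loop 𝔤)
    (q : Loop 𝔤) : ℂ :=
  pairing B (δF q) (P q (δG q))

/-- `P` is a Poisson tensor on the affine submanifold `A`. -/
structure IsPoissonOn (B : LinearMap.BilinForm ℂ 𝔤) (A : AffineSubspace ℂ (Loop 𝔤))
    (P : Tensor 𝔤) : Prop where
  tangent : ∀ q ∈ A, ∀ v, P q v ∈ A.direction
  skew : ∀ q ∈ A, ∀ v w, pairing B v (P q w) = -pairing B w (P q v)
  closed : ∀ F δF G δG, HasGradOn B A F δF → HasGradOn B A G δG →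
    ∃ δ, HasGradOn B A (bracket B P δF δG) δ
  jacobi : ∀ F δF G δG H δH, HasGradOn B A F δF → HasGradOn B A G δG → HasGradOn B A H δH →
    ∀ δFG δGH δHF, HasGradOn B A (bracket B P δF δG) δFG →
      HasGradOn B A (bracket B P δG δH) δGH → HasGradOn B A (bracket B P δH δF) δHF →
      ∀ q ∈ A, bracket B P δFG δH q + bracket B P δGH δF q + bracket B P δHF δG q = 0

/-- `(P₁, P₂)` is a bi-Hamiltonian structure on `A`: `P₁` and all `P₂ + λ P₁` are Poisson. -/
structure IsBihamiltonianOn (B : LinearMap.BilinForm ℂ 𝔤) (A : AffineSubspace ℂ (Loop 𝔤))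
    (P₁ P₂ : Tensor 𝔤) : Prop where
  first : IsPoissonOn B A P₁
  pencil : ∀ l : ℂ, IsPoissonOn B A (P₂ + l • P₁)

/-- The functional with gradient `δF` is constant along the distribution `D` at the points of
`U`: its differential annihilates `D` there. -/
def ConstAlongOn (B : LinearMap.BilinForm ℂ 𝔤) (D : Loop 𝔤 → Submodule ℂ (Loop 𝔤))
    (U : Set (Loop 𝔤)) (δF : Loop 𝔤 → Loop 𝔤) : Prop :=
  ∀ q ∈ U, ∀ d ∈ D q, pairing B (δF q) d = 0

/-! ### Marsden-Ratiu reduction -/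

/-- Through every point of `S` passes an immersed integral submanifold of `E`. -/
def IsIntegrableOn (S : AffineSubspace ℂ (Loop 𝔤)) (E : Loop 𝔤 → Submodule ℂ (Loop 𝔤)) : Prop :=
  ∀ p ∈ S, ∃ (W : Submodule ℂ (Loop 𝔤)) (φ : Loop 𝔤 → Loop 𝔤),
    SmoothMapOn (W : Set (Loop 𝔤)) φ ∧ φ 0 = p ∧
    ∀ w ∈ W, φ w ∈ S ∧
      (∀ s ∈ W, ∃ v ∈ E (φ w), HasVelocity (fun t : ℝ => φ (w + (t : ℂ) • s)) v) ∧
      (∀ v ∈ E (φ w), ∃! s, s ∈ W ∧ HasVelocity (fun t : ℝ => φ (w + (t : ℂ) • s)) v)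

/-- The foliation of `S` by the leaves of `E` is regular with quotient manifold `N` and
projection the submersion `π : S → N`: `π` is a smooth submersion (there is a smooth section
through every point) whose fibres are connected with tangent spaces `E`, i.e. are the leaves. -/
structure IsLeafSpace (S : AffineSubspace ℂ (Loop 𝔤)) (E : Loop 𝔤 → Submodule ℂ (Loop 𝔤))
    (N : AffineSubspace ℂ (Loop 𝔤)) (π : Loop 𝔤 → Loop 𝔤) : Prop where
  smooth : SmoothMapOn (S : Set (Loop 𝔤)) π
  mapsTo : ∀ p ∈ S, π p ∈ N
  submersion : ∀ p ∈ S, ∃ σ : Loop 𝔤 → Loop 𝔤, SmoothMapOn (N : Set (Loop 𝔤)) σ ∧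
    (∀ y ∈ N, σ y ∈ S ∧ π (σ y) = y) ∧ σ (π p) = p
  ker : ∀ p ∈ S, ∀ v ∈ S.direction, HasVelocity (fun t : ℝ => π (p + (t : ℂ) • v)) 0 ↔ v ∈ E p
  connected : ∀ p ∈ S, ∀ p' ∈ S, π p = π p' → ∃ c : ℝ → Loop 𝔤, IsPlot c ∧ c 0 = p ∧ c 1 = p' ∧
    ∀ t, c t ∈ S ∧ π (c t) = π p

/-- The hypotheses of the Marsden-Ratiu theorem for the Poisson tensor `P` on `L𝔤`, the
submanifold `S` and the distribution `D`, with `π : S → N` the quotient by `E = D ∩ TS`.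
Invariance of the bracket is required both for functionals that are constant along `D` on all of
`L𝔤` and for those that are so at the points of `S` only. -/
structure MarsdenRatiuHyp (B : LinearMap.BilinForm ℂ 𝔤) (P : Tensor 𝔤)
    (S : AffineSubspace ℂ (Loop 𝔤)) (D : Loop 𝔤 → Submodule ℂ (Loop 𝔤))
    (N : AffineSubspace ℂ (Loop 𝔤)) (π : Loop 𝔤 → Loop 𝔤) : Prop where
  poisson : IsPoissonOn B ⊤ P
  integrable : IsIntegrableOn S fun q => D q ⊓ S.direction
  regular : IsLeafSpace S (fun q => D q ⊓ S.direction) N π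
  invariant : ∀ U : Set (Loop 𝔤), U = Set.univ ∨ U = (S : Set (Loop 𝔤)) →
    ∀ F δF G δG δ, HasGradOn B ⊤ F δF → HasGradOn B ⊤ G δG →
      ConstAlongOn B D U δF → ConstAlongOn B D U δG →
      HasGradOn B ⊤ (bracket B P δF δG) δ → ConstAlongOn B D U δ
  annihilator : ∀ q ∈ S, ∀ v, (∀ d ∈ D q, pairing B v d = 0) → P q v ∈ S.direction ⊔ D q

/-- `Q` is a submanifold of `S` transversal to the distribution `D`:
`T_q S = (D_q ∩ T_q S) ⊕ T_q Q`. -/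
structure IsTransversalManifold (S : AffineSubspace ℂ (Loop 𝔤))
    (D : Loop 𝔤 → Submodule ℂ (Loop 𝔤)) (Q : AffineSubspace ℂ (Loop 𝔤)) : Prop where
  le : Q ≤ S
  sup : ∀ q ∈ Q, (D q ⊓ S.direction) ⊔ Q.direction = S.direction
  disjoint : ∀ q ∈ Q, Disjoint (D q ⊓ S.direction) Q.direction

/-- `PN` is the reduced tensor on the quotient `π : S → N`: `{f, g}^N ∘ π = {F, G} ∘ i_S` for all
extensions `F`, `G` of `f ∘ π`, `g ∘ π` that are constant along `D`; and extensions exist. -/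
structure IsQuotientReduction (B : LinearMap.BilinForm ℂ 𝔤) (P : Tensor 𝔤)
    (S : AffineSubspace ℂ (Loop 𝔤)) (D : Loop 𝔤 → Submodule ℂ (Loop 𝔤))
    (N : AffineSubspace ℂ (Loop 𝔤)) (π : Loop 𝔤 → Loop 𝔤) (PN : Tensor 𝔤) : Prop where
  extend : ∀ f δf, HasGradOn B N f δf → ∃ F δF, HasGradOn B ⊤ F δF ∧
    ConstAlongOn B D S δF ∧ ∀ p ∈ S, F p = f (π p)
  bracket_eq : ∀ f δf g δg, HasGradOn B N f δf → HasGradOn B N g δg →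
    ∀ F δF G δG, HasGradOn B ⊤ F δF → HasGradOn B ⊤ G δG →
      ConstAlongOn B D S δF → ConstAlongOn B D S δG →
      (∀ p ∈ S, F p = f (π p)) → (∀ p ∈ S, G p = g (π p)) →
      ∀ p ∈ S, bracket B P δF δG p = bracket B PN δf δg (π p)

/-- `PQ` is the reduced tensor on the transversal submanifold `Q`: `{f, g}^Q = {F, G} ∘ i_Q` for
all extensions `F`, `G` of `f`, `g` that are constant along `D`; and extensions exist. -/
structure IsTransversalReduction (B : LinearMap.BilinForm ℂ 𝔤) (P : Tensor 𝔤)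
    (S : AffineSubspace ℂ (Loop 𝔤)) (D : Loop 𝔤 → Submodule ℂ (Loop 𝔤))
    (Q : AffineSubspace ℂ (Loop 𝔤)) (PQ : Tensor 𝔤) : Prop where
  extend : ∀ f δf, HasGradOn B Q f δf → ∃ F δF, HasGradOn B ⊤ F δF ∧
    ConstAlongOn B D S δF ∧ ∀ q ∈ Q, F q = f q
  bracket_eq : ∀ f δf g δg, HasGradOn B Q f δf → HasGradOn B Q g δg →
    ∀ F δF G δG, HasGradOn B ⊤ F δF → HasGradOn B ⊤ G δG →
      ConstAlongOn B D S δF → ConstAlongOn B D S δG →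
      (∀ q ∈ Q, F q = f q) → (∀ q ∈ Q, G q = g q) →
      ∀ q ∈ Q, bracket B P δF δG q = bracket B PQ δf δg q

/-! ### Bi-Hamiltonian reduction -/

/-- The input of the bi-Hamiltonian reduction: `Ξ` is a space of Casimirs of `P₁`, independent at
every point and closed under the bracket of `P₂`; `S` is a level set of `Ξ`; and `D` is the
distribution of the Hamiltonian vector fields `P₂ dK`, `K ∈ Ξ`. -/
structure BihamiltonianReductionData (B : LinearMap.BilinForm ℂ 𝔤) (P₁ P₂ : Tensor 𝔤)
    (Ξ : Submodule ℂ (Loop 𝔤 → ℂ)) (S : AffineSubspace ℂ (Loop 𝔤))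
    (D : Loop 𝔤 → Submodule ℂ (Loop 𝔤)) : Prop where
  casimir : ∀ K ∈ Ξ, ∃ κ, HasGradOn B ⊤ K κ ∧ ∀ q, P₁ q (κ q) = 0
  independent : ∀ K ∈ Ξ, ∀ κ, HasGradOn B ⊤ K κ → ∀ q, κ q = 0 → K = 0
  closed : ∀ K ∈ Ξ, ∀ K' ∈ Ξ, ∀ κ κ', HasGradOn B ⊤ K κ → HasGradOn B ⊤ K' κ' →
    bracket B P₂ κ κ' ∈ Ξ
  level : ∃ q₀ : Loop 𝔤, ∀ q, q ∈ S ↔ ∀ K ∈ Ξ, K q = K q₀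
  distribution : ∀ q v, v ∈ D q ↔ ∃ K ∈ Ξ, ∃ κ, HasGradOn B ⊤ K κ ∧ P₂ q (κ q) = v

/-- The space of linear functionals `q ↦ (q|ξ)`, `ξ ∈ V`. -/
def linearFunctionals (B : LinearMap.BilinForm ℂ 𝔤) (V : Submodule ℂ (Loop 𝔤)) :
    Submodule ℂ (Loop 𝔤 → ℂ) where
  carrier := {K | ∃ ξ ∈ V, ∀ q, K q = pairing B q ξ}
  add_mem' := by
    rintro K K' ⟨ξ, hξ, h⟩ ⟨ξ', hξ', h'⟩
    exact ⟨ξ + ξ', V.add_mem hξ hξ', fun q => by simp [h q, h' q]⟩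
  zero_mem' := ⟨0, V.zero_mem, fun q => by simp⟩
  smul_mem' := by
    rintro c K ⟨ξ, hξ, h⟩
    exact ⟨c • ξ, V.smul_mem c hξ, fun q => by simp [h q]⟩

/-! ### The gauge action and Marsden-Weinstein reduction -/

/-- The operator `c d/dx + u` is the pair `(c, u)`; a point `q` of the phase space is `(1, q)`. -/
abbrev Op (𝔤 : Type*) [LieRing 𝔤] [LieAlgebra ℂ 𝔤] : Type _ := ℂ × Loop 𝔤

/-- `ad n` on operators: `[n, c d/dx + u] = [n, u] - c n_x`. -/
def adOp (n : Loop 𝔤) : Module.End ℂ (Op 𝔤) :=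
  LinearMap.prod 0
    ((loopLie n) ∘ₗ LinearMap.snd ℂ ℂ (Loop 𝔤)
      - (LinearMap.toSpanSingleton ℂ (Loop 𝔤) (loopDeriv n)) ∘ₗ LinearMap.fst ℂ ℂ (Loop 𝔤))

/-- `exp (ad n)` for `ad`-nilpotent `n`; the sum is then finite. -/
def expAd (n : Loop 𝔤) : Module.End ℂ (Op 𝔤) :=
  ∑ᶠ k : ℕ, ((k.factorial : ℂ)⁻¹) • (adOp n) ^ k

/-- The adjoint group of a nilpotent algebra `V` of loops: the group of operators generated by
`exp (ad n)`, `n ∈ V`. -/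
def adjointGroup (V : Submodule ℂ (Loop 𝔤)) : Subgroup (Module.End ℂ (Op 𝔤))ˣ :=
  Subgroup.closure {g | ∃ n ∈ V, (g : Module.End ℂ (Op 𝔤)) = expAd n}

/-- The action on points `d/dx + q`. -/
def act (g : Module.End ℂ (Op 𝔤)) (q : Loop 𝔤) : Loop 𝔤 := (g (1, q)).2

/-- The adjoint action on `L𝔤`. -/
def Ad (g : Module.End ℂ (Op 𝔤)) (u : Loop 𝔤) : Loop 𝔤 := (g (0, u)).2

/-- The fundamental vector field of `ξ` at `q` is `v`, where `X_ξ(q)` is the velocity of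
`exp(-t ξ) · q`. -/
def IsFundamental (ξ q v : Loop 𝔤) : Prop :=
  HasVelocity (fun t : ℝ => act (expAd ((-t : ℂ) • ξ)) q) v

/-- The input of Marsden-Weinstein reduction of `L𝔤` with the Poisson tensor `P`, acted upon by
the adjoint group `G` of `V` with momentum map `J`. The dual of `V` is identified with `V'` by
the pairing; the coadjoint action is then `Ad*_g μ = J (Ad_g μ)`. `S` is the level set of the
regular value `μ` and `D` is the tangent distribution to the orbits. -/
structure MarsdenWeinsteinData (B : LinearMap.BilinForm ℂ 𝔤) (P : Tensor 𝔤)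
    (V V' : Submodule ℂ (Loop 𝔤)) (J : Loop 𝔤 → Loop 𝔤) (μ : Loop 𝔤)
    (S : AffineSubspace ℂ (Loop 𝔤)) (D : Loop 𝔤 → Submodule ℂ (Loop 𝔤)) : Prop where
  poisson : IsPoissonOn B ⊤ P
  exp_mem : ∀ ξ ∈ V, ∃ g ∈ adjointGroup V, (g : Module.End ℂ (Op 𝔤)) = expAd ξ
  action : ∀ g ∈ adjointGroup V, ∀ q : Loop 𝔤, g.1 (1, q) = (1, act g.1 q)
  smooth : ∀ g ∈ adjointGroup V, SmoothMapOn Set.univ (act g.1)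
  dual_left : ∀ η ∈ V', (∀ ξ ∈ V, pairing B η ξ = 0) → η = 0
  dual_right : ∀ ξ ∈ V, (∀ η ∈ V', pairing B η ξ = 0) → ξ = 0
  momentum : ∀ q, J q ∈ V'
  hamiltonian : ∀ ξ ∈ V, ∃ δ, HasGradOn B ⊤ (fun q => pairing B (J q) ξ) δ ∧
    ∀ q, IsFundamental ξ q (P q (δ q))
  adjoint_mem : ∀ g ∈ adjointGroup V, ∀ ξ ∈ V, Ad g.1 ξ ∈ V
  coadjoint : ∀ g ∈ adjointGroup V, ∀ η ∈ V', ∀ ξ ∈ V,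
    pairing B (J (Ad g.1 η)) (Ad g.1 ξ) = pairing B η ξ
  equivariant : ∀ g ∈ adjointGroup V, ∀ q, J (act g.1 q) = J (Ad g.1 (J q))
  value_mem : μ ∈ V'
  regular : ∀ q, J q = μ → ∀ η ∈ V', ∃ s, HasVelocity (fun t : ℝ => J (q + (t : ℂ) • s)) η
  level : ∀ q, q ∈ S ↔ J q = μ
  distribution : ∀ q v, v ∈ D q ↔ ∃ ξ ∈ V, IsFundamental ξ q v

/-! ### The Lie-Poisson pencil -/

/-- `P₂(v) = v_x + [q, v]`. -/
def poisson₂ : Tensor 𝔤 := fun q => loopDeriv + loopLie q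

/-- `P₁(v) = [a, v]`. -/
def poisson₁ (a : 𝔤) : Tensor 𝔤 := fun _ => loopLie (constLoop a)

end Loops

/-! ### Good gradings -/

section Grading

variable {𝔤 : Type*} [LieRing 𝔤] [LieAlgebra ℂ 𝔤] (𝒢 : ℤ → Submodule ℂ 𝔤)

/-- `⨁_{i ≤ k} 𝔤_i`. -/
def degLE (k : ℤ) : Submodule ℂ 𝔤 := ⨆ i : ℤ, ⨆ _ : i ≤ k, 𝒢 i

/-- `⨁_{i ≥ k} 𝔤_i`. -/
def degGE (k : ℤ) : Submodule ℂ 𝔤 := ⨆ i : ℤ, ⨆ _ : k ≤ i, 𝒢 i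

/-- `𝔟⁻`. -/
def bMinus : Submodule ℂ 𝔤 := degLE 𝒢 0

/-- `𝔟⁺`. -/
def bPlus : Submodule ℂ 𝔤 := degGE 𝒢 0

/-- `𝔫⁻`. -/
def nMinus : Submodule ℂ 𝔤 := degLE 𝒢 (-1)

/-- `𝔤⁻`. -/
def gMinus : Submodule ℂ 𝔤 := degLE 𝒢 (-2)

/-- `𝔫⁺`. -/
def nPlus : Submodule ℂ 𝔤 := degGE 𝒢 1

/-- The projection of `𝔤` to `𝔫⁺` along `𝔟⁻`. -/
def projPlus [GradedLieAlgebra 𝒢] : 𝔤 →ₗ[ℂ] 𝔤 :=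
  DirectSum.coeLinearMap 𝒢 ∘ₗ
    (DFinsupp.filterLinearMap ℂ (fun i => 𝒢 i) (fun i : ℤ => 1 ≤ i) :
      (DirectSum ℤ fun i => 𝒢 i) →ₗ[ℂ] (DirectSum ℤ fun i => 𝒢 i)) ∘ₗ
    (DirectSum.decomposeLinearEquiv 𝒢 : 𝔤 →ₗ[ℂ] DirectSum ℤ fun i => 𝒢 i)

/-- `e` is a good element: `e ∈ 𝔤₂` and `ad e : 𝔤_j → 𝔤_{j+2}` is injective for `j ≤ -1`. -/
structure IsGoodElement (e : 𝔤) : Prop where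
  mem : e ∈ 𝒢 2
  injective : ∀ j : ℤ, j ≤ -1 → ∀ v ∈ 𝒢 j, ⁅e, v⁆ = 0 → v = 0

/-- `C` is a (graded) transversal subspace of `e`: `ad e (𝔤⁻) ⊕ C = 𝔟⁻`. -/
structure IsTransversalSubspace (e : 𝔤) (C : Submodule ℂ 𝔤) : Prop where
  graded : C = ⨆ i : ℤ, C ⊓ 𝒢 i
  disjoint : Disjoint ((gMinus 𝒢).map (LieAlgebra.ad ℂ 𝔤 e)) C
  sup : (gMinus 𝒢).map (LieAlgebra.ad ℂ 𝔤 e) ⊔ C = bMinus 𝒢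

variable [Module.Finite ℂ 𝔤]

/-- `S = e + L𝔟⁻`. -/
def levelManifold (e : 𝔤) : AffineSubspace ℂ (Loop 𝔤) :=
  AffineSubspace.mk' (constLoop e) (loopsIn (bMinus 𝒢))

/-- `D = P₂(L𝔫⁻)`. -/
def reductionDistribution (q : Loop 𝔤) : Submodule ℂ (Loop 𝔤) :=
  (loopsIn (nMinus 𝒢)).map (poisson₂ q)

/-- `Q = e + LC`. -/
def transversalManifold (e : 𝔤) (C : Submodule ℂ 𝔤) : AffineSubspace ℂ (Loop 𝔤) :=
  AffineSubspace.mk' (constLoop e) (loopsIn C)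

end Grading

end LoopReduction

end

set_option linter.unusedSectionVars false

noncomputable section

namespace LoopReduction

/-! ### Graded pieces -/

section GradedPieces

variable {𝔤 : Type*} [LieRing 𝔤] [LieAlgebra ℂ 𝔤] (𝒢 : ℤ → Submodule ℂ 𝔤)

/-! Two algebraic facts carry the theorem. The first: an element of minimal degree in the
transversal subspace `C` sits in the lowest degree of the whole grading, so it commutes with `𝔫⁻`
(`IsTransversalSubspace.lie_eq_zero`). Hence every `P_λ` agrees with `P₂` on `L𝔫⁻`, and neither the
Hamiltonian fields of the linear functionals, nor the distribution `D`, nor the momentum map sees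
`λ`. Because `𝔟⁻` is the orthogonal of `𝔫⁻`, skew-symmetry then gives `P_λ(D⁰) ⊂ L𝔟⁻ = TS`
(`affineTensor_mem`). Together with the Jacobi identity for `F`, `G` and a linear functional, this
makes the bracket of functionals constant along `D` again constant along `D`
(`constAlongOn_bracket`).

The second: `ad e` is injective on `𝔫⁻`, and `[e, 𝔫⁻] ⊕ C` is the sum of all `𝔤_i` with `i ≤ 1`.
This yields a partial inverse `ρ` of `ad e` that lowers degrees by two
(`IsTransversalSubspace.exists_partialInverse`). At points of `e + ⨁_{i ≤ 1} L𝔤_i` the remaining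
terms of `P₂` raise degrees by at most one, so problems about `P₂` and about gauge orbits are solved
degree by degree, in finitely many steps. This gives the splitting `TS = E ⊕ TQ`, the freeness of
the gauge action (`eq_one_of_act_sub`) and the gauge fixing map `gaugeFix`, an iteration of `p ↦
exp(ρ(p - e)) · p` (`sweep_spec`).

The gauge fixing map serves as `π`. It is a finite composition of brackets, `x`-derivatives and
linear maps, so its derivative has a smooth adjoint for the pairing, and `f ∘ π` has a smooth
gradient. It is invariant under all of `N⁻` on `e + ⨁_{i ≤ 1} L𝔤_i`, and not only under `G⁻` on `S`;
therefore its derivative kills the whole of `D` along `S`, and `f ∘ π` is an admissible extension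
for both reductions. The reduced tensor is `dπ ∘ P ∘ dπ*`. It is the right one because at points of
`Q` the bracket depends only on the differentials along `TQ` (`pairing_affineTensor_eq`), and
because brackets of admissible functionals are constant on the leaves.

Group elements are handled without logarithms: comparison with the grading element extracts the
leading term of `Ad g - 1` as a bracket (`IsGauge.exists_leading`), and dividing by its exponential
lowers the degree. -/

theorem degLE_le {k : ℤ} {p : Submodule ℂ 𝔤} : degLE 𝒢 k ≤ p ↔ ∀ i ≤ k, 𝒢 i ≤ p :=
  iSup₂_le_iff

theorem degGE_le {k : ℤ} {p : Submodule ℂ 𝔤} : degGE 𝒢 k ≤ p ↔ ∀ i, k ≤ i → 𝒢 i ≤ p :=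
  iSup₂_le_iff

theorem le_degLE {i k : ℤ} (h : i ≤ k) : 𝒢 i ≤ degLE 𝒢 k := (degLE_le 𝒢).1 le_rfl i h

theorem le_degGE {i k : ℤ} (h : k ≤ i) : 𝒢 i ≤ degGE 𝒢 k := (degGE_le 𝒢).1 le_rfl i h

theorem degLE_mono {k l : ℤ} (h : k ≤ l) : degLE 𝒢 k ≤ degLE 𝒢 l :=
  (degLE_le 𝒢).2 fun _ hi => le_degLE 𝒢 (hi.trans h)

variable [GradedLieAlgebra 𝒢]

/-- The projection of `𝔤` to the sum of the homogeneous components whose degree satisfies `p`. -/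
def filterPart (p : ℤ → Prop) [DecidablePred p] : 𝔤 →ₗ[ℂ] 𝔤 :=
  DirectSum.coeLinearMap 𝒢 ∘ₗ
    (DFinsupp.filterLinearMap ℂ (fun i => 𝒢 i) p :
      (DirectSum ℤ fun i => 𝒢 i) →ₗ[ℂ] (DirectSum ℤ fun i => 𝒢 i)) ∘ₗ
    (DirectSum.decomposeLinearEquiv 𝒢 : 𝔤 →ₗ[ℂ] DirectSum ℤ fun i => 𝒢 i)

/-- The homogeneous component of degree `i`. -/
def part (i : ℤ) : 𝔤 →ₗ[ℂ] 𝔤 := filterPart 𝒢 (· = i)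

theorem filterPart_of_mem (p : ℤ → Prop) [DecidablePred p] {i : ℤ} {x : 𝔤} (hx : x ∈ 𝒢 i) :
    filterPart 𝒢 p x = if p i then x else 0 := by
  simp only [filterPart, LinearMap.comp_apply, LinearEquiv.coe_coe,
    DirectSum.decomposeLinearEquiv_apply, DirectSum.decompose_of_mem 𝒢 hx]
  have h : DFinsupp.filterLinearMap ℂ (fun i => 𝒢 i) p
      (DirectSum.of (fun i => 𝒢 i) i ⟨x, hx⟩ : DirectSum ℤ fun i => 𝒢 i) =
      if p i then DirectSum.of (fun i => 𝒢 i) i ⟨x, hx⟩ else 0 :=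
    DFinsupp.filter_single p i _
  rw [h]
  split_ifs <;> simp

theorem part_self {i : ℤ} {x : 𝔤} (hx : x ∈ 𝒢 i) : part 𝒢 i x = x := by
  simp [part, filterPart_of_mem 𝒢 _ hx]

theorem part_of_ne {i j : ℤ} {x : 𝔤} (hx : x ∈ 𝒢 j) (h : j ≠ i) : part 𝒢 i x = 0 := by
  simp [part, filterPart_of_mem 𝒢 _ hx, h]

/-- A linear property holds everywhere if it holds on homogeneous elements. -/
theorem linear_induction {V : Type*} [AddCommGroup V] [Module ℂ V] {f g : 𝔤 →ₗ[ℂ] V}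
    (h : ∀ i, ∀ x ∈ 𝒢 i, f x = g x) : f = g := by
  ext x
  induction x using DirectSum.Decomposition.inductionOn 𝒢 with
  | zero => simp
  | homogeneous m => exact h _ _ m.2
  | add m m' hm hm' => simp [hm, hm']

theorem part_mem (i : ℤ) (x : 𝔤) : part 𝒢 i x ∈ 𝒢 i := by
  induction x using DirectSum.Decomposition.inductionOn 𝒢 with
  | zero => simp
  | @homogeneous j m =>
    by_cases h : j = i
    · subst h; rw [part_self 𝒢 m.2]; exact m.2
    · rw [part_of_ne 𝒢 m.2 h]; exact zero_mem _
  | add m m' hm hm' => rw [map_add]; exact add_mem hm hm'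

theorem part_filterPart (p : ℤ → Prop) [DecidablePred p] (i : ℤ) (x : 𝔤) :
    part 𝒢 i (filterPart 𝒢 p x) = if p i then part 𝒢 i x else 0 := by
  induction x using DirectSum.Decomposition.inductionOn 𝒢 with
  | zero => simp
  | @homogeneous j m =>
    rw [filterPart_of_mem 𝒢 p m.2]
    by_cases h : j = i
    · subst h; split_ifs <;> simp
    · rw [part_of_ne 𝒢 m.2 h]; split_ifs <;> simp [part_of_ne 𝒢 m.2 h]
  | add m m' hm hm' => simp only [map_add, hm, hm']; split_ifs <;> simp

/-- An element all of whose components lie in `p` lies in `p`. -/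
theorem mem_of_part_mem {p : Submodule ℂ 𝔤} {x : 𝔤} (h : ∀ i, part 𝒢 i x ∈ p) : x ∈ p := by
  classical
  rw [← DirectSum.sum_support_decompose 𝒢 x]
  refine sum_mem fun i _ => ?_
  have : part 𝒢 i x = DirectSum.decompose 𝒢 x i := by
    conv_lhs => rw [← DirectSum.sum_support_decompose 𝒢 x, map_sum]
    rw [Finset.sum_eq_single i]
    · exact part_self 𝒢 (SetLike.coe_mem _)
    · exact fun j _ hj => part_of_ne 𝒢 (SetLike.coe_mem _) hj
    · intro hi; rw [DFinsupp.notMem_support_iff.mp hi]; simp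
  exact this ▸ h i

theorem eq_zero_of_part {x : 𝔤} (h : ∀ i, part 𝒢 i x = 0) : x = 0 := by
  have : x ∈ (⊥ : Submodule ℂ 𝔤) := mem_of_part_mem 𝒢 fun i => by simp [h i]
  simpa using this

theorem mem_degLE {k : ℤ} {x : 𝔤} : x ∈ degLE 𝒢 k ↔ ∀ i, k < i → part 𝒢 i x = 0 := by
  refine ⟨fun hx i hi => ?_, fun h => mem_of_part_mem 𝒢 fun i => ?_⟩
  · have : degLE 𝒢 k ≤ LinearMap.ker (part 𝒢 i) :=
      (degLE_le 𝒢).2 fun j hj x hx => part_of_ne 𝒢 hx (by omega)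
    exact this hx
  · by_cases hi : k < i
    · rw [h i hi]; exact zero_mem _
    · exact le_degLE 𝒢 (not_lt.1 hi) (part_mem 𝒢 i x)

theorem mem_degGE {k : ℤ} {x : 𝔤} : x ∈ degGE 𝒢 k ↔ ∀ i, i < k → part 𝒢 i x = 0 := by
  refine ⟨fun hx i hi => ?_, fun h => mem_of_part_mem 𝒢 fun i => ?_⟩
  · have : degGE 𝒢 k ≤ LinearMap.ker (part 𝒢 i) :=
      (degGE_le 𝒢).2 fun j hj x hx => part_of_ne 𝒢 hx (by omega)
    exact this hx
  · by_cases hi : i < k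
    · rw [h i hi]; exact zero_mem _
    · exact le_degGE 𝒢 (not_lt.1 hi) (part_mem 𝒢 i x)

/-- `⨁_{i ≤ k} 𝔤_i = 𝔤_k + ⨁_{i ≤ k - 1} 𝔤_i`. -/
theorem sub_part_mem_degLE {k : ℤ} {x : 𝔤} (hx : x ∈ degLE 𝒢 k) :
    x - part 𝒢 k x ∈ degLE 𝒢 (k - 1) := by
  rw [mem_degLE] at hx ⊢
  intro i hi
  rw [map_sub, sub_eq_zero]
  rcases eq_or_ne k i with rfl | h
  · exact (part_self 𝒢 (part_mem 𝒢 _ _)).symm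
  · rw [hx i (by omega), part_of_ne 𝒢 (part_mem 𝒢 k x) h]

theorem eq_zero_of_mem_of_mem_degLE {k l : ℤ} {x : 𝔤} (hx : x ∈ 𝒢 k) (hx' : x ∈ degLE 𝒢 l)
    (h : l < k) : x = 0 := by
  rw [← part_self 𝒢 hx]; exact (mem_degLE 𝒢).1 hx' k h

theorem lie_mem_degLE {i j : ℤ} {x y : 𝔤} (hx : x ∈ degLE 𝒢 i) (hy : y ∈ degLE 𝒢 j) :
    ⁅x, y⁆ ∈ degLE 𝒢 (i + j) := by
  have h : degLE 𝒢 i ≤ (degLE 𝒢 (i + j)).comap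
      ((LieModule.toEnd ℂ 𝔤 𝔤 : 𝔤 →ₗ[ℂ] Module.End ℂ 𝔤).flip y) := by
    refine (degLE_le 𝒢).2 fun i' hi x hx => ?_
    have h' : degLE 𝒢 j ≤ (degLE 𝒢 (i + j)).comap (LieModule.toEnd ℂ 𝔤 𝔤 x) :=
      (degLE_le 𝒢).2 fun j' hj y hy => le_degLE 𝒢 (by omega : i' + j' ≤ i + j)
        (SetLike.GradedBracket.bracket_mem hx hy)
    exact h' hy
  exact h hx

theorem part_lie {k : ℤ} {e : 𝔤} (he : e ∈ 𝒢 k) (i : ℤ) (x : 𝔤) :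
    part 𝒢 (k + i) ⁅e, x⁆ = ⁅e, part 𝒢 i x⁆ := by
  have : (part 𝒢 (k + i)) ∘ₗ (LieModule.toEnd ℂ 𝔤 𝔤 e) =
      (LieModule.toEnd ℂ 𝔤 𝔤 e) ∘ₗ (part 𝒢 i) := by
    refine linear_induction 𝒢 fun j y hy => ?_
    have hm := SetLike.GradedBracket.bracket_mem he hy
    simp only [LinearMap.comp_apply, LieModule.toEnd_apply_apply]
    rcases eq_or_ne j i with rfl | h
    · rw [part_self 𝒢 hm, part_self 𝒢 hy]
    · rw [part_of_ne 𝒢 hm (by omega), part_of_ne 𝒢 hy h, lie_zero]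
  exact LinearMap.congr_fun this x

theorem exists_bound [Module.Finite ℂ 𝔤] : ∃ M : ℕ, ∀ i : ℤ, (M : ℤ) < |i| → 𝒢 i = ⊥ := by
  have hf : {i | 𝒢 i ≠ ⊥}.Finite :=
    WellFoundedGT.finite_ne_bot_of_iSupIndep (DirectSum.Decomposition.isInternal 𝒢).submodule_iSupIndep
  obtain ⟨M, hM⟩ := (hf.image Int.natAbs).bddAbove
  refine ⟨M, fun i hi => ?_⟩
  by_contra h
  have := hM (Set.mem_image_of_mem _ (show i ∈ {i | 𝒢 i ≠ ⊥} from h))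
  rw [Int.abs_eq_natAbs] at hi
  omega

/-- The lower half of the graded algebra is bounded. -/
theorem exists_degLE_bounds [Module.Finite ℂ 𝔤] :
    ∃ M : ℕ, degLE 𝒢 (-(M : ℤ)) = ⊥ ∧ degLE 𝒢 (M : ℤ) = ⊤ := by
  obtain ⟨M, hM⟩ := exists_bound 𝒢
  -- The bound `M` is strict, so one more degree is needed for the component of degree `-(M + 1)` to
  -- vanish.
  refine ⟨M + 1, ?_, ?_⟩
  · rw [eq_bot_iff, degLE_le]
    intro i hi
    rw [hM i (by push_cast at hi; rw [abs_of_neg] <;> omega)]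
  · rw [eq_top_iff]
    intro x _
    rw [mem_degLE]
    intro i hi
    have := part_mem 𝒢 i x
    rw [hM i (by push_cast at hi; rw [abs_of_pos] <;> omega)] at this
    simpa using this

end GradedPieces

/-! ### Simple graded algebras -/

/-- Invariance of a form in its associative version. -/
theorem invariant_assoc {𝔤 : Type*} [LieRing 𝔤] [LieAlgebra ℂ 𝔤]
    {B : LinearMap.BilinForm ℂ 𝔤} (hBinv : B.lieInvariant 𝔤) (x y z : 𝔤) :
    B ⁅x, y⁆ z = B x ⁅y, z⁆ := by
  rw [← lie_skew x y, map_neg, LinearMap.neg_apply, hBinv y x z, neg_neg]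

section Simple

variable {𝔤 : Type*} [LieRing 𝔤] [LieAlgebra ℂ 𝔤] [LieAlgebra.IsSimple ℂ 𝔤]
  {B : LinearMap.BilinForm ℂ 𝔤}

theorem eq_zero_of_lie_eq_zero {r : 𝔤} (h : ∀ u : 𝔤, ⁅r, u⁆ = 0) : r = 0 := by
  have hc : LieAlgebra.center ℂ 𝔤 = ⊥ := by
    have := LieAlgebra.center_eq_bot ℂ 𝔤
    exact this
  have : r ∈ LieAlgebra.center ℂ 𝔤 := by
    rw [LieModule.mem_maxTrivSubmodule]
    intro x
    rw [← lie_skew, h x, neg_zero]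
  rw [hc] at this
  simpa using this

/-- An invariant bilinear form on a simple Lie algebra is symmetric. -/
theorem invariant_isSymm (hBinv : B.lieInvariant 𝔤) (x y : 𝔤) : B x y = B y x := by
  have htop : ⁅(⊤ : LieIdeal ℂ 𝔤), (⊤ : LieIdeal ℂ 𝔤)⁆ = ⊤ := by
    rcases LieAlgebra.IsSimple.eq_bot_or_eq_top ⁅(⊤ : LieIdeal ℂ 𝔤), (⊤ : LieIdeal ℂ 𝔤)⁆ with h | h
    · exfalso
      apply LieAlgebra.IsSimple.non_abelian ℂ (L := 𝔤)
      refine ⟨fun x y => ?_⟩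
      have : ⁅x, y⁆ ∈ ⁅(⊤ : LieIdeal ℂ 𝔤), (⊤ : LieIdeal ℂ 𝔤)⁆ :=
        LieSubmodule.lie_mem_lie (by simp) (by simp)
      rw [h] at this
      simpa using this
    · exact h
  have hx : x ∈ ⁅(⊤ : LieIdeal ℂ 𝔤), (⊤ : LieIdeal ℂ 𝔤)⁆ := by rw [htop]; simp
  -- The trilinear form `B([u,v], w) - B(w, [u,v])` is symmetric in `v, w` and antisymmetric in `u,
  -- v`. These transpositions are conjugate, so the form vanishes; brackets span a simple algebra.
  have key : ∀ u v w : 𝔤, B ⁅u, v⁆ w = B w ⁅u, v⁆ := by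
    have h1 : ∀ u v w : 𝔤, B ⁅u, v⁆ w - B w ⁅u, v⁆ = B ⁅u, w⁆ v - B v ⁅u, w⁆ := by
      intro u v w
      rw [hBinv u v w, hBinv u w v]; ring
    have h2 : ∀ u v w : 𝔤, B ⁅u, v⁆ w - B w ⁅u, v⁆ = -(B ⁅v, u⁆ w - B w ⁅v, u⁆) := by
      intro u v w
      rw [← lie_skew v u]; simp only [map_neg, LinearMap.neg_apply]; ring
    intro u v w
    have e1 := h1 u v w
    have e2 := h2 u w v
    have e3 := h1 w u v
    have e4 := h2 w v u
    have e5 := h1 v w u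
    have e6 := h2 v u w
    have : B ⁅u, v⁆ w - B w ⁅u, v⁆ = 0 := by linear_combination (1/2) * (e1 + e2 - e3 - e4 + e5 + e6)
    linear_combination this
  rw [← LieSubmodule.mem_toSubmodule, LieSubmodule.lieIdeal_oper_eq_linear_span'] at hx
  induction hx using Submodule.span_induction with
  | mem z hz => obtain ⟨u, -, v, -, rfl⟩ := hz; exact key u v y
  | zero => simp
  | add u v _ _ hu hv => simp [hu, hv]
  | smul c u _ hu => simp [hu]

variable [Module.Finite ℂ 𝔤] (𝒢 : ℤ → Submodule ℂ 𝔤) [GradedLieAlgebra 𝒢]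

/-- The grading of a simple Lie algebra is given by a semisimple element. -/
theorem exists_grading_element : ∃ h : 𝔤, ∀ i, ∀ x ∈ 𝒢 i, ⁅h, x⁆ = (i : ℂ) • x := by
  -- Multiplication by the degree is a derivation, and derivations of a simple algebra are inner.
  obtain ⟨h, hh⟩ := LieDerivation.IsKilling.exists_eq_ad
    (LieDerivation.ofGrading 𝒢 (Int.castAddHom ℂ))
  refine ⟨h, fun i x hx => ?_⟩
  have := LieDerivation.congr_fun hh x
  rw [LieDerivation.ad_apply_apply] at this
  rw [this, LieDerivation.ofGrading_apply_apply 𝒢 _ hx]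
  rfl

/-- Invariance under the grading element multiplies the form by `i + j` and gives zero. -/
theorem form_eq_zero (hBinv : B.lieInvariant 𝔤) {i j : ℤ} (hij : i + j ≠ 0) {x y : 𝔤}
    (hx : x ∈ 𝒢 i) (hy : y ∈ 𝒢 j) : B x y = 0 := by
  obtain ⟨h, hh⟩ := exists_grading_element 𝒢
  have h1 := hBinv h x y
  rw [hh i x hx, hh j y hy] at h1
  simp only [map_smul, LinearMap.smul_apply, smul_eq_mul] at h1
  have h2 : ((i + j : ℤ) : ℂ) * B x y = 0 := by push_cast; linear_combination h1
  exact (mul_eq_zero.1 h2).resolve_left (by exact_mod_cast hij)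

theorem form_part (hBinv : B.lieInvariant 𝔤) (i : ℤ) (x y : 𝔤) :
    B (part 𝒢 i x) y = B x (part 𝒢 (-i) y) := by
  have : B ∘ₗ part 𝒢 i = B.compl₂ (part 𝒢 (-i)) := by
    refine linear_induction 𝒢 fun j x hx => linear_induction 𝒢 fun k y hy => ?_
    simp only [LinearMap.comp_apply, LinearMap.compl₂_apply]
    by_cases hj : j = i
    · subst hj
      rw [part_self 𝒢 hx]
      by_cases hk : k = -j
      · subst hk; rw [part_self 𝒢 hy]
      · rw [part_of_ne 𝒢 hy hk, map_zero, form_eq_zero 𝒢 hBinv (by omega) hx hy]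
    · rw [part_of_ne 𝒢 hx hj, map_zero, LinearMap.zero_apply]
      by_cases hk : k = -i
      · subst hk; rw [part_self 𝒢 hy, form_eq_zero 𝒢 hBinv (by omega) hx hy]
      · rw [part_of_ne 𝒢 hy hk, map_zero]
  exact LinearMap.congr_fun (LinearMap.congr_fun this x) y

variable {𝒢} in
-- The form pairs degree `i` with degree `-i` only. The case `k = 0` says that `𝔟⁻` is the
-- orthogonal of `𝔫⁻`, which is how `S`, `D` and the momentum map fit together.
theorem mem_degLE_iff_form (hB : B.Nondegenerate) (hBinv : B.lieInvariant 𝔤) {k : ℤ} {x : 𝔤} :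
    x ∈ degLE 𝒢 k ↔ ∀ y ∈ degLE 𝒢 (-k - 1), B x y = 0 := by
  rw [mem_degLE]
  constructor
  · intro h y hy
    have : y ∈ LinearMap.ker (B x) := by
      refine mem_of_part_mem 𝒢 fun i => ?_
      rw [LinearMap.mem_ker]
      by_cases hi : -k - 1 < i
      · rw [(mem_degLE 𝒢).1 hy i hi, map_zero]
      · have := form_part 𝒢 hBinv (-i) x y
        rw [neg_neg] at this
        rw [← this, h _ (by omega), map_zero, LinearMap.zero_apply]
    exact this
  · intro h i hi
    refine hB.1 _ fun y => ?_
    rw [form_part 𝒢 hBinv]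
    exact h _ (le_degLE 𝒢 (by omega) (part_mem 𝒢 _ _))

theorem form_degGE (hBinv : B.lieInvariant 𝔤) {k l : ℤ} (hkl : 0 < k + l) {x y : 𝔤}
    (hx : x ∈ degGE 𝒢 k) (hy : y ∈ degGE 𝒢 l) : B x y = 0 := by
  have : y ∈ LinearMap.ker (B x) := by
    refine mem_of_part_mem 𝒢 fun i => ?_
    rw [LinearMap.mem_ker]
    by_cases hi : i < l
    · rw [(mem_degGE 𝒢).1 hy i hi, map_zero]
    · have := form_part 𝒢 hBinv (-i) x y
      rw [neg_neg] at this
      rw [← this, (mem_degGE 𝒢).1 hx _ (by omega), map_zero, LinearMap.zero_apply]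
  exact this

/-- Adjoints with respect to a nondegenerate form. -/
theorem exists_adjoint (hB : B.Nondegenerate) (T : 𝔤 →ₗ[ℂ] 𝔤) :
    ∃ T' : 𝔤 →ₗ[ℂ] 𝔤, ∀ x y, B (T' x) y = B x (T y) :=
  ⟨B.leftAdjointOfNondegenerate hB T, fun x y =>
    LinearMap.BilinForm.isAdjointPairLeftAdjointOfNondegenerate B hB T x y⟩

variable {𝒢}

/-- Nondegeneracy embeds `𝔤_i` into the dual of `𝔤_{-i}`. -/
theorem finrank_le_of_form (hB : B.Nondegenerate) (hBinv : B.lieInvariant 𝔤) (i : ℤ) :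
    Module.finrank ℂ (𝒢 i) ≤ Module.finrank ℂ (𝒢 (-i)) := by
  rw [← Subspace.dual_finrank_eq (V := 𝒢 (-i))]
  refine LinearMap.finrank_le_finrank_of_injective
    (f := (𝒢 (-i)).subtype.dualMap ∘ₗ B ∘ₗ (𝒢 i).subtype) ?_
  rw [← LinearMap.ker_eq_bot, LinearMap.ker_eq_bot']
  intro x hx
  ext
  refine hB.1 _ fun y => ?_
  have := LinearMap.congr_fun hx ⟨part 𝒢 (-i) y, part_mem 𝒢 _ _⟩
  simp only [LinearMap.comp_apply, LinearMap.dualMap_apply, Submodule.subtype_apply,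
    LinearMap.zero_apply] at this
  rw [← form_part 𝒢 hBinv, part_self 𝒢 x.2] at this
  exact this

/-! ### Good elements and transversal subspaces -/

theorem IsGoodElement.eq_zero {e : 𝔤} (he : IsGoodElement 𝒢 e) {x : 𝔤} (hx : x ∈ degLE 𝒢 (-1))
    (h : ⁅e, x⁆ = 0) : x = 0 := by
  refine eq_zero_of_part 𝒢 fun i => ?_
  by_cases hi : -1 < i
  · exact (mem_degLE 𝒢).1 hx i hi
  · refine he.injective i (by omega) _ (part_mem 𝒢 i x) ?_
    rw [← part_lie 𝒢 he.mem, h, map_zero]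

/-- `ad e` is injective from `𝔤_{-1}` to `𝔤_1`, and duality bounds the dimension of the target by
that of the source. Goodness thus reaches degree one, which the transversality equation for `𝔟⁻`
does not cover. -/
theorem IsGoodElement.exists_lie_eq {e : 𝔤} (he : IsGoodElement 𝒢 e) (hB : B.Nondegenerate)
    (hBinv : B.lieInvariant 𝔤) {y : 𝔤} (hy : y ∈ 𝒢 1) : ∃ x ∈ 𝒢 (-1), ⁅e, x⁆ = y := by
  have h1 : (𝒢 (-1)).map (LieAlgebra.ad ℂ 𝔤 e) ≤ 𝒢 1 := by
    rintro _ ⟨x, hx, rfl⟩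
    exact SetLike.GradedBracket.bracket_mem he.mem hx
  have h2 : (𝒢 (-1)).map (LieAlgebra.ad ℂ 𝔤 e) = 𝒢 1 := by
    refine Submodule.eq_of_le_of_finrank_le h1 ((finrank_le_of_form hB hBinv 1).trans ?_)
    refine LinearMap.finrank_le_finrank_of_injective
      (f := (LieAlgebra.ad ℂ 𝔤 e).submoduleMap (𝒢 (-1))) ?_
    rw [← LinearMap.ker_eq_bot, LinearMap.ker_eq_bot']
    intro x hx
    ext
    exact he.injective (-1) le_rfl x x.2 (congrArg Subtype.val hx)
  rw [← h2] at hy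
  exact hy

variable {e : 𝔤} {C : Submodule ℂ 𝔤}

theorem IsTransversalSubspace.le (hC : IsTransversalSubspace 𝒢 e C) : C ≤ degLE 𝒢 0 :=
  le_sup_right.trans hC.sup.le

theorem IsTransversalSubspace.part_mem (hC : IsTransversalSubspace 𝒢 e C) (i : ℤ) {x : 𝔤}
    (hx : x ∈ C) : part 𝒢 i x ∈ C := by
  have : C ≤ C.comap (part 𝒢 i) := by
    conv_lhs => rw [hC.graded]
    refine iSup_le fun j x hx => ?_
    rw [Submodule.mem_comap]
    rcases eq_or_ne j i with rfl | h
    · rw [part_self 𝒢 hx.2]; exact hx.1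
    · rw [part_of_ne 𝒢 hx.2 h]; exact zero_mem _
  exact this hx

/-- `C` is graded, so the component of degree `j` of any decomposition is again a decomposition. -/
theorem IsTransversalSubspace.exists_homogeneous (hC : IsTransversalSubspace 𝒢 e C)
    (he : IsGoodElement 𝒢 e) {j : ℤ} (hj : j ≤ 0) {y : 𝔤} (hy : y ∈ 𝒢 j) :
    ∃ x ∈ 𝒢 (j - 2), ∃ c ∈ C ⊓ 𝒢 j, y = ⁅e, x⁆ + c := by
  have hy' : y ∈ (gMinus 𝒢).map (LieAlgebra.ad ℂ 𝔤 e) ⊔ C := by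
    rw [hC.sup]; exact le_degLE 𝒢 hj hy
  obtain ⟨_, ⟨x, -, rfl⟩, c, hc, h⟩ := Submodule.mem_sup.1 hy'
  refine ⟨part 𝒢 (j - 2) x, LoopReduction.part_mem 𝒢 _ _, part 𝒢 j c,
    ⟨hC.part_mem j hc, LoopReduction.part_mem 𝒢 _ _⟩, ?_⟩
  have := congrArg (part 𝒢 j) h
  rw [part_self 𝒢 hy, map_add] at this
  rw [← this, ← part_lie 𝒢 he.mem, show (2 : ℤ) + (j - 2) = j by ring]
  rfl

theorem IsTransversalSubspace.exists_decomposition (hC : IsTransversalSubspace 𝒢 e C)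
    (he : IsGoodElement 𝒢 e) (hB : B.Nondegenerate) (hBinv : B.lieInvariant 𝔤) {i : ℤ}
    (hi : i ≤ 1) {y : 𝔤} (hy : y ∈ degLE 𝒢 i) :
    ∃ x ∈ degLE 𝒢 (i - 2), y - ⁅e, x⁆ ∈ C := by
  have : degLE 𝒢 i ≤ (degLE 𝒢 (i - 2)).map (LieAlgebra.ad ℂ 𝔤 e) ⊔ C := by
    refine (degLE_le 𝒢).2 fun j hj y hy => ?_
    rcases eq_or_lt_of_le (hj.trans hi) with rfl | hj1
    · obtain ⟨x, hx, rfl⟩ := he.exists_lie_eq hB hBinv hy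
      exact Submodule.mem_sup_left ⟨x, le_degLE 𝒢 (by omega) hx, rfl⟩
    · obtain ⟨x, hx, c, hc, rfl⟩ := hC.exists_homogeneous he (by omega : j ≤ 0) hy
      exact add_mem (Submodule.mem_sup_left ⟨x, le_degLE 𝒢 (by omega) hx, rfl⟩)
        (Submodule.mem_sup_right hc.1)
  obtain ⟨_, ⟨x, hx, rfl⟩, c, hc, rfl⟩ := Submodule.mem_sup.1 (this hy)
  exact ⟨x, hx, by simpa using hc⟩

/-- `C` has nothing in degree one, so the component of `x` of degree `-1` is killed by `ad e` and
vanishes. What is left lies in `𝔤⁻`, where directness of the sum applies. -/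
theorem IsTransversalSubspace.eq_zero_of_lie_mem (hC : IsTransversalSubspace 𝒢 e C)
    (he : IsGoodElement 𝒢 e) {x : 𝔤} (hx : x ∈ degLE 𝒢 (-1)) (h : ⁅e, x⁆ ∈ C) : x = 0 := by
  have h1 : part 𝒢 (-1) x = 0 := by
    refine he.injective (-1) le_rfl _ (LoopReduction.part_mem 𝒢 _ _) ?_
    rw [← part_lie 𝒢 he.mem]
    exact (mem_degLE 𝒢).1 (hC.le h) _ (by norm_num)
  have h2 : x ∈ gMinus 𝒢 := by
    have := sub_part_mem_degLE 𝒢 hx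
    rwa [h1, sub_zero] at this
  have h3 := Submodule.disjoint_def.1 hC.disjoint _ ⟨x, h2, rfl⟩ h
  exact he.eq_zero hx h3

/-- A partial inverse `ρ` of `ad e`, vanishing on the transversal subspace. -/
structure IsPartialInverse (𝒢 : ℤ → Submodule ℂ 𝔤) (e : 𝔤) (C : Submodule ℂ 𝔤)
    (ρ : 𝔤 →ₗ[ℂ] 𝔤) : Prop where
  lie : ∀ x ∈ degLE 𝒢 (-1), ρ ⁅e, x⁆ = x
  zero : ∀ c ∈ C, ρ c = 0
  range : ∀ x, ρ x ∈ degLE 𝒢 (-1)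
  lowers : ∀ i, ∀ x ∈ degLE 𝒢 i, ρ x ∈ degLE 𝒢 (i - 2)
  sub_mem : ∀ x ∈ degLE 𝒢 1, x - ⁅e, ρ x⁆ ∈ C

/-- The map `(x, c) ↦ [e,x] + c` on `𝔫⁻ × C` is injective; `ρ` is the first component of an
arbitrary linear left inverse. The choice matters only outside the image, that is, in degrees above
one. -/
theorem IsTransversalSubspace.exists_partialInverse (hC : IsTransversalSubspace 𝒢 e C)
    (he : IsGoodElement 𝒢 e) (hB : B.Nondegenerate) (hBinv : B.lieInvariant 𝔤) :
    ∃ ρ : 𝔤 →ₗ[ℂ] 𝔤, IsPartialInverse 𝒢 e C ρ := by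
  let Φ : (degLE 𝒢 (-1) × C) →ₗ[ℂ] 𝔤 :=
    ((LieModule.toEnd ℂ 𝔤 𝔤 e).comp (degLE 𝒢 (-1)).subtype).coprod C.subtype
  have hΦ : LinearMap.ker Φ = ⊥ := by
    rw [LinearMap.ker_eq_bot']
    rintro ⟨x, c⟩ h
    have h' : ⁅e, (x : 𝔤)⁆ + c = 0 := h
    have hx : (x : 𝔤) = 0 := by
      refine hC.eq_zero_of_lie_mem he x.2 ?_
      rw [eq_neg_of_add_eq_zero_left h']
      exact neg_mem c.2
    rw [hx, lie_zero, zero_add] at h'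
    ext <;> simp [hx, h']
  obtain ⟨g, hg⟩ := Φ.exists_leftInverse_of_injective hΦ
  let ρ : 𝔤 →ₗ[ℂ] 𝔤 := (degLE 𝒢 (-1)).subtype ∘ₗ LinearMap.fst ℂ _ _ ∘ₗ g
  have hρ : ∀ x ∈ degLE 𝒢 (-1), ∀ c ∈ C, ρ (⁅e, x⁆ + c) = x := fun x hx c hc => by
    have := LinearMap.congr_fun hg (⟨x, hx⟩, ⟨c, hc⟩)
    have h2 : ρ (Φ (⟨x, hx⟩, ⟨c, hc⟩)) = x := by
      simp only [ρ, LinearMap.comp_apply] at this ⊢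
      rw [this]; rfl
    exact h2
  have hρ' : ∀ i ≤ 1, ∀ y ∈ degLE 𝒢 i, ρ y ∈ degLE 𝒢 (i - 2) ∧ y - ⁅e, ρ y⁆ ∈ C := by
    intro i hi y hy
    obtain ⟨x, hx, hc⟩ := hC.exists_decomposition he hB hBinv hi hy
    have := hρ x (degLE_mono 𝒢 (by omega) hx) _ hc
    rw [add_sub_cancel] at this
    rw [this]; exact ⟨hx, hc⟩
  refine ⟨ρ, fun x hx => ?_, fun c hc => ?_, fun x => (g x).1.2, fun i x hx => ?_,
    fun x hx => (hρ' 1 le_rfl x hx).2⟩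
  · simpa using hρ x hx 0 (zero_mem _)
  · simpa using hρ 0 (zero_mem _) c hc
  · rcases le_or_gt i 1 with hi | hi
    · exact (hρ' i hi x hx).1
    -- Above degree one nothing is claimed beyond the range of `ρ`, since `-1 ≤ i - 2`.
    · exact degLE_mono 𝒢 (by omega) (g x).1.2

/-- An element of minimal degree of the transversal subspace commutes with `𝔫⁻`. -/
theorem IsTransversalSubspace.lie_eq_zero (hC : IsTransversalSubspace 𝒢 e C)
    (he : IsGoodElement 𝒢 e) {a : 𝔤} {m : ℤ} (ham : a ∈ 𝒢 m)
    (hm : IsLeast {i : ℤ | C ⊓ 𝒢 i ≠ ⊥} m) {y : 𝔤} (hy : y ∈ degLE 𝒢 (-1)) : ⁅a, y⁆ = 0 := by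
  have hm0 : m ≤ 0 := by
    by_contra h
    refine hm.1 (eq_bot_iff.2 fun x hx => ?_)
    simpa using eq_zero_of_mem_of_mem_degLE 𝒢 hx.2 (hC.le hx.1) (by omega)
  obtain ⟨M, hM, -⟩ := exists_degLE_bounds 𝒢
  -- Below `m` the subspace `C` has no components, so `𝔤_i = [e, 𝔤_{i-2}]`, and vanishing propagates
  -- upwards from the bottom of the grading. Hence `m` is the lowest degree of `𝔤`.
  have hlow : ∀ n : ℕ, ∀ i < m, i ≤ -(M : ℤ) + n → 𝒢 i = ⊥ := by
    intro n
    induction n with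
    | zero =>
      intro i _ hi
      exact eq_bot_iff.2 ((le_degLE 𝒢 (by simpa using hi)).trans hM.le)
    | succ n ih =>
      intro i him hi
      rw [eq_bot_iff]
      intro y hy
      obtain ⟨x, hx, c, hc, rfl⟩ := hC.exists_homogeneous he (by omega : i ≤ 0) hy
      rw [ih (i - 2) (by omega) (by push_cast at hi; omega)] at hx
      have hi' : C ⊓ 𝒢 i = ⊥ := by
        by_contra h
        have := hm.2 h
        omega
      rw [hi'] at hc
      simp only [Submodule.mem_bot] at hx hc
      simp [hx, hc]
  have : degLE 𝒢 (-1) ≤ LinearMap.ker (LieModule.toEnd ℂ 𝔤 𝔤 a) := by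
    refine (degLE_le 𝒢).2 fun j hj y hy => ?_
    have h := SetLike.GradedBracket.bracket_mem ham hy
    rw [hlow (m + j + M).toNat (m + j) (by omega) (by omega)] at h
    simpa using h
  exact this hy

end Simple

/-! ### Integrals depending on parameters -/

section Parametric

variable {T : Type*} [NormedAddCommGroup T] [NormedSpace ℝ T]

theorem contDiff_fderiv_apply {T' : Type*} [NormedAddCommGroup T'] [NormedSpace ℝ T']
    {f : T → ℂ} (hf : ContDiff ℝ ∞ f) {u v : T' → T} (hu : ContDiff ℝ ∞ u) (hv : ContDiff ℝ ∞ v) :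
    ContDiff ℝ ∞ fun s => fderiv ℝ f (u s) (v s) :=
  ((hf.fderiv_right (m := ∞) (by simp)).comp hu).clm_apply hv

theorem hasFDerivAt_partial {f : T × ℝ → ℂ} (hf : ContDiff ℝ ∞ f) (t : T) (x : ℝ) :
    HasFDerivAt (fun t => f (t, x)) ((fderiv ℝ f (t, x)).comp (ContinuousLinearMap.inl ℝ T ℝ)) t :=
  ((hf.differentiable (by simp)) (t, x)).hasFDerivAt.comp t (hasFDerivAt_prodMk_left t x)

variable [FiniteDimensional ℝ T]

theorem hasFDerivAt_parametric_integral {f : T × ℝ → ℂ} (hf : ContDiff ℝ ∞ f) (t₀ : T) :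
    HasFDerivAt (fun t => ∫ x in (0 : ℝ)..1, f (t, x))
      (∫ x in (0 : ℝ)..1, (fderiv ℝ f (t₀, x)).comp (ContinuousLinearMap.inl ℝ T ℝ)) t₀ := by
  have hcont : Continuous fun p : T × ℝ =>
      (fderiv ℝ f p).comp (ContinuousLinearMap.inl ℝ T ℝ) :=
    (hf.continuous_fderiv (by simp)).clm_comp continuous_const
  have : ProperSpace T := FiniteDimensional.proper ℝ T
  -- The derivative is bounded on the compact product of a ball with the interval; the constant
  -- bound dominates the integrand.
  obtain ⟨K, hK⟩ := ((isCompact_closedBall t₀ 1).prod (isCompact_Icc (a := (0 : ℝ)) (b := 1))).exists_bound_of_continuousOn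
    hcont.continuousOn
  have hsec : ∀ t, Continuous fun x : ℝ => f (t, x) := fun t =>
    hf.continuous.comp (by fun_prop)
  refine intervalIntegral.hasFDerivAt_integral_of_dominated_of_fderiv_le
    (F' := fun t x => (fderiv ℝ f (t, x)).comp (ContinuousLinearMap.inl ℝ T ℝ))
    (bound := fun _ => K)
    (Metric.closedBall_mem_nhds t₀ one_pos)
    (Filter.Eventually.of_forall fun t => (hsec t).aestronglyMeasurable)
    ((hsec t₀).intervalIntegrable _ _)
    (hcont.comp (by fun_prop : Continuous fun x : ℝ => (t₀, x))).aestronglyMeasurable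
    (Filter.Eventually.of_forall fun x hx t ht => hK (t, x) ⟨ht, ?_⟩)
    (by simp)
    (Filter.Eventually.of_forall fun x _ t _ => hasFDerivAt_partial hf t x)
  rw [Set.uIoc_of_le zero_le_one] at hx
  exact ⟨hx.1.le, hx.2⟩

theorem contDiff_parametric_integral {f : T × ℝ → ℂ} (hf : ContDiff ℝ ∞ f) :
    ContDiff ℝ ∞ fun t => ∫ x in (0 : ℝ)..1, f (t, x) := by
  rw [contDiff_infty]
  intro n
  induction n generalizing f with
  | zero =>
    exact contDiff_zero.2 (continuous_iff_continuousAt.2 fun t =>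
      (hasFDerivAt_parametric_integral hf t).continuousAt)
  | succ n ih =>
    push_cast
    rw [contDiff_succ_iff_fderiv_apply]
    refine ⟨fun t => (hasFDerivAt_parametric_integral hf t).differentiableAt, by simp, fun y => ?_⟩
    have h : (fun t => fderiv ℝ (fun t => ∫ x in (0 : ℝ)..1, f (t, x)) t y) =
        fun t => ∫ x in (0 : ℝ)..1, fderiv ℝ f (t, x) (y, 0) := by
      funext t
      rw [(hasFDerivAt_parametric_integral hf t).fderiv,
        ContinuousLinearMap.intervalIntegral_apply]
      · simp
      · have hcont : Continuous fun x : ℝ =>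
            (fderiv ℝ f (t, x)).comp (ContinuousLinearMap.inl ℝ T ℝ) :=
          ((hf.continuous_fderiv (by simp)).comp (by fun_prop : Continuous fun x : ℝ => (t, x))).clm_comp
            continuous_const
        exact hcont.intervalIntegrable _ _
    rw [h]
    exact ih (f := fun p => fderiv ℝ f p (y, 0)) (contDiff_fderiv_apply hf contDiff_id contDiff_const)

theorem hasDerivAt_parametric_integral {f : ℝ × ℝ → ℂ} (hf : ContDiff ℝ ∞ f) {f' : ℝ → ℂ} {t₀ : ℝ}
    (h : ∀ x, HasDerivAt (fun t => f (t, x)) (f' x) t₀) :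
    HasDerivAt (fun t => ∫ x in (0 : ℝ)..1, f (t, x)) (∫ x in (0 : ℝ)..1, f' x) t₀ := by
  have := (hasFDerivAt_parametric_integral hf t₀).hasDerivAt
  rw [ContinuousLinearMap.intervalIntegral_apply] at this
  · convert this using 3 with x
    exact (h x).unique (hasFDerivAt_partial hf t₀ x).hasDerivAt
  · have hcont : Continuous fun x : ℝ =>
        (fderiv ℝ f (t₀, x)).comp (ContinuousLinearMap.inl ℝ ℝ ℝ) :=
      ((hf.continuous_fderiv (by simp)).comp (by fun_prop : Continuous fun x : ℝ => (t₀, x))).clm_comp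
        continuous_const
    exact hcont.intervalIntegrable _ _

end Parametric

/-! ### Smooth maps into `𝔤` -/

section VecSmooth

variable {𝔤 : Type*} [LieRing 𝔤] [LieAlgebra ℂ 𝔤]
  {T : Type*} [NormedAddCommGroup T] [NormedSpace ℝ T]
  {T' : Type*} [NormedAddCommGroup T'] [NormedSpace ℝ T']

theorem eq_of_dual {x y : 𝔤} (h : ∀ φ : Module.Dual ℂ 𝔤, φ x = φ y) : x = y := by
  rw [← sub_eq_zero]
  exact (Module.forall_dual_apply_eq_zero_iff ℂ _).1 fun φ => by rw [map_sub, h φ, sub_self]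

theorem mem_of_dual {V : Submodule ℂ 𝔤} {x : 𝔤}
    (h : ∀ φ : Module.Dual ℂ 𝔤, (∀ y ∈ V, φ y = 0) → φ x = 0) : x ∈ V := by
  by_contra hx
  obtain ⟨φ, hφ, hV⟩ := Submodule.exists_le_ker_of_notMem hx
  exact hφ (h φ fun y hy => hV hy)

theorem VecSmooth.comp {f : T → 𝔤} (hf : VecSmooth f) {u : T' → T} (hu : ContDiff ℝ ∞ u) :
    VecSmooth fun s => f (u s) := fun φ => (hf φ).comp hu

theorem VecSmooth.add {f g : T → 𝔤} (hf : VecSmooth f) (hg : VecSmooth g) :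
    VecSmooth fun s => f s + g s := fun φ => by simpa using (hf φ).add (hg φ)

theorem VecSmooth.smul {a : T → ℂ} {f : T → 𝔤} (ha : ContDiff ℝ ∞ a) (hf : VecSmooth f) :
    VecSmooth fun s => a s • f s := fun φ => by simpa using ha.mul (hf φ)

theorem vecSmooth_const (v : 𝔤) : VecSmooth fun _ : T => v := fun _ => contDiff_const

theorem VecSmooth.map {f : T → 𝔤} (hf : VecSmooth f) (L : 𝔤 →ₗ[ℂ] 𝔤) :
    VecSmooth fun s => L (f s) := fun φ => hf (φ ∘ₗ L)

variable [Module.Finite ℂ 𝔤]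

theorem VecSmooth.lie {f g : T → 𝔤} (hf : VecSmooth f) (hg : VecSmooth g) :
    VecSmooth fun s => ⁅f s, g s⁆ := fun φ =>
  contDiff_bilin hf hg ((LieModule.toEnd ℂ 𝔤 𝔤 : 𝔤 →ₗ[ℂ] Module.End ℂ 𝔤).compr₂ φ)

/-- Linear coordinates recover a vector. -/
theorem dual_sum_basis (a : Module.Dual ℂ 𝔤 → ℂ)
    (ha : ∀ φ, a φ = ∑ i, a ((Module.finBasis ℂ 𝔤).coord i) * φ (Module.finBasis ℂ 𝔤 i))
    (φ : Module.Dual ℂ 𝔤) :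
    φ (∑ i, a ((Module.finBasis ℂ 𝔤).coord i) • Module.finBasis ℂ 𝔤 i) = a φ := by
  rw [ha φ]; simp

theorem dual_apply_eq_sum (φ : Module.Dual ℂ 𝔤) (v : 𝔤) :
    φ v = ∑ i, (Module.finBasis ℂ 𝔤).coord i v * φ (Module.finBasis ℂ 𝔤 i) := by
  conv_lhs => rw [← (Module.finBasis ℂ 𝔤).sum_repr v]
  simp only [map_sum, map_smul, smul_eq_mul, Module.Basis.coord_apply]

/-- The derivative of `f` at `y` in the direction `w`. -/
def vecFDeriv (f : T → 𝔤) (y w : T) : 𝔤 :=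
  ∑ i, fderiv ℝ (fun z => (Module.finBasis ℂ 𝔤).coord i (f z)) y w • Module.finBasis ℂ 𝔤 i

theorem dual_vecFDeriv {f : T → 𝔤} (hf : VecSmooth f) (φ : Module.Dual ℂ 𝔤) (y w : T) :
    φ (vecFDeriv f y w) = fderiv ℝ (fun z => φ (f z)) y w := by
  refine dual_sum_basis (fun φ => fderiv ℝ (fun z => φ (f z)) y w) (fun φ => ?_) φ
  have hd : ∀ i, DifferentiableAt ℝ (fun z => (Module.finBasis ℂ 𝔤).coord i (f z)) y := fun i =>
    ((hf _).differentiable (by simp)) y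
  simp only [fun z => dual_apply_eq_sum φ (f z)]
  rw [fderiv_fun_sum fun i _ => (hd i).mul_const _]
  simp only [sum_apply]
  refine Finset.sum_congr rfl fun i _ => ?_
  rw [fderiv_mul_const (hd i)]
  simp [mul_comm]

theorem VecSmooth.fderiv {f : T → 𝔤} (hf : VecSmooth f) {u v : T' → T} (hu : ContDiff ℝ ∞ u)
    (hv : ContDiff ℝ ∞ v) : VecSmooth fun s => vecFDeriv f (u s) (v s) := fun φ => by
  simp only [dual_vecFDeriv hf]
  exact contDiff_fderiv_apply (hf φ) hu hv

/-- The integral over `[0, 1]` of a family of vectors. -/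
def vecIntegral (f : ℝ → 𝔤) : 𝔤 :=
  ∑ i, (∫ s in (0 : ℝ)..1, (Module.finBasis ℂ 𝔤).coord i (f s)) • Module.finBasis ℂ 𝔤 i

theorem dual_vecIntegral {f : ℝ → 𝔤} (hf : VecSmooth f) (φ : Module.Dual ℂ 𝔤) :
    φ (vecIntegral f) = ∫ s in (0 : ℝ)..1, φ (f s) := by
  refine dual_sum_basis (fun φ => ∫ s in (0 : ℝ)..1, φ (f s)) (fun φ => ?_) φ
  simp only [fun z => dual_apply_eq_sum φ (f z)]
  rw [intervalIntegral.integral_finsetSum fun i _ =>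
    ((hf _).mul contDiff_const).continuous.intervalIntegrable _ _]
  simp

theorem VecSmooth.integral [FiniteDimensional ℝ T] {f : T × ℝ → 𝔤} (hf : VecSmooth f) :
    VecSmooth fun t => vecIntegral fun s => f (t, s) := fun φ => by
  have h : ∀ t, VecSmooth fun s => f (t, s) := fun t => hf.comp (by fun_prop)
  simp only [fun t => dual_vecIntegral (h t) φ]
  exact contDiff_parametric_integral (hf φ)

theorem hasDerivAt_bilin {f g : ℝ → 𝔤} {f' g' : 𝔤} {t : ℝ}
    (hf : ∀ φ : Module.Dual ℂ 𝔤, HasDerivAt (fun s => φ (f s)) (φ f') t)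
    (hg : ∀ φ : Module.Dual ℂ 𝔤, HasDerivAt (fun s => φ (g s)) (φ g') t)
    (β : 𝔤 →ₗ[ℂ] 𝔤 →ₗ[ℂ] ℂ) :
    HasDerivAt (fun s => β (f s) (g s)) (β f' (g t) + β (f t) g') t := by
  let b := Module.finBasis ℂ 𝔤
  have h : ∀ u v : 𝔤, β u v = ∑ i, ∑ j, b.coord i u * (b.coord j v * β (b i) (b j)) := by
    intro u v
    conv_lhs => rw [← b.sum_repr u, ← b.sum_repr v]
    simp only [map_sum, map_smul, LinearMap.sum_apply, LinearMap.smul_apply, smul_eq_mul,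
      Finset.mul_sum, Module.Basis.coord_apply]
    rw [Finset.sum_comm]
    exact Finset.sum_congr rfl fun i _ => Finset.sum_congr rfl fun j _ => by ring
  rw [funext fun s => h (f s) (g s), h f', h (f t), ← Finset.sum_add_distrib]
  simp only [← Finset.sum_add_distrib]
  exact HasDerivAt.fun_sum fun i _ => HasDerivAt.fun_sum fun j _ =>
    (hf (b.coord i)).mul ((hg (b.coord j)).mul_const _)

end VecSmooth

/-! ### Plots and velocities -/

section Plots

variable {𝔤 : Type*} [LieRing 𝔤] [LieAlgebra ℂ 𝔤] [Module.Finite ℂ 𝔤]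
  {T : Type*} [NormedAddCommGroup T] [NormedSpace ℝ T]
  {T' : Type*} [NormedAddCommGroup T'] [NormedSpace ℝ T']

theorem Loop.ext {u v : Loop 𝔤} (h : ∀ x, u x = v x) : u = v := Subtype.ext (funext h)

@[simp] theorem loop_sub_apply (u v : Loop 𝔤) (x : ℝ) : (u - v) x = u x - v x := rfl
@[simp] theorem constLoop_apply (a : 𝔤) (x : ℝ) : constLoop a x = a := rfl
@[simp] theorem loopMap_apply (L : 𝔤 →ₗ[ℂ] 𝔤) (u : Loop 𝔤) (x : ℝ) : loopMap L u x = L (u x) := rfl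
@[simp] theorem loopLie_apply (u v : Loop 𝔤) (x : ℝ) : loopLie u v x = ⁅u x, v x⁆ := rfl
theorem loopDeriv_apply (u : Loop 𝔤) (x : ℝ) : loopDeriv u x = vecDeriv (u : ℝ → 𝔤) x := rfl

theorem IsPlot.comp {c : T → Loop 𝔤} (hc : IsPlot c) {u : T' → T} (hu : ContDiff ℝ ∞ u) :
    IsPlot fun s => c (u s) :=
  VecSmooth.comp (T := T × ℝ) hc (u := fun p : T' × ℝ => (u p.1, p.2))
    ((hu.comp contDiff_fst).prodMk contDiff_snd)

theorem isPlot_const (u : Loop 𝔤) : IsPlot fun _ : T => u :=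
  VecSmooth.comp u.2.2 contDiff_snd

theorem IsPlot.add {c d : T → Loop 𝔤} (hc : IsPlot c) (hd : IsPlot d) :
    IsPlot fun t => c t + d t := VecSmooth.add hc hd

theorem IsPlot.smul {a : T → ℂ} {c : T → Loop 𝔤} (ha : ContDiff ℝ ∞ a) (hc : IsPlot c) :
    IsPlot fun t => a t • c t := VecSmooth.smul (ha.comp contDiff_fst) hc

theorem IsPlot.neg {c : T → Loop 𝔤} (hc : IsPlot c) : IsPlot fun t => -c t :=
  fun φ => by simpa using! ContDiff.neg (hc φ)

theorem IsPlot.sub {c d : T → Loop 𝔤} (hc : IsPlot c) (hd : IsPlot d) :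
    IsPlot fun t => c t - d t := by
  simpa [sub_eq_add_neg] using hc.add hd.neg

theorem IsPlot.map {c : T → Loop 𝔤} (hc : IsPlot c) (L : 𝔤 →ₗ[ℂ] 𝔤) :
    IsPlot fun t => loopMap L (c t) := VecSmooth.map hc L

theorem IsPlot.lie {c d : T → Loop 𝔤} (hc : IsPlot c) (hd : IsPlot d) :
    IsPlot fun t => loopLie (c t) (d t) := VecSmooth.lie hc hd

theorem IsPlot.sum {ι : Type*} {s : Finset ι} {c : ι → T → Loop 𝔤} (h : ∀ i ∈ s, IsPlot (c i)) :
    IsPlot fun t => ∑ i ∈ s, c i t := by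
  classical
  induction s using Finset.induction_on with
  | empty => simpa using isPlot_const 0
  | insert i s hi ih =>
    simp only [Finset.sum_insert hi]
    exact (h i (Finset.mem_insert_self _ _)).add
      (ih fun j hj => h j (Finset.mem_insert_of_mem hj))

theorem IsPlot.deriv {c : T → Loop 𝔤} (hc : IsPlot c) : IsPlot fun t => loopDeriv (c t) := by
  have h : (fun p : T × ℝ => loopDeriv (c p.1) p.2) = fun p : T × ℝ =>
      vecFDeriv (fun p : T × ℝ => c p.1 p.2) p (0, 1) := by
    funext p
    refine eq_of_dual fun φ => ?_
    rw [loopDeriv_apply, dual_vecDeriv (c p.1).2.2, dual_vecFDeriv hc]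
    have h1 : HasFDerivAt (fun p : T × ℝ => φ (c p.1 p.2))
      (fderiv ℝ (fun p : T × ℝ => φ (c p.1 p.2)) p) (p.1, p.2) :=
      (((hc φ).differentiable (by simp)) p).hasFDerivAt
    have := (h1.comp p.2 (hasFDerivAt_prodMk_right p.1 p.2)).hasDerivAt
    simpa [Function.comp_def] using this.deriv
  unfold IsPlot
  rw [h]
  exact VecSmooth.fderiv hc contDiff_id contDiff_const

theorem HasVelocity.unique {c : ℝ → Loop 𝔤} {v w : Loop 𝔤} (hv : HasVelocity c v)
    (hw : HasVelocity c w) : v = w :=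
  Loop.ext fun x => eq_of_dual fun φ => (hv φ x).unique (hw φ x)

theorem HasVelocity.add {c d : ℝ → Loop 𝔤} {v w : Loop 𝔤} (hv : HasVelocity c v)
    (hw : HasVelocity d w) : HasVelocity (fun t => c t + d t) (v + w) := fun φ x => by
  simpa using (hv φ x).fun_add (hw φ x)

theorem hasVelocity_const (u : Loop 𝔤) : HasVelocity (fun _ => u) 0 := fun φ x => by
  simpa using hasDerivAt_const (0 : ℝ) (φ (u x))

theorem hasVelocity_smul (v : Loop 𝔤) : HasVelocity (fun t : ℝ => (t : ℂ) • v) v := fun φ x => by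
  simpa using (Complex.ofRealCLM.hasDerivAt (x := 0)).mul_const (φ (v x))

theorem hasVelocity_line (q v : Loop 𝔤) : HasVelocity (fun t : ℝ => q + (t : ℂ) • v) v := by
  simpa using (hasVelocity_const q).add (hasVelocity_smul v)

theorem HasVelocity.map {c : ℝ → Loop 𝔤} {v : Loop 𝔤} (hv : HasVelocity c v) (L : 𝔤 →ₗ[ℂ] 𝔤) :
    HasVelocity (fun t => loopMap L (c t)) (loopMap L v) := fun φ x => hv (φ ∘ₗ L) x

theorem HasVelocity.lie {c d : ℝ → Loop 𝔤} {v w : Loop 𝔤} (hv : HasVelocity c v)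
    (hw : HasVelocity d w) :
    HasVelocity (fun t => loopLie (c t) (d t)) (loopLie v (d 0) + loopLie (c 0) w) := fun φ x => by
  simpa using hasDerivAt_bilin (fun ψ => hv ψ x) (fun ψ => hw ψ x)
    ((LieModule.toEnd ℂ 𝔤 𝔤 : 𝔤 →ₗ[ℂ] Module.End ℂ 𝔤).compr₂ φ)

/-- Velocities are tangent to closed linear constraints. -/
theorem HasVelocity.mem {c : ℝ → Loop 𝔤} {v q : Loop 𝔤} (hv : HasVelocity c v)
    {V : Submodule ℂ 𝔤} (hc : ∀ t, c t - q ∈ loopsIn V) : v ∈ loopsIn V := fun x => by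
  refine mem_of_dual fun φ hφ => ?_
  have h : (fun t => φ (c t x)) = fun _ => φ (q x) := by
    funext t
    have := hφ _ (hc t x)
    rwa [loop_sub_apply, map_sub, sub_eq_zero] at this
  have h1 := hv φ x
  rw [h] at h1
  exact h1.unique (hasDerivAt_const _ _)

/-- Smooth families of curves have velocities, which depend smoothly on the parameter. -/
theorem IsPlot.exists_velocity {c : T × ℝ → Loop 𝔤} (hc : IsPlot c) :
    ∃ v : T → Loop 𝔤, IsPlot v ∧ ∀ t, HasVelocity (fun s => c (t, s)) (v t) := by
  let f : (T × ℝ) × ℝ → 𝔤 := fun p => c p.1 p.2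
  have hf : VecSmooth f := hc
  -- Differentiating the periodicity in `x` shows that the velocity is again a loop.
  have hper : ∀ t x, vecFDeriv f ((t, 0), x + 1) ((0, 1), 0) =
      vecFDeriv f ((t, 0), x) ((0, 1), 0) := by
    intro t x
    refine eq_of_dual fun φ => ?_
    rw [dual_vecFDeriv hf, dual_vecFDeriv hf]
    have h : (fun z => φ (f z)) = fun z => φ (f (z + (0, 1))) := by
      funext z
      simp only [f, Prod.fst_add, Prod.snd_add, add_zero]
      rw [(c z.1).2.1]
    have h' : fderiv ℝ (fun z => φ (f (z + (0, 1)))) ((t, 0), x) =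
        fderiv ℝ (fun z => φ (f z)) (((t, 0), x) + (0, 1)) :=
      fderiv_comp_add_right (f := fun z => φ (f z)) _
    rw [← h] at h'
    rw [h']; simp
  have hv : VecSmooth fun p : T × ℝ => vecFDeriv f ((p.1, 0), p.2) ((0, 1), 0) :=
    hf.fderiv (by fun_prop) contDiff_const
  refine ⟨fun t => ⟨fun x => vecFDeriv f ((t, 0), x) ((0, 1), 0), hper t,
    hv.comp (u := fun x => (t, x)) (by fun_prop)⟩, hv, fun t φ x => ?_⟩
  show HasDerivAt _ (φ (vecFDeriv f ((t, 0), x) ((0, 1), 0))) 0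
  rw [dual_vecFDeriv hf]
  have h1 : HasFDerivAt (fun z => φ (f z)) (fderiv ℝ (fun z => φ (f z)) ((t, 0), x)) ((t, 0), x) :=
    (((hf φ).differentiable (by simp)) _).hasFDerivAt
  have h2 : HasDerivAt (fun s : ℝ => ((t, s), x)) (((0 : T), (1 : ℝ)), (0 : ℝ)) 0 :=
    ((hasDerivAt_const _ _).prodMk (hasDerivAt_id _)).prodMk (hasDerivAt_const _ _)
  exact HasFDerivAt.comp_hasDerivAt (f := fun s : ℝ => ((t, s), x)) 0 h1 h2

theorem IsPlot.exists_hasVelocity {c : ℝ → Loop 𝔤} (hc : IsPlot c) : ∃ v, HasVelocity c v := by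
  obtain ⟨v, -, hv⟩ := (hc.comp (u := fun p : ℝ × ℝ => p.2) contDiff_snd).exists_velocity
  exact ⟨v 0, hv 0⟩

/-- Hadamard's lemma for curves of loops. -/
theorem IsPlot.hadamard {c : ℝ → Loop 𝔤} (hc : IsPlot c) :
    ∃ k : ℝ → Loop 𝔤, IsPlot k ∧ ∀ t : ℝ, c t = c 0 + (t : ℂ) • k t := by
  let f : ℝ × ℝ → 𝔤 := fun p => c p.1 p.2
  have hf : VecSmooth f := hc
  have hg : VecSmooth fun p : (ℝ × ℝ) × ℝ => vecFDeriv f (p.2 * p.1.1, p.1.2) (1, 0) :=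
    hf.fderiv (by fun_prop) contDiff_const
  -- The quotient is `k(t) = ∫₀¹ c'(st) ds`.
  have hk : VecSmooth fun p : ℝ × ℝ =>
      vecIntegral fun s => vecFDeriv f (s * p.1, p.2) (1, 0) := hg.integral
  have hper : ∀ t x, vecFDeriv f (t, x + 1) (1, 0) = vecFDeriv f (t, x) (1, 0) := by
    intro t x
    refine eq_of_dual fun φ => ?_
    rw [dual_vecFDeriv hf, dual_vecFDeriv hf]
    have h : (fun z => φ (f z)) = fun z => φ (f (z + (0, 1))) := by
      funext z
      simp only [f, Prod.fst_add, Prod.snd_add, add_zero]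
      rw [(c z.1).2.1]
    have h' : fderiv ℝ (fun z => φ (f (z + (0, 1)))) (t, x) =
        fderiv ℝ (fun z => φ (f z)) ((t, x) + (0, 1)) :=
      fderiv_comp_add_right (f := fun z => φ (f z)) _
    rw [← h] at h'
    rw [h']; simp
  refine ⟨fun t => ⟨fun x => vecIntegral fun s => vecFDeriv f (s * t, x) (1, 0),
    fun x => by simp only [hper], hk.comp (u := fun x => (t, x)) (by fun_prop)⟩, hk, fun t => ?_⟩
  refine Loop.ext fun x => eq_of_dual fun φ => ?_
  have hs : VecSmooth fun s : ℝ => vecFDeriv f (s * t, x) (1, 0) :=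
    hf.fderiv (by fun_prop) contDiff_const
  show φ (c t x) = φ (c 0 x + (t : ℂ) • vecIntegral fun s => vecFDeriv f (s * t, x) (1, 0))
  rw [map_add, map_smul, dual_vecIntegral hs, smul_eq_mul, ← intervalIntegral.integral_const_mul]
  have hd : ∀ s : ℝ, HasDerivAt (fun s : ℝ => φ (f (s * t, x)))
      ((t : ℂ) * φ (vecFDeriv f (s * t, x) (1, 0))) s := by
    intro s
    have h1 : HasFDerivAt (fun z => φ (f z)) (fderiv ℝ (fun z => φ (f z)) (s * t, x)) (s * t, x) :=
      (((hf φ).differentiable (by simp)) _).hasFDerivAt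
    have h2 : HasDerivAt (fun s : ℝ => (s * t, x)) (t, (0 : ℝ)) s := by
      simpa using ((hasDerivAt_id s).mul_const t).prodMk (hasDerivAt_const s x)
    have h3 := HasFDerivAt.comp_hasDerivAt (f := fun s : ℝ => (s * t, x)) s h1 h2
    rw [dual_vecFDeriv hf]
    have h4 : fderiv ℝ (fun z => φ (f z)) (s * t, x) (t, 0) =
        (t : ℂ) * fderiv ℝ (fun z => φ (f z)) (s * t, x) (1, 0) := by
      rw [show ((t, 0) : ℝ × ℝ) = t • (1, 0) by simp, map_smul]
      simp
    rw [← h4]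
    exact h3
  rw [intervalIntegral.integral_eq_sub_of_hasDerivAt (fun s _ => hd s)
    ((contDiff_const.mul (hs φ)).continuous.intervalIntegrable _ _)]
  simp [f]

end Plots

/-! ### The pairing -/

section Pairing

variable {𝔤 : Type*} [LieRing 𝔤] [LieAlgebra ℂ 𝔤] [Module.Finite ℂ 𝔤]
  (B : LinearMap.BilinForm ℂ 𝔤)

theorem pairing_apply (u v : Loop 𝔤) : pairing B u v = ∫ x in (0 : ℝ)..1, B (u x) (v x) := rfl

theorem IsPlot.pairing {T : Type*} [NormedAddCommGroup T] [NormedSpace ℝ T] [FiniteDimensional ℝ T]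
    {c d : T → Loop 𝔤} (hc : IsPlot c) (hd : IsPlot d) :
    ContDiff ℝ ∞ fun t => pairing B (c t) (d t) :=
  contDiff_parametric_integral (f := fun p : T × ℝ => B (c p.1 p.2) (d p.1 p.2))
    (contDiff_bilin hc hd B)

theorem HasVelocity.pairing {c d : ℝ → Loop 𝔤} (hc : IsPlot c) (hd : IsPlot d) {v w : Loop 𝔤}
    (hv : HasVelocity c v) (hw : HasVelocity d w) :
    HasDerivAt (fun t => pairing B (c t) (d t)) (pairing B v (d 0) + pairing B (c 0) w) 0 := by
  have h := hasDerivAt_parametric_integral (f := fun p : ℝ × ℝ => B (c p.1 p.2) (d p.1 p.2))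
    (contDiff_bilin hc hd B) (t₀ := 0) fun x =>
      hasDerivAt_bilin (fun φ => hv φ x) (fun φ => hw φ x) B
  rw [intervalIntegral.integral_add] at h
  · exact h
  · exact (contDiff_bilin v.2.2 (d 0).2.2 B).continuous.intervalIntegrable 0 1
  · exact (contDiff_bilin (c 0).2.2 w.2.2 B).continuous.intervalIntegrable 0 1

/-- Integration by parts on the circle. -/
theorem pairing_loopDeriv (u v : Loop 𝔤) :
    pairing B (loopDeriv u) v = -pairing B u (loopDeriv v) := by
  have hd : ∀ (w : Loop 𝔤) (x : ℝ) (φ : Module.Dual ℂ 𝔤),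
      HasDerivAt (fun y => φ (w y)) (φ (loopDeriv w x)) x := fun w x φ => by
    rw [loopDeriv_apply, dual_vecDeriv w.2.2]
    exact (((w.2.2 φ).differentiable (by simp)) x).hasDerivAt
  have hi : ∀ u v : Loop 𝔤, IntervalIntegrable (fun x => B (u x) (v x)) MeasureTheory.volume 0 1 :=
    fun u v => (contDiff_bilin u.2.2 v.2.2 B).continuous.intervalIntegrable 0 1
  have h := intervalIntegral.integral_eq_sub_of_hasDerivAt (a := 0) (b := 1)
    (fun x _ => hasDerivAt_bilin (hd u x) (hd v x) B) ((hi (loopDeriv u) v).add (hi u (loopDeriv v)))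
  rw [intervalIntegral.integral_add (hi _ _) (hi _ _)] at h
  have h0 : B (u 1) (v 1) = B (u 0) (v 0) := by
    have h1 := u.2.1 0
    have h2 := v.2.1 0
    rw [zero_add] at h1 h2
    rw [h1, h2]
  rw [h0, sub_self] at h
  rw [pairing_apply, pairing_apply]
  exact eq_neg_of_add_eq_zero_left h

/-- A loop orthogonal to `LV` is pointwise orthogonal to `V`. -/
theorem form_eq_zero_of_pairing {V : Submodule ℂ 𝔤} {u : Loop 𝔤}
    (h : ∀ ξ ∈ loopsIn V, pairing B u ξ = 0) (x : ℝ) {y : 𝔤} (hy : y ∈ V) : B (u x) y = 0 := by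
  have hs : ContDiff ℝ ∞ fun x => B (u x) y :=
    contDiff_bilin u.2.2 (vecSmooth_const y) B
  have hs' : ContDiff ℝ ∞ fun x => (starRingEnd ℂ) (B (u x) y) :=
    Complex.conjCLE.contDiff.comp hs
  -- This test loop turns the pairing into the integral of `|B(u, y)|²`.
  let ξ : Loop 𝔤 := ⟨fun x => (starRingEnd ℂ) (B (u x) y) • y,
    fun x => by simp only [u.2.1], (vecSmooth_const y).smul hs'⟩
  have hξ : pairing B u ξ = ((∫ x in (0 : ℝ)..1, ‖B (u x) y‖ ^ 2 : ℝ) : ℂ) := by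
    rw [pairing_apply, ← intervalIntegral.integral_ofReal]
    congr 1
    funext x
    show B (u x) ((starRingEnd ℂ) (B (u x) y) • y) = _
    rw [map_smul, smul_eq_mul, mul_comm, Complex.mul_conj, Complex.normSq_eq_norm_sq]
  have h0 := h ξ fun x => V.smul_mem _ hy
  rw [hξ] at h0
  norm_cast at h0
  have hcont : Continuous fun x => ‖B (u x) y‖ ^ 2 := hs.continuous.norm.pow 2
  have hz : ∀ x ∈ Set.Icc (0 : ℝ) 1, B (u x) y = 0 := by
    by_contra! hne
    obtain ⟨x, hx, hne⟩ := hne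
    have := intervalIntegral.integral_pos zero_lt_one hcont.continuousOn
      (fun x _ => by positivity) ⟨x, hx, by positivity⟩
    exact this.ne' h0
  have hper : Function.Periodic (fun x => B (u x) y) 1 := fun x => by simp only [u.2.1]
  obtain ⟨x', hx', he⟩ := hper.exists_mem_Ico₀ zero_lt_one x
  rw [he]
  exact hz x' ⟨hx'.1, hx'.2.le⟩

variable {B}

theorem eq_zero_of_pairing (hB : B.Nondegenerate) {u : Loop 𝔤} (h : ∀ ξ, pairing B u ξ = 0) :
    u = 0 :=
  Loop.ext fun x => hB.1 _ fun _ =>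
    form_eq_zero_of_pairing B (V := ⊤) (fun ξ _ => h ξ) x Submodule.mem_top

theorem eq_of_pairing (hB : B.Nondegenerate) {u v : Loop 𝔤}
    (h : ∀ ξ, pairing B u ξ = pairing B v ξ) : u = v :=
  sub_eq_zero.1 (eq_zero_of_pairing hB fun ξ => by rw [map_sub, LinearMap.sub_apply, h, sub_self])

theorem pairing_map {L L' : 𝔤 →ₗ[ℂ] 𝔤} (h : ∀ x y, B (L' x) y = B x (L y)) (u v : Loop 𝔤) :
    pairing B (loopMap L' u) v = pairing B u (loopMap L v) := by
  simp only [pairing_apply, loopMap_apply, h]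

theorem pairing_comm (hs : ∀ x x', B x x' = B x' x) (u v : Loop 𝔤) : pairing B u v = pairing B v u := by
  simp only [pairing_apply, hs (u _)]

end Pairing

/-! ### Smooth functionals along plots -/

section Functionals

variable {𝔤 : Type*} [LieRing 𝔤] [LieAlgebra ℂ 𝔤] [Module.Finite ℂ 𝔤]
  {T : Type*} [NormedAddCommGroup T] [NormedSpace ℝ T] [FiniteDimensional ℝ T]

theorem SmoothMapOn.comp_plot {A : Set (Loop 𝔤)} {Φ : Loop 𝔤 → Loop 𝔤} (hΦ : SmoothMapOn A Φ)
    {c : T → Loop 𝔤} (hc : IsPlot c) (hA : ∀ t, c t ∈ A) : IsPlot fun t => Φ (c t) := by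
  let L : T ≃L[ℝ] (Fin (Module.finrank ℝ T) → ℝ) := ContinuousLinearEquiv.ofFinrankEq (by simp)
  have := (hΦ _ (fun t => c (L.symm t)) (hc.comp L.symm.contDiff) fun t => hA _).comp L.contDiff
  simpa using this

theorem SmoothFunctionalOn.comp_plot {A : Set (Loop 𝔤)} {F : Loop 𝔤 → ℂ}
    (hF : SmoothFunctionalOn A F) {c : T → Loop 𝔤} (hc : IsPlot c) (hA : ∀ t, c t ∈ A) :
    ContDiff ℝ ∞ fun t => F (c t) := by
  let L : T ≃L[ℝ] (Fin (Module.finrank ℝ T) → ℝ) := ContinuousLinearEquiv.ofFinrankEq (by simp)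
  have := (hF _ (fun t => c (L.symm t)) (hc.comp L.symm.contDiff) fun t => hA _).comp L.contDiff
  simpa [Function.comp_def] using this

theorem isPlot_line (q s : Loop 𝔤) : IsPlot fun t : ℝ => q + (t : ℂ) • s :=
  (isPlot_const q).add ((isPlot_const s).smul Complex.ofRealCLM.contDiff)

theorem hasVelocity_add_smul {k : ℝ → Loop 𝔤} (hk : IsPlot k) (q : Loop 𝔤) :
    HasVelocity (fun t : ℝ => q + (t : ℂ) • k t) (k 0) := fun φ x => by
  have h1 : DifferentiableAt ℝ (fun t => φ (k t x)) 0 :=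
    (((hk φ).comp (g := fun p : ℝ × ℝ => φ (k p.1 p.2)) (f := fun t : ℝ => (t, x))
      (by fun_prop)).differentiable (by simp)) 0
  have h2 := ((Complex.ofRealCLM.hasDerivAt (x := 0)).mul h1.hasDerivAt).const_add (φ (q x))
  simpa using! h2

theorem direction_of_velocity {A : AffineSubspace ℂ (Loop 𝔤)} {V : Submodule ℂ 𝔤}
    (hV : A.direction = loopsIn V) {c : ℝ → Loop 𝔤} (hA : ∀ t, c t ∈ A) {v : Loop 𝔤}
    (hv : HasVelocity c v) : v ∈ A.direction := by
  rw [hV]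
  exact hv.mem fun t => hV ▸ AffineSubspace.vsub_mem_direction (hA t) (hA 0)

/-- The derivative of a smooth functional along a curve depends only on the velocity. -/
theorem SmoothFunctionalOn.hasDerivAt_comp {A : AffineSubspace ℂ (Loop 𝔤)} {V : Submodule ℂ 𝔤}
    (hV : A.direction = loopsIn V) {F : Loop 𝔤 → ℂ} (hF : SmoothFunctionalOn (A : Set (Loop 𝔤)) F)
    {c : ℝ → Loop 𝔤} (hc : IsPlot c) (hA : ∀ t, c t ∈ A) {v : Loop 𝔤} (hv : HasVelocity c v)
    {d : ℂ} (hd : HasDerivAt (fun t : ℝ => F (c 0 + (t : ℂ) • v)) d 0) :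
    HasDerivAt (fun t => F (c t)) d 0 := by
  obtain ⟨k, hk, hck⟩ := hc.hadamard
  have hk0 : k 0 = v := by
    have h := hasVelocity_add_smul hk (c 0)
    simp only [← hck] at h
    exact h.unique hv
  -- For `t ≠ 0` this is division by `t`. At `t = 0` the velocity must stay in the direction; this
  -- is where the direction is required to be of the form `LV`.
  have hkA : ∀ t, k t ∈ A.direction := by
    intro t
    rcases eq_or_ne t 0 with rfl | ht
    · rw [hk0]; exact direction_of_velocity hV hA hv
    · have h := AffineSubspace.vsub_mem_direction (hA t) (hA 0)
      rw [vsub_eq_sub, hck t, add_sub_cancel_left] at h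
      exact (Submodule.smul_mem_iff _ (by exact_mod_cast ht)).1 h
  -- The diagonal of this family is the curve, while `t ↦ γ(0, t)` is the straight line with the
  -- same velocity. As `γ(s, 0)` is constant, the diagonal derivative equals the derivative along
  -- the line.
  let γ : ℝ × ℝ → Loop 𝔤 := fun p => c 0 + (p.2 : ℂ) • k p.1
  have hγ : IsPlot γ := (isPlot_const (c 0)).add
    ((hk.comp contDiff_fst).smul (Complex.ofRealCLM.contDiff.comp contDiff_snd))
  have hγA : ∀ p, γ p ∈ A := fun p => by
    have := AffineSubspace.vadd_mem_of_mem_direction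
      (A.direction.smul_mem (p.2 : ℂ) (hkA p.1)) (hA 0)
    rwa [vadd_eq_add, add_comm] at this
  have hG : ContDiff ℝ ∞ fun p => F (γ p) := hF.comp_plot hγ hγA
  have hG' : HasFDerivAt (fun p => F (γ p)) (fderiv ℝ (fun p => F (γ p)) (0, 0)) (0, 0) :=
    ((hG.differentiable (by simp)) _).hasFDerivAt
  have h1 : fderiv ℝ (fun p => F (γ p)) (0, 0) (1, 0) = 0 := by
    have := HasFDerivAt.comp_hasDerivAt (f := fun t : ℝ => (t, (0 : ℝ))) 0 hG'
      ((hasDerivAt_id _).prodMk (hasDerivAt_const _ _))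
    have h : ((fun p => F (γ p)) ∘ fun t : ℝ => (t, (0 : ℝ))) = fun _ => F (c 0) := by
      funext t; simp [γ]
    rw [h] at this
    exact this.unique (hasDerivAt_const _ _)
  have h2 : fderiv ℝ (fun p => F (γ p)) (0, 0) (0, 1) = d := by
    have := HasFDerivAt.comp_hasDerivAt (f := fun t : ℝ => ((0 : ℝ), t)) 0 hG'
      ((hasDerivAt_const _ _).prodMk (hasDerivAt_id _))
    refine this.unique ?_
    rw [← hk0] at hd
    exact hd
  have h3 := HasFDerivAt.comp_hasDerivAt (f := fun t : ℝ => (t, t)) 0 hG'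
      ((hasDerivAt_id _).prodMk (hasDerivAt_id _))
  have h4 : fderiv ℝ (fun p => F (γ p)) (0, 0) (1, 1) = d := by
    rw [show ((1, 1) : ℝ × ℝ) = (1, 0) + (0, 1) by simp, map_add, h1, h2, zero_add]
  rw [h4] at h3
  have h5 : ((fun p => F (γ p)) ∘ fun t : ℝ => (t, t)) = fun t => F (c t) := by
    funext t; simp only [Function.comp_apply, γ, ← hck]
  rwa [h5] at h3

variable {B : LinearMap.BilinForm ℂ 𝔤}

theorem HasGradOn.hasDerivAt_comp {A : AffineSubspace ℂ (Loop 𝔤)} {V : Submodule ℂ 𝔤}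
    (hV : A.direction = loopsIn V) {F : Loop 𝔤 → ℂ} {δF : Loop 𝔤 → Loop 𝔤}
    (hF : HasGradOn B A F δF) {c : ℝ → Loop 𝔤} (hc : IsPlot c) (hA : ∀ t, c t ∈ A) {v : Loop 𝔤}
    (hv : HasVelocity c v) : HasDerivAt (fun t => F (c t)) (pairing B (δF (c 0)) v) 0 :=
  hF.smooth.hasDerivAt_comp hV hc hA hv
    (hF.deriv _ (hA 0) v (direction_of_velocity hV hA hv))

theorem HasGradOn.mono {A A' : AffineSubspace ℂ (Loop 𝔤)} (h : A' ≤ A) {F : Loop 𝔤 → ℂ}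
    {δF : Loop 𝔤 → Loop 𝔤} (hF : HasGradOn B A F δF) : HasGradOn B A' F δF :=
  ⟨fun k c hc hA => hF.smooth k c hc fun t => h (hA t),
    fun k c hc hA => hF.smooth_grad k c hc fun t => h (hA t),
    fun q hq s hs => hF.deriv q (h hq) s (AffineSubspace.direction_le h hs)⟩

theorem HasGradOn.congr {A : AffineSubspace ℂ (Loop 𝔤)} {F G : Loop 𝔤 → ℂ}
    {δF : Loop 𝔤 → Loop 𝔤} (hF : HasGradOn B A F δF) (h : ∀ q ∈ A, F q = G q) :
    HasGradOn B A G δF := by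
  refine ⟨fun k c hc hA => ?_, hF.smooth_grad, fun q hq s hs => ?_⟩
  · have := hF.smooth k c hc hA
    rwa [funext fun t => h (c t) (hA t)] at this
  · have := hF.deriv q hq s hs
    rwa [funext fun θ : ℝ => h (q + (θ : ℂ) • s) (by
      have := AffineSubspace.vadd_mem_of_mem_direction (A.direction.smul_mem (θ : ℂ) hs) hq
      rwa [vadd_eq_add, add_comm] at this)] at this

theorem HasGradOn.pairing_unique {A A' : AffineSubspace ℂ (Loop 𝔤)} {F G : Loop 𝔤 → ℂ}
    {δF δG : Loop 𝔤 → Loop 𝔤} (hF : HasGradOn B A F δF) (hG : HasGradOn B A' G δG)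
    (hA : A' ≤ A) (h : ∀ q ∈ A', F q = G q) {q : Loop 𝔤} (hq : q ∈ A') {s : Loop 𝔤}
    (hs : s ∈ A'.direction) : pairing B (δF q) s = pairing B (δG q) s :=
  (((hF.mono hA).congr h).deriv q hq s hs).unique (hG.deriv q hq s hs)

theorem HasGradOn.unique (hB : B.Nondegenerate) {F : Loop 𝔤 → ℂ} {δ δ' : Loop 𝔤 → Loop 𝔤}
    (h : HasGradOn B ⊤ F δ) (h' : HasGradOn B ⊤ F δ') (q : Loop 𝔤) : δ q = δ' q :=
  eq_of_pairing hB fun _ => h.pairing_unique h' le_rfl (fun _ _ => rfl)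
    (AffineSubspace.mem_top ℂ _ _) (by simp)

theorem direction_top : (⊤ : AffineSubspace ℂ (Loop 𝔤)).direction = loopsIn (⊤ : Submodule ℂ 𝔤) := by
  rw [AffineSubspace.direction_top]
  exact (eq_top_iff.2 fun u _ x => Submodule.mem_top).symm

/-! ### Derivatives of maps along lines -/

open Classical in
/-- The derivative of `Φ` at `q` in the direction `s`. -/
def lineDeriv (Φ : Loop 𝔤 → Loop 𝔤) (q s : Loop 𝔤) : Loop 𝔤 :=
  if h : ∃ v, HasVelocity (fun θ : ℝ => Φ (q + (θ : ℂ) • s)) v then h.choose else 0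

theorem lineDeriv_eq {Φ : Loop 𝔤 → Loop 𝔤} {q s v : Loop 𝔤}
    (h : HasVelocity (fun θ : ℝ => Φ (q + (θ : ℂ) • s)) v) : lineDeriv Φ q s = v := by
  have h' : ∃ v, HasVelocity (fun θ : ℝ => Φ (q + (θ : ℂ) • s)) v := ⟨v, h⟩
  rw [lineDeriv, dif_pos h']
  exact h'.choose_spec.unique h

theorem SmoothMapOn.hasVelocity {Φ : Loop 𝔤 → Loop 𝔤} (hΦ : SmoothMapOn Set.univ Φ)
    (q s : Loop 𝔤) : HasVelocity (fun θ : ℝ => Φ (q + (θ : ℂ) • s)) (lineDeriv Φ q s) := by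
  obtain ⟨v, hv⟩ := (hΦ.comp_plot (isPlot_line q s) fun _ => Set.mem_univ _).exists_hasVelocity
  rwa [lineDeriv_eq hv]

theorem SmoothMapOn.isPlot_lineDeriv {Φ : Loop 𝔤 → Loop 𝔤} (hΦ : SmoothMapOn Set.univ Φ)
    {c d : T → Loop 𝔤} (hc : IsPlot c) (hd : IsPlot d) :
    IsPlot fun t => lineDeriv Φ (c t) (d t) := by
  have h : IsPlot fun p : T × ℝ => c p.1 + (p.2 : ℂ) • d p.1 :=
    (hc.comp contDiff_fst).add
      ((hd.comp contDiff_fst).smul (Complex.ofRealCLM.contDiff.comp contDiff_snd))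
  obtain ⟨v, hv, hv'⟩ := (hΦ.comp_plot h fun _ => Set.mem_univ _).exists_velocity
  rwa [funext fun t => lineDeriv_eq (hv' t)]

/-- Tested against a fixed loop, the `x`-derivative moves onto that loop by integration by parts.
This avoids interchanging partial derivatives and is why nondegeneracy of the form enters. -/
theorem HasVelocity.deriv (hB : B.Nondegenerate) {c : ℝ → Loop 𝔤}
    (hc : IsPlot c) {v : Loop 𝔤} (hv : HasVelocity c v) :
    HasVelocity (fun t => loopDeriv (c t)) (loopDeriv v) := by
  obtain ⟨w, hw⟩ := hc.deriv.exists_hasVelocity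
  suffices h : w = loopDeriv v by rwa [← h]
  refine eq_of_pairing hB fun u => ?_
  have h1 := hw.pairing B hc.deriv (isPlot_const u) (hasVelocity_const u)
  have h2 := (hv.pairing B hc (isPlot_const (loopDeriv u)) (hasVelocity_const _)).neg
  simp only [map_zero, add_zero] at h1 h2
  rw [pairing_loopDeriv B v u]
  refine h1.unique ?_
  refine h2.congr_of_eventuallyEq (Filter.Eventually.of_forall fun t => ?_)
  exact pairing_loopDeriv B _ _

theorem HasVelocity.const_smul {c : ℝ → Loop 𝔤} {v : Loop 𝔤} (hv : HasVelocity c v) (k : ℂ) :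
    HasVelocity (fun t => k • c t) (k • v) := fun φ x => by
  simpa using (hv φ x).const_mul k

/-- The second derivative of a functional is symmetric. -/
theorem HasGradOn.lineDeriv_symm {F : Loop 𝔤 → ℂ} {δF : Loop 𝔤 → Loop 𝔤}
    (hF : HasGradOn B ⊤ F δF) (q s v : Loop 𝔤) :
    pairing B (lineDeriv δF q s) v = pairing B (lineDeriv δF q v) s := by
  -- The claim is the symmetry of the ordinary second derivative of `F` on this plane.
  let γ : ℝ × ℝ → Loop 𝔤 := fun p => q + ((p.1 : ℂ) • s + (p.2 : ℂ) • v)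
  have hγ : IsPlot γ := (isPlot_const q).add
    (((isPlot_const s).smul (Complex.ofRealCLM.contDiff.comp contDiff_fst)).add
      ((isPlot_const v).smul (Complex.ofRealCLM.contDiff.comp contDiff_snd)))
  have hG : ContDiff ℝ ∞ fun p => F (γ p) :=
    hF.smooth.comp_plot hγ fun _ => AffineSubspace.mem_top ℂ _ _
  have hδ : SmoothMapOn Set.univ δF := fun k c hc _ =>
    hF.smooth_grad k c hc fun _ => AffineSubspace.mem_top ℂ _ _
  have hG' : ∀ p, HasFDerivAt (fun p => F (γ p)) (fderiv ℝ (fun p => F (γ p)) p) p := fun p =>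
    ((hG.differentiable (by simp)) _).hasFDerivAt
  have hG2 : HasFDerivAt (fderiv ℝ fun p => F (γ p))
      (fderiv ℝ (fderiv ℝ fun p => F (γ p)) 0) 0 :=
    (((hG.fderiv_right (m := ∞) (by simp)).differentiable (by simp)) _).hasFDerivAt
  have hfirst : ∀ p w : ℝ × ℝ, fderiv ℝ (fun p => F (γ p)) p w =
      pairing B (δF (γ p)) ((w.1 : ℂ) • s + (w.2 : ℂ) • v) := by
    intro p w
    have h0 : HasDerivAt (fun t : ℝ => p + t • w) w 0 := by
      simpa using ((hasDerivAt_id (0 : ℝ)).smul_const w).const_add p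
    have hp := hG' (p + (0 : ℝ) • w)
    have h1 := HasFDerivAt.comp_hasDerivAt (f := fun t : ℝ => p + t • w) 0 hp h0
    have h2 := hF.deriv (γ p) (AffineSubspace.mem_top ℂ _ _) ((w.1 : ℂ) • s + (w.2 : ℂ) • v)
      (by simp)
    rw [zero_smul, add_zero] at h1
    have hfun : ((fun p => F (γ p)) ∘ fun t : ℝ => p + t • w) =
        fun θ : ℝ => F (γ p + (θ : ℂ) • ((w.1 : ℂ) • s + (w.2 : ℂ) • v)) := by
      funext t
      simp only [Function.comp_apply, γ]
      congr 1
      simp only [Prod.fst_add, Prod.snd_add, Prod.smul_fst, Prod.smul_snd, smul_eq_mul]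
      push_cast
      module
    rw [hfun] at h1
    exact h1.unique h2
  have hsecond : ∀ w w' : ℝ × ℝ, fderiv ℝ (fderiv ℝ fun p => F (γ p)) 0 w w' =
      pairing B (lineDeriv δF q ((w.1 : ℂ) • s + (w.2 : ℂ) • v))
        ((w'.1 : ℂ) • s + (w'.2 : ℂ) • v) := by
    intro w w'
    have h0 : HasDerivAt (fun t : ℝ => t • w) w 0 := by
      simpa using (hasDerivAt_id (0 : ℝ)).smul_const w
    have hp : HasFDerivAt (fderiv ℝ fun p => F (γ p))
      (fderiv ℝ (fderiv ℝ fun p => F (γ p)) 0) ((0 : ℝ) • w) := by rwa [zero_smul]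
    have h1 := HasFDerivAt.comp_hasDerivAt (f := fun t : ℝ => t • w) 0 hp h0
    have h2 := h1.clm_apply (hasDerivAt_const (0 : ℝ) w')
    rw [map_zero, add_zero] at h2
    simp only [Function.comp_apply, hfirst] at h2
    have h3 := (hδ.hasVelocity q ((w.1 : ℂ) • s + (w.2 : ℂ) • v)).pairing B
      (hδ.comp_plot (isPlot_line _ _) fun _ => Set.mem_univ _)
      (isPlot_const ((w'.1 : ℂ) • s + (w'.2 : ℂ) • v)) (hasVelocity_const _)
    rw [map_zero, add_zero] at h3
    have hfun : ∀ t : ℝ, γ (t • w) = q + (t : ℂ) • ((w.1 : ℂ) • s + (w.2 : ℂ) • v) := by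
      intro t
      simp only [γ, Prod.smul_fst, Prod.smul_snd, smul_eq_mul]
      push_cast
      module
    simp only [hfun] at h2
    exact h2.unique h3
  have hsymm : IsSymmSndFDerivAt ℝ (fun p => F (γ p)) 0 :=
    hG.contDiffAt.isSymmSndFDerivAt (by
      rw [minSmoothness_of_isRCLikeNormedField]; exact WithTop.coe_le_coe.2 (le_top : (2 : ℕ∞) ≤ ⊤))
  have := hsymm (1, 0) (0, 1)
  rw [hsecond, hsecond] at this
  simpa using this

end Functionals

/-! ### The Lie-Poisson pencil -/

section Poisson

variable {𝔤 : Type*} [LieRing 𝔤] [LieAlgebra ℂ 𝔤] [Module.Finite ℂ 𝔤]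
  {B : LinearMap.BilinForm ℂ 𝔤}

theorem loopLie_skew (u v : Loop 𝔤) : loopLie u v = -loopLie v u :=
  Loop.ext fun x => (lie_skew (u x) (v x)).symm

theorem loopLie_jacobi (u v w : Loop 𝔤) :
    loopLie u (loopLie v w) + loopLie v (loopLie w u) + loopLie w (loopLie u v) = 0 :=
  Loop.ext fun x => lie_jacobi (u x) (v x) (w x)

theorem loopLie_leibniz (u v w : Loop 𝔤) :
    loopLie u (loopLie v w) = loopLie (loopLie u v) w + loopLie v (loopLie u w) :=
  Loop.ext fun x => leibniz_lie (u x) (v x) (w x)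

theorem loopDeriv_lie (u v : Loop 𝔤) :
    loopDeriv (loopLie u v) = loopLie (loopDeriv u) v + loopLie u (loopDeriv v) := by
  refine Loop.ext fun x => eq_of_dual fun φ => ?_
  have hd : ∀ (w : Loop 𝔤) (φ : Module.Dual ℂ 𝔤),
      HasDerivAt (fun y => φ (w y)) (φ (loopDeriv w x)) x := fun w φ => by
    rw [loopDeriv_apply, dual_vecDeriv w.2.2]
    exact (((w.2.2 φ).differentiable (by simp)) x).hasDerivAt
  have h := hasDerivAt_bilin (hd u) (hd v)
    ((LieModule.toEnd ℂ 𝔤 𝔤 : 𝔤 →ₗ[ℂ] Module.End ℂ 𝔤).compr₂ φ)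
  have h' := (hd (loopLie u v) φ).unique h
  rw [h']; simp

theorem loopDeriv_mem {V : Submodule ℂ 𝔤} {u : Loop 𝔤} (hu : u ∈ loopsIn V) :
    loopDeriv u ∈ loopsIn V := fun x => by
  refine mem_of_dual fun φ hφ => ?_
  rw [loopDeriv_apply, dual_vecDeriv u.2.2, funext fun y => hφ _ (hu y)]
  simp

theorem pairing_lie (hBinv : B.lieInvariant 𝔤) (u v w : Loop 𝔤) :
    pairing B (loopLie u v) w = pairing B u (loopLie v w) := by
  simp only [pairing_apply, loopLie_apply, invariant_assoc hBinv]

/-- The tensors `k (d/dx + ad q) + ad w`. -/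
def affineTensor (k : ℂ) (w : Loop 𝔤) : Tensor 𝔤 := fun q => k • poisson₂ q + loopLie w

theorem affineTensor_apply (k : ℂ) (w q u : Loop 𝔤) :
    affineTensor k w q u = k • (loopDeriv u + loopLie q u) + loopLie w u := rfl

theorem affineTensor_skew (hs : ∀ x y, B x y = B y x) (hBinv : B.lieInvariant 𝔤) (k : ℂ)
    (w q u v : Loop 𝔤) :
    pairing B u (affineTensor k w q v) = -pairing B v (affineTensor k w q u) := by
  have h1 : ∀ r : Loop 𝔤, pairing B u (loopLie r v) = -pairing B v (loopLie r u) := by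
    intro r
    rw [pairing_comm hs u, loopLie_skew r v, map_neg, LinearMap.neg_apply, pairing_lie hBinv]
  have h2 : pairing B u (loopDeriv v) = -pairing B v (loopDeriv u) := by
    rw [pairing_comm hs u, pairing_loopDeriv]
  simp only [affineTensor_apply, map_add, map_smul, smul_eq_mul, h1, h2]
  ring

/-- The gradient of the bracket of two functionals. -/
def bracketGrad (k : ℂ) (w : Loop 𝔤) (δF δG : Loop 𝔤 → Loop 𝔤) (q : Loop 𝔤) : Loop 𝔤 :=
  lineDeriv δF q (affineTensor k w q (δG q)) - lineDeriv δG q (affineTensor k w q (δF q)) +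
    k • loopLie (δG q) (δF q)

theorem HasGradOn.smooth_top {F : Loop 𝔤 → ℂ} {δF : Loop 𝔤 → Loop 𝔤} (hF : HasGradOn B ⊤ F δF) :
    SmoothMapOn Set.univ δF := fun k c hc _ =>
  hF.smooth_grad k c hc fun _ => AffineSubspace.mem_top ℂ _ _

theorem IsPlot.affineTensor {T : Type*} [NormedAddCommGroup T] [NormedSpace ℝ T]
    (k : ℂ) (w : Loop 𝔤) {c d : T → Loop 𝔤} (hc : IsPlot c) (hd : IsPlot d) :
    IsPlot fun t => affineTensor k w (c t) (d t) :=
  (IsPlot.smul contDiff_const (hd.deriv.add (hc.lie hd))).add ((isPlot_const w).lie hd)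

/-- Product rule: the two terms with second derivatives become gradients by symmetry of the
Hessians, with one use of skewness, and the tensor, affine in `q`, contributes only `k` times a
bracket. -/
theorem hasGradOn_bracket (hB : B.Nondegenerate) (hs : ∀ x y, B x y = B y x)
    (hBinv : B.lieInvariant 𝔤) (k : ℂ) (w : Loop 𝔤) {F G : Loop 𝔤 → ℂ} {δF δG : Loop 𝔤 → Loop 𝔤}
    (hF : HasGradOn B ⊤ F δF) (hG : HasGradOn B ⊤ G δG) :
    HasGradOn B ⊤ (bracket B (affineTensor k w) δF δG) (bracketGrad k w δF δG) := by
  have hf := hF.smooth_top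
  have hg := hG.smooth_top
  refine ⟨fun n c hc hA => ?_, fun n c hc hA => ?_, fun q _ s _ => ?_⟩
  · exact (hF.smooth_grad n c hc hA).pairing B (hc.affineTensor k w (hG.smooth_grad n c hc hA))
  · have h1 := hF.smooth_grad n c hc hA
    have h2 := hG.smooth_grad n c hc hA
    exact ((hf.isPlot_lineDeriv hc (hc.affineTensor k w h2)).sub
      (hg.isPlot_lineDeriv hc (hc.affineTensor k w h1))).add
      (IsPlot.smul contDiff_const (h2.lie h1))
  · have hp := isPlot_line q s
    have pf := hf.comp_plot hp fun _ => Set.mem_univ _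
    have pg := hg.comp_plot hp fun _ => Set.mem_univ _
    have vf := hf.hasVelocity q s
    have vg := hg.hasVelocity q s
    have vp := (((vg.deriv hB pg).add ((hasVelocity_line q s).lie vg)).const_smul k).add
      ((hasVelocity_const w).lie vg)
    have h := vf.pairing B pf (hp.affineTensor k w pg) vp
    simp only [Complex.ofReal_zero, zero_smul, add_zero, map_zero, LinearMap.zero_apply,
      zero_add] at h
    have e1 : pairing B (lineDeriv δF q s) (affineTensor k w q (δG q)) =
        pairing B (lineDeriv δF q (affineTensor k w q (δG q))) s := hF.lineDeriv_symm _ _ _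
    have e2 : pairing B (δF q) (affineTensor k w q (lineDeriv δG q s)) =
        -pairing B (lineDeriv δG q (affineTensor k w q (δF q))) s := by
      rw [affineTensor_skew hs hBinv, hG.lineDeriv_symm]
    have e3 : pairing B (δF q) (loopLie s (δG q)) = pairing B (loopLie (δG q) (δF q)) s := by
      rw [pairing_comm hs, pairing_lie hBinv, pairing_comm hs]
    rw [affineTensor_apply] at e2
    simp only [map_add, map_smul, smul_eq_mul] at e2
    refine h.congr_deriv ?_
    rw [e1]
    simp only [bracketGrad, map_add, map_sub, map_smul, LinearMap.add_apply, LinearMap.sub_apply,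
      LinearMap.smul_apply, smul_eq_mul, ← e3]
    linear_combination e2

/-- The tensors `k (d/dx + ad q) + ad w` are Poisson tensors on `L𝔤`. -/
theorem isPoissonOn_affineTensor (hB : B.Nondegenerate) (hs : ∀ x y, B x y = B y x)
    (hBinv : B.lieInvariant 𝔤) (k : ℂ) (w : Loop 𝔤) : IsPoissonOn B ⊤ (affineTensor k w) where
  tangent _ _ _ := by simp
  skew q _ u v := affineTensor_skew hs hBinv k w q u v
  closed F δF G δG hF hG := ⟨_, hasGradOn_bracket hB hs hBinv k w hF hG⟩
  jacobi F δF G δG H δH hF hG hH δFG δGH δHF hFG hGH hHF q _ := by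
    have e1 := hFG.unique hB (hasGradOn_bracket hB hs hBinv k w hF hG) q
    have e2 := hGH.unique hB (hasGradOn_bracket hB hs hBinv k w hG hH) q
    have e3 := hHF.unique hB (hasGradOn_bracket hB hs hBinv k w hH hF) q
    simp only [bracket, e1, e2, e3, bracketGrad, map_add, map_sub, map_smul, LinearMap.add_apply,
      LinearMap.sub_apply, LinearMap.smul_apply, smul_eq_mul]
    have s1 := hF.lineDeriv_symm q (affineTensor k w q (δG q)) (affineTensor k w q (δH q))
    have s2 := hG.lineDeriv_symm q (affineTensor k w q (δH q)) (affineTensor k w q (δF q))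
    have s3 := hH.lineDeriv_symm q (affineTensor k w q (δF q)) (affineTensor k w q (δG q))
    set f := δF q
    set g := δG q
    set h := δH q
    -- The Hessian terms cancel in pairs; this cyclic sum is what remains. For the parts `ad q` and
    -- `ad w` it vanishes by the Jacobi identity of `𝔤`.
    have key : pairing B (loopLie g f) (affineTensor k w q h) +
        pairing B (loopLie h g) (affineTensor k w q f) +
        pairing B (loopLie f h) (affineTensor k w q g) = 0 := by
      have hr : ∀ r : Loop 𝔤, pairing B (loopLie g f) (loopLie r h) +
          pairing B (loopLie h g) (loopLie r f) + pairing B (loopLie f h) (loopLie r g) = 0 := by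
        intro r
        rw [pairing_comm hs, pairing_comm hs (loopLie h g), pairing_comm hs (loopLie f h),
          pairing_lie hBinv, pairing_lie hBinv, pairing_lie hBinv, ← map_add, ← map_add]
        have := loopLie_jacobi f h g
        rw [show loopLie h (loopLie g f) + loopLie f (loopLie h g) + loopLie g (loopLie f h) = 0 by
          rw [← this]; abel, map_zero]
      -- The cocycle identity of the central extension: integration by parts and the Leibniz rule
      -- for `d/dx`.
      have hd : pairing B (loopLie g f) (loopDeriv h) +
          pairing B (loopLie h g) (loopDeriv f) + pairing B (loopLie f h) (loopDeriv g) = 0 := by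
        have h1 := pairing_loopDeriv B (loopLie g f) h
        rw [loopDeriv_lie, map_add, LinearMap.add_apply, pairing_lie hBinv,
          loopLie_skew g (loopDeriv f), map_neg, LinearMap.neg_apply, pairing_lie hBinv,
          pairing_comm hs (loopDeriv g), pairing_comm hs (loopDeriv f), loopLie_skew g h,
          map_neg, LinearMap.neg_apply, neg_neg] at h1
        linear_combination h1
      simp only [affineTensor_apply, map_add, map_smul, smul_eq_mul]
      linear_combination k * hd + k * hr q + hr w
    linear_combination s1 + s2 + s3 + k * key

end Poisson

/-! ### Exponentials of nilpotent endomorphisms -/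

section NilExp

variable {V W : Type*} [AddCommGroup V] [Module ℂ V] [AddCommGroup W] [Module ℂ W]

/-- The exponential series; the sum is finite for nilpotent endomorphisms. -/
def nilExp (D : Module.End ℂ V) : Module.End ℂ V := ∑ᶠ k : ℕ, ((k.factorial : ℂ)⁻¹) • D ^ k

theorem nilExp_eq_sum {D : Module.End ℂ V} {K : ℕ} (h : D ^ K = 0) :
    nilExp D = ∑ k ∈ Finset.range K, ((k.factorial : ℂ)⁻¹) • D ^ k := by
  refine finsum_eq_sum_of_support_subset _ fun k hk => ?_
  rw [Finset.coe_range, Set.mem_Iio]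
  by_contra hle
  refine hk ?_
  show ((k.factorial : ℂ)⁻¹) • D ^ k = 0
  rw [pow_eq_zero_of_le (not_lt.1 hle) h, smul_zero]

theorem nilExp_eq_exp [Module ℚ (Module.End ℂ V)] {D : Module.End ℂ V} (h : IsNilpotent D) :
    nilExp D = IsNilpotent.exp D := by
  obtain ⟨K, hK⟩ := h
  rw [nilExp_eq_sum hK, IsNilpotent.exp_eq_sum hK]
  refine Finset.sum_congr rfl fun k _ => ?_
  rw [← Rat.cast_smul_eq_qsmul ℂ, Rat.cast_inv, Rat.cast_natCast]

theorem nilExp_mul_neg {D : Module.End ℂ V} (h : IsNilpotent D) : nilExp D * nilExp (-D) = 1 := by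
  let _ : Module ℚ (Module.End ℂ V) := Module.compHom _ (algebraMap ℚ ℂ)
  rw [nilExp_eq_exp h, nilExp_eq_exp h.neg]
  exact IsNilpotent.exp_mul_exp_neg_self h

theorem nilExp_add {D D' : Module.End ℂ V} (hD : IsNilpotent D) (hD' : IsNilpotent D')
    (h : Commute D D') : nilExp (D + D') = nilExp D * nilExp D' := by
  let _ : Module ℚ (Module.End ℂ V) := Module.compHom _ (algebraMap ℚ ℂ)
  rw [nilExp_eq_exp hD, nilExp_eq_exp hD', nilExp_eq_exp (h.isNilpotent_add hD hD')]
  exact IsNilpotent.exp_add_of_commute h hD hD'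

theorem nilExp_zero : nilExp (0 : Module.End ℂ V) = 1 := by
  rw [nilExp_eq_sum (K := 1) (by simp)]; simp

/-- The exponential of a derivation is an automorphism. -/
theorem nilExp_bilin {D : Module.End ℂ V} {D' : Module.End ℂ W} (hD : IsNilpotent D)
    (hD' : IsNilpotent D') (β : V →ₗ[ℂ] V →ₗ[ℂ] W)
    (h : ∀ x y, D' (β x y) = β (D x) y + β x (D y)) (x y : V) :
    nilExp D' (β x y) = β (nilExp D x) (nilExp D y) := by
  -- `L` and `R` insert `D` into the first and second argument of a bilinear map. They commute, and
  -- on `β` the sum `L + R` acts as `D'`, so the claim is `exp(L + R) = exp L · exp R` evaluated at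
  -- `β`.
  let L : Module.End ℂ (V →ₗ[ℂ] V →ₗ[ℂ] W) := LinearMap.lcomp ℂ _ D
  let R : Module.End ℂ (V →ₗ[ℂ] V →ₗ[ℂ] W) :=
    { toFun := fun γ => γ.compl₂ D
      map_add' := fun γ γ' => by ext; simp
      map_smul' := fun c γ => by ext; simp }
  have hL : ∀ (k : ℕ) γ x y, (L ^ k) γ x y = γ ((D ^ k) x) y := by
    intro k
    induction k with
    | zero => intro γ x y; simp
    | succ k ih =>
      intro γ x y
      rw [pow_succ, Module.End.mul_apply, ih, pow_succ', Module.End.mul_apply]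
      rfl
  have hR : ∀ (k : ℕ) γ x y, (R ^ k) γ x y = γ x ((D ^ k) y) := by
    intro k
    induction k with
    | zero => intro γ x y; simp
    | succ k ih =>
      intro γ x y
      rw [pow_succ, Module.End.mul_apply, ih, pow_succ', Module.End.mul_apply]
      rfl
  have hLR : ∀ (k : ℕ) x y, ((L + R) ^ k) β x y = (D' ^ k) (β x y) := by
    intro k
    induction k with
    | zero => intro x y; simp
    | succ k ih =>
      intro x y
      rw [pow_succ', Module.End.mul_apply, pow_succ, Module.End.mul_apply, h, map_add, ← ih, ← ih]
      rfl
  have hcomm : Commute L R := by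
    ext γ x y; rfl
  obtain ⟨K, hK⟩ := hD
  obtain ⟨K', hK'⟩ := hD'
  have hLK : L ^ K = 0 := by ext γ x y; rw [hL, hK]; simp
  have hRK : R ^ K = 0 := by ext γ x y; rw [hR, hK]; simp
  have hLn : IsNilpotent L := ⟨K, hLK⟩
  have hRn : IsNilpotent R := ⟨K, hRK⟩
  have hadd := nilExp_add hLn hRn hcomm
  have hnil : IsNilpotent (L + R) := hcomm.isNilpotent_add hLn hRn
  have h1 := LinearMap.congr_fun (LinearMap.congr_fun (LinearMap.congr_fun hadd β) x) y
  obtain ⟨K'', hK''⟩ := hnil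
  -- A common exponent makes the two finite series run over the same range.
  have hN : (L + R) ^ (K' + K'') = 0 := pow_eq_zero_of_le (Nat.le_add_left _ _) hK''
  have hN' : D' ^ (K' + K'') = 0 := pow_eq_zero_of_le (Nat.le_add_right _ _) hK'
  rw [nilExp_eq_sum hN, nilExp_eq_sum hLK, nilExp_eq_sum hRK] at h1
  rw [nilExp_eq_sum hN', nilExp_eq_sum hK]
  simp only [Module.End.mul_apply, LinearMap.sum_apply, LinearMap.smul_apply, hL, hR, hLR,
    map_sum, map_smul] at h1 ⊢
  exact h1

end NilExp

/-! ### The exponentials of the gauge group -/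

section Gauge

variable {𝔤 : Type*} [LieRing 𝔤] [LieAlgebra ℂ 𝔤] [Module.Finite ℂ 𝔤]
  (𝒢 : ℤ → Submodule ℂ 𝔤)

/-- The filtration of `L𝔤` by degree. -/
abbrev fil (k : ℤ) : Submodule ℂ (Loop 𝔤) := loopsIn (degLE 𝒢 k)

theorem adOp_apply (n : Loop 𝔤) (X : Op 𝔤) :
    adOp n X = (0, loopLie n X.2 - X.1 • loopDeriv n) := rfl

theorem adOp_smul (c : ℂ) (n : Loop 𝔤) : adOp (c • n) = c • adOp n := by
  refine LinearMap.ext fun X => ?_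
  rw [LinearMap.smul_apply, adOp_apply, adOp_apply, Prod.smul_mk, smul_zero, smul_sub, map_smul,
    map_smul, LinearMap.smul_apply, smul_comm c]

theorem adOp_neg (n : Loop 𝔤) : adOp (-n) = -adOp n := by
  refine LinearMap.ext fun X => ?_
  rw [LinearMap.neg_apply, adOp_apply, adOp_apply, Prod.neg_mk, neg_zero, map_neg, map_neg,
    LinearMap.neg_apply, smul_neg, neg_sub, sub_neg_eq_add, neg_add_eq_sub]

theorem expAd_eq_nilExp (n : Loop 𝔤) : expAd n = nilExp (adOp n) := rfl

/-- The operators of order zero with values in the `k`-th filtration step. -/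
def opFil (k : ℤ) : Submodule ℂ (Op 𝔤) := (⊥ : Submodule ℂ ℂ).prod (fil 𝒢 k)

theorem mem_opFil {k : ℤ} {X : Op 𝔤} : X ∈ opFil 𝒢 k ↔ X.1 = 0 ∧ X.2 ∈ fil 𝒢 k := by
  simp [opFil, Submodule.mem_prod]

theorem fil_mono {k l : ℤ} (h : k ≤ l) : fil 𝒢 k ≤ fil 𝒢 l := fun _ hu x => degLE_mono 𝒢 h (hu x)

variable [GradedLieAlgebra 𝒢]

theorem lie_mem_fil {i j : ℤ} {u v : Loop 𝔤} (hu : u ∈ fil 𝒢 i) (hv : v ∈ fil 𝒢 j) :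
    loopLie u v ∈ fil 𝒢 (i + j) := fun x => lie_mem_degLE 𝒢 (hu x) (hv x)

theorem lie_mem_fil_of_le {i j k : ℤ} {u v : Loop 𝔤} (hu : u ∈ fil 𝒢 i) (hv : v ∈ fil 𝒢 j)
    (h : i + j ≤ k) : loopLie u v ∈ fil 𝒢 k := fil_mono 𝒢 h (lie_mem_fil 𝒢 hu hv)

theorem adOp_mem_opFil {d k : ℤ} {n : Loop 𝔤} (hn : n ∈ fil 𝒢 (-d)) {X : Op 𝔤}
    (hX : X ∈ opFil 𝒢 k) : adOp n X ∈ opFil 𝒢 (k - d) := by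
  rw [mem_opFil] at hX ⊢
  refine ⟨rfl, ?_⟩
  rw [adOp_apply, hX.1, zero_smul, sub_zero]
  exact lie_mem_fil_of_le 𝒢 hn hX.2 (by omega)

/-- The first application lands in operators of order zero, and each later one lowers the degree.
The exponent is the same for all `n`, so exponentials of varying loops are sums of fixed length;
smoothness in `n` follows from this. -/
theorem exists_adOp_pow_eq_zero :
    ∃ K : ℕ, ∀ n ∈ fil 𝒢 (-1), adOp n ^ (K + 2) = 0 := by
  obtain ⟨M, hbot, htop⟩ := exists_degLE_bounds 𝒢
  refine ⟨2 * M, fun n hn => ?_⟩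
  have h : ∀ (j : ℕ) (X : Op 𝔤), (adOp n ^ (j + 1)) X ∈ opFil 𝒢 (M - j) := by
    intro j
    induction j with
    | zero =>
      intro X
      rw [mem_opFil]
      exact ⟨rfl, fun x => by simp [htop]⟩
    | succ j ih =>
      intro X
      rw [pow_succ', Module.End.mul_apply]
      have := adOp_mem_opFil 𝒢 hn (ih X)
      push_cast
      rwa [sub_add_eq_sub_sub]
  refine LinearMap.ext fun X => ?_
  have h1 := (mem_opFil 𝒢).1 (h (2 * M + 1) X)
  refine Prod.ext h1.1 (Loop.ext fun x => ?_)
  have h2 := degLE_mono 𝒢 (by push_cast; omega : (M : ℤ) - (2 * M + 1 : ℕ) ≤ -M) (h1.2 x)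
  rw [hbot] at h2
  exact h2

theorem isNilpotent_adOp {n : Loop 𝔤} (hn : n ∈ fil 𝒢 (-1)) : IsNilpotent (adOp n) := by
  obtain ⟨K, hK⟩ := exists_adOp_pow_eq_zero 𝒢
  exact ⟨_, hK n hn⟩

theorem expAd_mul_neg {n : Loop 𝔤} (hn : n ∈ fil 𝒢 (-1)) : expAd n * expAd (-n) = 1 := by
  rw [expAd_eq_nilExp, expAd_eq_nilExp, adOp_neg]
  exact nilExp_mul_neg (isNilpotent_adOp 𝒢 hn)

theorem expAd_zero : expAd (0 : Loop 𝔤) = 1 := by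
  rw [expAd_eq_nilExp, show adOp (0 : Loop 𝔤) = 0 by
    simpa using adOp_smul (0 : ℂ) (0 : Loop 𝔤), nilExp_zero]

/-- The exponential as an element of the adjoint group. -/
def expUnit (n : Loop 𝔤) (hn : n ∈ fil 𝒢 (-1)) : (Module.End ℂ (Op 𝔤))ˣ where
  val := expAd n
  inv := expAd (-n)
  val_inv := expAd_mul_neg 𝒢 hn
  inv_val := by simpa using expAd_mul_neg 𝒢 (neg_mem hn)

theorem adOp_pow_mem {d l : ℤ} (hd : 0 ≤ d) {n : Loop 𝔤} (hn : n ∈ fil 𝒢 (-d)) {X : Op 𝔤}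
    (hX : X ∈ opFil 𝒢 l) (j : ℕ) : (adOp n ^ j) X ∈ opFil 𝒢 l := by
  induction j with
  | zero => simpa using hX
  | succ j ih =>
    rw [pow_succ', Module.End.mul_apply]
    have := (mem_opFil 𝒢).1 (adOp_mem_opFil 𝒢 hn ih)
    exact (mem_opFil 𝒢).2 ⟨this.1, fil_mono 𝒢 (by omega) this.2⟩

theorem expAd_apply_eq {n : Loop 𝔤} {K : ℕ} (hK : adOp n ^ K = 0) (X : Op 𝔤) :
    expAd n X = ∑ k ∈ Finset.range K, ((k.factorial : ℂ)⁻¹) • (adOp n ^ k) X := by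
  rw [expAd_eq_nilExp, nilExp_eq_sum hK]
  simp [LinearMap.sum_apply]

/-- Every term beyond the constant one is a power of `ad n` applied to `ad n X`, and `ad n`
preserves the filtration steps. -/
theorem expAd_sub_mem {d l : ℤ} (hd : 1 ≤ d) {n : Loop 𝔤} (hn : n ∈ fil 𝒢 (-d)) {X : Op 𝔤}
    (hX : adOp n X ∈ opFil 𝒢 l) : expAd n X - X ∈ opFil 𝒢 l := by
  obtain ⟨K, hK⟩ := exists_adOp_pow_eq_zero 𝒢
  rw [expAd_apply_eq (hK n (fil_mono 𝒢 (by omega) hn)), Finset.sum_range_succ']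
  simp only [Nat.factorial_zero, Nat.cast_one, inv_one, pow_zero, one_smul, Module.End.one_apply,
    add_sub_cancel_right]
  refine sum_mem fun k _ => Submodule.smul_mem _ _ ?_
  rw [pow_succ, Module.End.mul_apply]
  exact adOp_pow_mem 𝒢 (by omega) hn hX k

theorem expAd_sub_sub_mem {d l : ℤ} (hd : 1 ≤ d) {n : Loop 𝔤} (hn : n ∈ fil 𝒢 (-d)) {X : Op 𝔤}
    (hX : adOp n (adOp n X) ∈ opFil 𝒢 l) : expAd n X - X - adOp n X ∈ opFil 𝒢 l := by
  obtain ⟨K, hK⟩ := exists_adOp_pow_eq_zero 𝒢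
  rw [expAd_apply_eq (hK n (fil_mono 𝒢 (by omega) hn)), Finset.sum_range_succ',
    Finset.sum_range_succ']
  simp only [Nat.factorial_zero, Nat.cast_one, inv_one, pow_zero, one_smul, Module.End.one_apply,
    add_sub_cancel_right, zero_add, Nat.factorial_one, pow_one]
  refine sum_mem fun k _ => Submodule.smul_mem _ _ ?_
  rw [pow_succ, pow_succ, Module.End.mul_apply, Module.End.mul_apply]
  exact adOp_pow_mem 𝒢 (by omega) hn hX k

theorem adOp_pow_fst (n : Loop 𝔤) (k : ℕ) (X : Op 𝔤) :
    ((adOp n ^ k) X).1 = if k = 0 then X.1 else 0 := by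
  cases k with
  | zero => simp
  | succ k => rw [pow_succ', Module.End.mul_apply]; rfl

theorem adOp_pow_succ_snd (n : Loop 𝔤) (k : ℕ) (X : Op 𝔤) :
    ((adOp n ^ (k + 1)) X).2 =
      loopLie n ((adOp n ^ k) X).2 - (if k = 0 then X.1 else 0 : ℂ) • loopDeriv n := by
  rw [pow_succ', Module.End.mul_apply, adOp_apply, adOp_pow_fst]

theorem act_expAd_eq {n : Loop 𝔤} {K : ℕ} (hK : adOp n ^ K = 0) (q : Loop 𝔤) :
    act (expAd n) q = ∑ k ∈ Finset.range K, ((k.factorial : ℂ)⁻¹) • ((adOp n ^ k) (1, q)).2 := by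
  rw [act, expAd_apply_eq hK, Prod.snd_sum]
  rfl

theorem isPlot_act_expAd {T : Type*} [NormedAddCommGroup T] [NormedSpace ℝ T]
    {c d : T → Loop 𝔤} (hc : IsPlot c) (hd : IsPlot d) (hn : ∀ t, c t ∈ fil 𝒢 (-1)) :
    IsPlot fun t => act (expAd (c t)) (d t) := by
  obtain ⟨K, hK⟩ := exists_adOp_pow_eq_zero 𝒢
  simp only [fun t => act_expAd_eq (hK (c t) (hn t)) (d t)]
  have hterm : ∀ k : ℕ, IsPlot fun t => ((adOp (c t) ^ k) (1, d t)).2 := by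
    intro k
    induction k with
    | zero => simpa using hd
    | succ k ih =>
      simp only [adOp_pow_succ_snd]
      exact (hc.lie ih).sub (IsPlot.smul contDiff_const hc.deriv)
  exact IsPlot.sum fun k _ => IsPlot.smul contDiff_const (hterm k)

/-- The fundamental vector fields of the gauge action. -/
theorem isFundamental_poisson₂ {ξ : Loop 𝔤} (hξ : ξ ∈ fil 𝒢 (-1)) (q : Loop 𝔤) :
    IsFundamental ξ q (poisson₂ q ξ) := by
  obtain ⟨K, hK⟩ := exists_adOp_pow_eq_zero 𝒢
  -- The exponential series minus its constant term, divided by `t`; its value at zero is the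
  -- velocity `-(ad ξ)(d/dx + q) = ξ_x + [q, ξ]`.
  let k : ℝ → Loop 𝔤 := fun t => ∑ j ∈ Finset.range (K + 1),
    (-(((j + 1).factorial : ℂ)⁻¹ * (-(t : ℂ)) ^ j)) • ((adOp ξ ^ (j + 1)) (1, q)).2
  have hk : IsPlot k := IsPlot.sum fun j _ => (isPlot_const _).smul
    (contDiff_const.mul (Complex.ofRealCLM.contDiff.neg.pow j)).neg
  have hk0 : k 0 = poisson₂ q ξ := by
    simp only [k]
    rw [Finset.sum_eq_single_of_mem 0 (by simp)]
    · simp only [zero_add, Nat.factorial_one, Nat.cast_one, inv_one, pow_zero, mul_one, pow_one,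
        adOp_apply, one_smul]
      rw [poisson₂, LinearMap.add_apply, loopLie_skew q ξ, sub_eq_add_neg]
      module
    · intro j _ hj
      simp [hj]
  have heq : (fun t : ℝ => act (expAd ((-t : ℂ) • ξ)) q) = fun t : ℝ => q + (t : ℂ) • k t := by
    funext t
    rw [act_expAd_eq (hK _ (Submodule.smul_mem _ _ hξ)), Finset.sum_range_succ', add_comm]
    simp only [Nat.factorial_zero, Nat.cast_one, inv_one, pow_zero, one_smul,
      Module.End.one_apply, k, Finset.smul_sum]
    congr 1
    refine Finset.sum_congr rfl fun j _ => ?_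
    rw [adOp_smul, smul_pow, LinearMap.smul_apply, Prod.smul_snd, smul_smul, smul_smul]
    congr 1
    ring
  rw [IsFundamental, heq, ← hk0]
  exact hasVelocity_add_smul hk q

/-- The Lie bracket of operators. -/
def opLie : Op 𝔤 →ₗ[ℂ] Op 𝔤 →ₗ[ℂ] Op 𝔤 :=
  LinearMap.mk₂ ℂ (fun X Y => (0, loopLie X.2 Y.2 + X.1 • loopDeriv Y.2 - Y.1 • loopDeriv X.2))
    (fun X X' Y => by ext1 <;> simp [add_smul]; abel)
    (fun c X Y => by ext1 <;> simp [smul_sub, smul_add, mul_smul, smul_comm c Y.1])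
    (fun X Y Y' => by ext1 <;> simp [add_smul]; abel)
    (fun c X Y => by ext1 <;> simp [smul_sub, smul_add, mul_smul, smul_comm c X.1])

theorem opLie_apply (X Y : Op 𝔤) :
    opLie X Y = (0, loopLie X.2 Y.2 + X.1 • loopDeriv Y.2 - Y.1 • loopDeriv X.2) := rfl

theorem adOp_opLie (n : Loop 𝔤) (X Y : Op 𝔤) :
    adOp n (opLie X Y) = opLie (adOp n X) Y + opLie X (adOp n Y) := by
  simp only [adOp_apply, opLie_apply, Prod.mk_add_mk, add_zero, zero_smul, sub_zero, map_add,
    map_sub, map_smul, LinearMap.sub_apply, LinearMap.smul_apply, loopDeriv_lie]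
  congr 1
  rw [loopLie_leibniz n X.2 Y.2, loopLie_skew X.2 (loopDeriv n)]
  module

variable (B : LinearMap.BilinForm ℂ 𝔤)

/-- The properties shared by the elements of the adjoint group of `⨁_{i ≤ -d} L𝔤_i`. -/
structure IsGauge (d : ℤ) (g : Module.End ℂ (Op 𝔤)) : Prop where
  fst : ∀ X, (g X).1 = X.1
  lie : ∀ X Y, g (opLie X Y) = opLie (g X) (g Y)
  pairing : ∀ u v, pairing B (Ad g u) (Ad g v) = pairing B u v
  lowers : ∀ k, ∀ u ∈ fil 𝒢 k, Ad g u - u ∈ fil 𝒢 (k - d)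
  affine : ∀ q, act g q - Ad g q ∈ fil 𝒢 (-d)
  smooth : SmoothMapOn Set.univ (act g)

variable {B 𝒢}

theorem Ad_add (g : Module.End ℂ (Op 𝔤)) (u v : Loop 𝔤) : Ad g (u + v) = Ad g u + Ad g v := by
  have : ((0, u + v) : Op 𝔤) = (0, u) + (0, v) := by simp
  rw [Ad, this, map_add]; rfl

theorem Ad_smul (g : Module.End ℂ (Op 𝔤)) (c : ℂ) (u : Loop 𝔤) : Ad g (c • u) = c • Ad g u := by
  have : ((0, c • u) : Op 𝔤) = c • (0, u) := by simp
  rw [Ad, this, map_smul]; rfl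

theorem Ad_sub (g : Module.End ℂ (Op 𝔤)) (u v : Loop 𝔤) : Ad g (u - v) = Ad g u - Ad g v := by
  rw [eq_sub_iff_add_eq, ← Ad_add, sub_add_cancel]

theorem act_add (g : Module.End ℂ (Op 𝔤)) (q u : Loop 𝔤) : act g (q + u) = act g q + Ad g u := by
  have : ((1, q + u) : Op 𝔤) = (1, q) + (0, u) := by simp
  rw [act, this, map_add]; rfl

@[simp] theorem act_one (q : Loop 𝔤) : act (1 : Module.End ℂ (Op 𝔤)) q = q := rfl
@[simp] theorem Ad_one (q : Loop 𝔤) : Ad (1 : Module.End ℂ (Op 𝔤)) q = q := rfl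

namespace IsGauge

variable {d : ℤ} {g h : Module.End ℂ (Op 𝔤)}

theorem apply_one (hg : IsGauge 𝒢 B d g) (q : Loop 𝔤) : g (1, q) = (1, act g q) :=
  Prod.ext (hg.fst _) rfl

theorem apply_zero (hg : IsGauge 𝒢 B d g) (q : Loop 𝔤) : g (0, q) = (0, Ad g q) :=
  Prod.ext (hg.fst _) rfl

theorem act_mul (hh : IsGauge 𝒢 B d h) (g : Module.End ℂ (Op 𝔤)) (q : Loop 𝔤) :
    act (g * h) q = act g (act h q) := by
  rw [act, Module.End.mul_apply, hh.apply_one]; rfl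

theorem Ad_mul (hh : IsGauge 𝒢 B d h) (g : Module.End ℂ (Op 𝔤)) (q : Loop 𝔤) :
    Ad (g * h) q = Ad g (Ad h q) := by
  rw [Ad, Module.End.mul_apply, hh.apply_zero]; rfl

theorem Ad_mem (hg : IsGauge 𝒢 B d g) (hd : 0 ≤ d) {k : ℤ} {u : Loop 𝔤} (hu : u ∈ fil 𝒢 k) :
    Ad g u ∈ fil 𝒢 k := by
  have := add_mem (fil_mono 𝒢 (by omega) (hg.lowers k u hu)) hu
  rwa [sub_add_cancel] at this

theorem Ad_lie (hg : IsGauge 𝒢 B d g) (u v : Loop 𝔤) :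
    Ad g (loopLie u v) = loopLie (Ad g u) (Ad g v) := by
  have h := hg.lie (0, u) (0, v)
  rw [hg.apply_zero, hg.apply_zero] at h
  simpa [opLie_apply, Ad] using congrArg Prod.snd h

theorem poisson₂_act (hg : IsGauge 𝒢 B d g) (q u : Loop 𝔤) :
    poisson₂ (act g q) (Ad g u) = Ad g (poisson₂ q u) := by
  have h := hg.lie (1, q) (0, u)
  rw [hg.apply_one, hg.apply_zero] at h
  have h' := congrArg Prod.snd h
  simp only [opLie_apply, one_smul, zero_smul, sub_zero] at h'
  rw [poisson₂, poisson₂, LinearMap.add_apply, LinearMap.add_apply, add_comm (loopDeriv u),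
    add_comm (loopDeriv _), ← h']
  rfl

theorem one : IsGauge 𝒢 B d (1 : Module.End ℂ (Op 𝔤)) :=
  ⟨fun _ => rfl, fun _ _ => rfl, fun _ _ => rfl, fun k u _ => by simp, fun q => by simp,
    fun _ _ hc _ => hc⟩

theorem mul (hg : IsGauge 𝒢 B d g) (hh : IsGauge 𝒢 B d h) (hd : 0 ≤ d) :
    IsGauge 𝒢 B d (g * h) where
  fst X := by rw [Module.End.mul_apply, hg.fst, hh.fst]
  lie X Y := by simp only [Module.End.mul_apply, hh.lie, hg.lie]
  pairing u v := by rw [hh.Ad_mul, hh.Ad_mul, hg.pairing, hh.pairing]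
  lowers k u hu := by
    rw [hh.Ad_mul]
    have := add_mem (hg.lowers k _ (hh.Ad_mem hd hu)) (hh.lowers k u hu)
    rwa [sub_add_sub_cancel] at this
  affine q := by
    rw [hh.Ad_mul, hh.act_mul]
    have := add_mem (hg.affine (act h q)) (hg.Ad_mem hd (hh.affine q))
    rwa [Ad_sub, sub_add_sub_cancel] at this
  smooth k c hc hA := by
    simp only [hh.act_mul]
    exact hg.smooth k _ (hh.smooth k c hc hA) fun _ => Set.mem_univ _

end IsGauge

/-- On operators of order zero the exponential is that of the derivation `[n, ·]` of loops, to which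
`nilExp_bilin` applies. -/
theorem Ad_expAd_eq {n : Loop 𝔤} {K : ℕ} (hK : adOp n ^ K = 0) (u : Loop 𝔤) :
    (loopLie n : Module.End ℂ (Loop 𝔤)) ^ K = 0 ∧
      Ad (expAd n) u = nilExp (loopLie n : Module.End ℂ (Loop 𝔤)) u := by
  have hpow : ∀ (k : ℕ) (u : Loop 𝔤), (adOp n ^ k) (0, u) =
      (0, ((loopLie n : Module.End ℂ (Loop 𝔤)) ^ k) u) := by
    intro k u
    induction k with
    | zero => simp
    | succ k ih =>
      rw [pow_succ', Module.End.mul_apply, ih, pow_succ', Module.End.mul_apply, adOp_apply]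
      simp
  have h0 : (loopLie n : Module.End ℂ (Loop 𝔤)) ^ K = 0 := by
    ext1 v
    have := hpow K v
    rw [hK] at this
    exact (congrArg Prod.snd this).symm
  refine ⟨h0, ?_⟩
  rw [Ad, expAd_apply_eq hK, nilExp_eq_sum h0, Prod.snd_sum, LinearMap.sum_apply]
  refine Finset.sum_congr rfl fun k _ => ?_
  rw [hpow]; rfl

/-- Brackets are preserved because `ad n` is a derivation of operators. The pairing is preserved by
the same principle, with the zero derivation on the scalars. -/
theorem isGauge_expAd (hBinv : B.lieInvariant 𝔤) {d : ℤ}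
    (hd : 1 ≤ d) {n : Loop 𝔤} (hn : n ∈ fil 𝒢 (-d)) : IsGauge 𝒢 B d (expAd n) where
  fst X := by
    obtain ⟨K, hK⟩ := exists_adOp_pow_eq_zero 𝒢
    rw [expAd_apply_eq (hK n (fil_mono 𝒢 (by omega) hn)), Finset.sum_range_succ', Prod.fst_add,
      Prod.fst_sum]
    simp [adOp_pow_fst]
  lie X Y := nilExp_bilin (isNilpotent_adOp 𝒢 (fil_mono 𝒢 (by omega) hn))
    (isNilpotent_adOp 𝒢 (fil_mono 𝒢 (by omega) hn)) opLie (adOp_opLie n) X Y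
  pairing u v := by
    obtain ⟨K, hK⟩ := exists_adOp_pow_eq_zero 𝒢
    have hK' := hK n (fil_mono 𝒢 (by omega) hn)
    rw [(Ad_expAd_eq hK' u).2, (Ad_expAd_eq hK' v).2, ← nilExp_bilin
      ⟨_, (Ad_expAd_eq hK' u).1⟩ (IsNilpotent.zero : IsNilpotent (0 : Module.End ℂ ℂ))
      (LoopReduction.pairing B), nilExp_zero]
    · rfl
    · intro x y
      rw [loopLie_skew n x, map_neg, LinearMap.neg_apply, pairing_lie hBinv]
      simp
  lowers k u hu := by
    have h : adOp n (0, u) ∈ opFil 𝒢 (k - d) :=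
      adOp_mem_opFil 𝒢 hn ((mem_opFil 𝒢).2 ⟨rfl, hu⟩)
    exact ((mem_opFil 𝒢).1 (expAd_sub_mem 𝒢 hd hn h)).2
  affine q := by
    have h : adOp n (1, 0) ∈ opFil 𝒢 (-d) := by
      refine (mem_opFil 𝒢).2 ⟨rfl, ?_⟩
      rw [adOp_apply, map_zero, one_smul, zero_sub]
      exact neg_mem (loopDeriv_mem hn)
    have h1 := ((mem_opFil 𝒢).1 (expAd_sub_mem 𝒢 hd hn h)).2
    have h2 := act_add (expAd n) 0 q
    rw [zero_add] at h2
    rw [h2, add_sub_cancel_right]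
    simpa [act] using h1
  smooth k c hc _ := isPlot_act_expAd 𝒢 (isPlot_const n) hc fun _ => fil_mono 𝒢 (by omega) hn

end Gauge

/-! ### The adjoint group -/

section AdjointGroup

variable {𝔤 : Type*} [LieRing 𝔤] [LieAlgebra ℂ 𝔤] [Module.Finite ℂ 𝔤]
  {𝒢 : ℤ → Submodule ℂ 𝔤} [GradedLieAlgebra 𝒢] {B : LinearMap.BilinForm ℂ 𝔤}

theorem adjointGroup_mono {V W : Submodule ℂ (Loop 𝔤)} (h : V ≤ W) :
    adjointGroup V ≤ adjointGroup W :=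
  Subgroup.closure_mono fun _ ⟨n, hn, hg⟩ => ⟨n, h hn, hg⟩

variable (𝒢) in
theorem expUnit_mem {V : Submodule ℂ (Loop 𝔤)} {n : Loop 𝔤} (hn : n ∈ fil 𝒢 (-1)) (hV : n ∈ V) :
    expUnit 𝒢 n hn ∈ adjointGroup V :=
  Subgroup.subset_closure ⟨n, hV, rfl⟩

theorem inv_eq_expAd_neg {g : (Module.End ℂ (Op 𝔤))ˣ} {n : Loop 𝔤} (hn : n ∈ fil 𝒢 (-1))
    (hg : (g : Module.End ℂ (Op 𝔤)) = expAd n) :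
    ((g⁻¹ : (Module.End ℂ (Op 𝔤))ˣ) : Module.End ℂ (Op 𝔤)) = expAd (-n) :=
  Units.inv_eq_of_mul_eq_one_right (by rw [hg]; exact expAd_mul_neg 𝒢 hn)

/-- The inverse is carried through the induction, since the properties are not visibly stable under
inversion; for generators the inverse is `exp(ad(-n))`. -/
theorem isGauge_of_mem (hBinv : B.lieInvariant 𝔤) {d : ℤ} (hd : 1 ≤ d)
    {g : (Module.End ℂ (Op 𝔤))ˣ} (hg : g ∈ adjointGroup (fil 𝒢 (-d))) :
    IsGauge 𝒢 B d (g : Module.End ℂ (Op 𝔤)) := by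
  suffices h : IsGauge 𝒢 B d (g : Module.End ℂ (Op 𝔤)) ∧
      IsGauge 𝒢 B d ((g⁻¹ : (Module.End ℂ (Op 𝔤))ˣ) : Module.End ℂ (Op 𝔤)) from h.1
  induction hg using Subgroup.closure_induction with
  | mem g hg =>
    obtain ⟨n, hn, hg⟩ := hg
    rw [inv_eq_expAd_neg (fil_mono 𝒢 (by omega) hn) hg, hg]
    exact ⟨isGauge_expAd hBinv hd hn, isGauge_expAd hBinv hd (neg_mem hn)⟩
  | one => simpa using IsGauge.one
  | mul g h _ _ ihg ihh =>
    rw [mul_inv_rev, Units.val_mul, Units.val_mul]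
    exact ⟨ihg.1.mul ihh.1 (by omega), ihh.2.mul ihg.2 (by omega)⟩
  | inv g _ ih => rw [inv_inv]; exact ih.symm

/-- The group is arcwise connected. -/
theorem exists_path (hBinv : B.lieInvariant 𝔤) {d : ℤ} (hd : 1 ≤ d)
    {g : (Module.End ℂ (Op 𝔤))ˣ} (hg : g ∈ adjointGroup (fil 𝒢 (-d))) :
    ∃ γ : ℝ → (Module.End ℂ (Op 𝔤))ˣ, (∀ t, γ t ∈ adjointGroup (fil 𝒢 (-d))) ∧ γ 0 = 1 ∧
      γ 1 = g ∧ ∀ c : ℝ → Loop 𝔤, IsPlot c → IsPlot fun t => act (γ t).1 (c t) := by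
  -- Smoothness of the inverse path is added so that the induction passes inverses; generators are
  -- joined to the identity by `exp(ad(tn))`.
  suffices h : ∃ γ : ℝ → (Module.End ℂ (Op 𝔤))ˣ, (∀ t, γ t ∈ adjointGroup (fil 𝒢 (-d))) ∧
      γ 0 = 1 ∧ γ 1 = g ∧ (∀ c : ℝ → Loop 𝔤, IsPlot c → IsPlot fun t => act (γ t).1 (c t)) ∧
      ∀ c : ℝ → Loop 𝔤, IsPlot c → IsPlot fun t => act (γ t)⁻¹.1 (c t) by
    obtain ⟨γ, h1, h2, h3, h4, -⟩ := h
    exact ⟨γ, h1, h2, h3, h4⟩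
  induction hg using Subgroup.closure_induction with
  | mem g hg =>
    obtain ⟨n, hn, hg⟩ := hg
    have hn1 : ∀ t : ℝ, (t : ℂ) • n ∈ fil 𝒢 (-1) := fun t =>
      fil_mono 𝒢 (by omega) (Submodule.smul_mem _ _ hn)
    have hp : IsPlot fun t : ℝ => (t : ℂ) • n := (isPlot_const n).smul Complex.ofRealCLM.contDiff
    refine ⟨fun t => expUnit 𝒢 ((t : ℂ) • n) (hn1 t),
      fun t => expUnit_mem 𝒢 _ (Submodule.smul_mem _ _ hn), Units.ext ?_, Units.ext ?_,
      fun c hc => isPlot_act_expAd 𝒢 hp hc hn1, fun c hc =>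
        isPlot_act_expAd 𝒢 hp.neg hc fun t => neg_mem (hn1 t)⟩
    · simp only [expUnit, Complex.ofReal_zero, zero_smul, expAd_zero]; rfl
    · simp only [expUnit, Complex.ofReal_one, one_smul, hg]
  | one =>
    exact ⟨fun _ => 1, fun _ => one_mem _, rfl, rfl, fun c hc => hc, fun c hc => by simpa using hc⟩
  | mul g h _ _ ihg ihh =>
    obtain ⟨γ, h1, h2, h3, h4, h5⟩ := ihg
    obtain ⟨η, k1, k2, k3, k4, k5⟩ := ihh
    refine ⟨fun t => γ t * η t, fun t => mul_mem (h1 t) (k1 t), by simp [h2, k2],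
      by simp [h3, k3], fun c hc => ?_, fun c hc => ?_⟩
    · simp only [Units.val_mul, fun t => (isGauge_of_mem (B := B) hBinv hd (k1 t)).act_mul]
      exact h4 _ (k4 c hc)
    · have : ∀ t, act ((γ t * η t)⁻¹).1 (c t) = act (η t)⁻¹.1 (act (γ t)⁻¹.1 (c t)) := fun t => by
        rw [mul_inv_rev, Units.val_mul,
          (isGauge_of_mem (B := B) hBinv hd (inv_mem (h1 t))).act_mul]
      simp only [this]
      exact k5 _ (h5 c hc)
  | inv g _ ih =>
    obtain ⟨γ, h1, h2, h3, h4, h5⟩ := ih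
    exact ⟨fun t => (γ t)⁻¹, fun t => inv_mem (h1 t), by simp [h2], by simp [h3], h5,
      fun c hc => by simpa using h4 c hc⟩

end AdjointGroup

/-! ### Leading terms of group elements and freeness of the gauge action -/

section LeadingTerm

variable {𝔤 : Type*} [LieRing 𝔤] [LieAlgebra ℂ 𝔤] [Module.Finite ℂ 𝔤] [LieAlgebra.IsSimple ℂ 𝔤]
  {𝒢 : ℤ → Submodule ℂ 𝔤} [GradedLieAlgebra 𝒢] {B : LinearMap.BilinForm ℂ 𝔤}

variable (𝒢) in
/-- `Ad g - 1` lowers the degree by `k`. -/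
def Lowers (k : ℤ) (g : Module.End ℂ (Op 𝔤)) : Prop :=
  ∀ i, ∀ u ∈ fil 𝒢 i, Ad g u - u ∈ fil 𝒢 (i - k)

theorem part_lie_of_mem {i : ℤ} {u : 𝔤} (hu : u ∈ 𝒢 i) (k : ℤ) (w : 𝔤) :
    part 𝒢 (i + k) ⁅w, u⁆ = ⁅part 𝒢 k w, u⁆ := by
  rw [← lie_skew, map_neg, part_lie 𝒢 hu, lie_skew]

theorem part_lie_gradingElement {h : 𝔤} (hh : ∀ i, ∀ x ∈ 𝒢 i, ⁅h, x⁆ = (i : ℂ) • x) (i : ℤ)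
    (x : 𝔤) : part 𝒢 i ⁅h, x⁆ = (i : ℂ) • part 𝒢 i x := by
  have : (part 𝒢 i) ∘ₗ (LieModule.toEnd ℂ 𝔤 𝔤 h) = (i : ℂ) • part 𝒢 i := by
    refine linear_induction 𝒢 fun j y hy => ?_
    simp only [LinearMap.comp_apply, LieModule.toEnd_apply_apply, LinearMap.smul_apply, hh j y hy,
      map_smul]
    rcases eq_or_ne j i with rfl | hji
    · rfl
    · rw [part_of_ne 𝒢 hy hji, smul_zero, smul_zero]
  exact LinearMap.congr_fun this x

theorem gradingElement_mem {h : 𝔤} (hh : ∀ i, ∀ x ∈ 𝒢 i, ⁅h, x⁆ = (i : ℂ) • x) :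
    h ∈ degLE 𝒢 0 := by
  refine (mem_degLE 𝒢).2 fun i hi => ?_
  have := part_lie_gradingElement hh i h
  rw [lie_self, map_zero] at this
  exact (smul_eq_zero.1 this.symm).resolve_left (by exact_mod_cast hi.ne')

theorem mem_degLE_of_part {k : ℤ} {x : 𝔤} (hx : x ∈ degLE 𝒢 k) (h : part 𝒢 k x = 0) :
    x ∈ degLE 𝒢 (k - 1) := by
  simpa [h] using sub_part_mem_degLE 𝒢 hx

/-- The leading term of an element of the group, as an infinitesimal transformation. -/
theorem IsGauge.exists_leading {d : ℤ} {g : Module.End ℂ (Op 𝔤)} (hg : IsGauge 𝒢 B d g) {k : ℤ}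
    (hk : 1 ≤ k) (hl : Lowers 𝒢 k g) :
    ∃ n ∈ loopsIn (𝒢 (-k)), ∀ i, ∀ u ∈ fil 𝒢 i, Ad g u - u - loopLie n u ∈ fil 𝒢 (i - k - 1) := by
  obtain ⟨h, hh⟩ := exists_grading_element 𝒢
  have hk0 : (k : ℂ) ≠ 0 := by exact_mod_cast (by omega : k ≠ 0)
  -- Since `g` preserves brackets, `Ad g h` acts on `Ad g u` by `i` whenever `[h, u] = i u`. The
  -- component of `w` of degree `-k`, divided by `k`, will be the infinitesimal transformation.
  set w := Ad g (constLoop h) - constLoop h with hw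
  have hwm : w ∈ fil 𝒢 (-k) := by
    have := hl 0 (constLoop h) fun _ => gradingElement_mem hh
    rwa [zero_sub] at this
  let n : Loop 𝔤 := loopMap ((k : ℂ)⁻¹ • part 𝒢 (-k)) w
  have hn : n ∈ loopsIn (𝒢 (-k)) := fun x => Submodule.smul_mem _ _ (part_mem 𝒢 _ _)
  have hnf : n ∈ fil 𝒢 (-k) := fun x => le_degLE 𝒢 le_rfl (hn x)
  have hom : ∀ i, ∀ u ∈ loopsIn (𝒢 i), Ad g u - u - loopLie n u ∈ fil 𝒢 (i - k - 1) := by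
    intro i u hu x
    have huf : u ∈ fil 𝒢 i := fun x => le_degLE 𝒢 le_rfl (hu x)
    set v := Ad g u - u with hv
    have hvm : v ∈ fil 𝒢 (i - k) := hl i u huf
    have h1 : loopLie (constLoop h) u = (i : ℂ) • u := Loop.ext fun y => hh i _ (hu y)
    have h2 : loopLie (w + constLoop h) (v + u) = (i : ℂ) • (v + u) := by
      rw [hw, hv, sub_add_cancel, sub_add_cancel, ← hg.Ad_lie, h1, Ad_smul]
    have h3 : ⁅w x, v x⁆ + ⁅w x, u x⁆ + ⁅h, v x⁆ = (i : ℂ) • v x := by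
      have h4 : ⁅w x + h, v x + u x⁆ = (i : ℂ) • (v x + u x) := congrArg (fun z : Loop 𝔤 => z x) h2
      rw [add_lie, lie_add, lie_add, hh i _ (hu x), smul_add, ← add_assoc] at h4
      exact add_right_cancel h4
    -- In degree `i - k` the bracket `[w, v]` is too low to contribute, `[h, v]` contributes `(i -
    -- k)v`, and the right-hand side `i v`; the difference is `k v`.
    have h5 : (k : ℂ) • part 𝒢 (i - k) (v x) = ⁅part 𝒢 (-k) (w x), u x⁆ := by
      have h6 := congrArg (part 𝒢 (i - k)) h3
      rw [map_add, map_add, part_lie_gradingElement hh, map_smul,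
        (mem_degLE 𝒢).1 (lie_mem_degLE 𝒢 (hwm x) (hvm x)) (i - k) (by omega), zero_add,
        sub_eq_add_neg i k, part_lie_of_mem (hu x), ← sub_eq_add_neg, ← eq_sub_iff_add_eq,
        ← sub_smul] at h6
      rw [h6]
      congr 1
      push_cast
      ring
    refine mem_degLE_of_part (sub_mem (hvm x)
      (by simpa [sub_eq_neg_add] using lie_mem_degLE 𝒢 (hnf x) (huf x))) ?_
    rw [loop_sub_apply, loopLie_apply, map_sub, sub_eq_zero]
    have h7 : ⁅n x, u x⁆ = (k : ℂ)⁻¹ • ⁅part 𝒢 (-k) (w x), u x⁆ := by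
      rw [← smul_lie]; rfl
    rw [part_self 𝒢 (show ⁅n x, u x⁆ ∈ 𝒢 (i - k) by
      simpa [sub_eq_neg_add] using SetLike.GradedBracket.bracket_mem (hn x) (hu x)), h7, ← h5,
      smul_smul, inv_mul_cancel₀ hk0, one_smul]
  refine ⟨n, hn, fun i u hu => ?_⟩
  have hp : loopMap (part 𝒢 i) u ∈ loopsIn (𝒢 i) := fun x => part_mem 𝒢 _ _
  -- Below the top component, both `Ad g - 1` and `[n, ·]` already land one degree lower.
  have hr : u - loopMap (part 𝒢 i) u ∈ fil 𝒢 (i - 1) := fun x => sub_part_mem_degLE 𝒢 (hu x)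
  set r := u - loopMap (part 𝒢 i) u
  have h8 : u = loopMap (part 𝒢 i) u + r := by simp [r]
  have h9 := add_mem (hom i _ hp) (sub_mem (fil_mono 𝒢 (by omega) (hl _ r hr))
    (lie_mem_fil_of_le 𝒢 hnf hr (by omega : _ ≤ i - k - 1)))
  rw [h8, Ad_add, map_add]
  convert h9 using 1
  abel

/-- An element that acts trivially on loops is trivial. -/
theorem IsGauge.eq_one {d : ℤ} {g : Module.End ℂ (Op 𝔤)} (hg : IsGauge 𝒢 B d g)
    (h : ∀ u, Ad g u = u) : g = 1 := by
  have hact : ∀ q, act g q = q := by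
    intro q
    rw [← sub_eq_zero]
    -- Comparing `[d/dx + q, y]` before and after the action, for constant `y`, shows that `g · q -
    -- q` is pointwise central.
    refine Loop.ext fun x => eq_zero_of_lie_eq_zero fun y => ?_
    have h1 := hg.poisson₂_act q (constLoop y)
    rw [h, h, poisson₂, poisson₂, LinearMap.add_apply, LinearMap.add_apply] at h1
    have h2 : ⁅act g q x, y⁆ = ⁅q x, y⁆ := congrArg (fun z : Loop 𝔤 => z x) (add_left_cancel h1)
    rw [loop_sub_apply, sub_lie, h2, sub_self]
  refine LinearMap.ext fun X => ?_
  have hX : X = X.1 • ((1, 0) : Op 𝔤) + (0, X.2) := by ext1 <;> simp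
  rw [hX, map_add, map_smul, hg.apply_one, hg.apply_zero, hact, h]
  simp

variable (𝒢) in
-- Lowering by more than the width of the grading leaves nothing of `Ad g - 1`, and the adjoint
-- action determines `g`.
theorem exists_lowers_eq_one : ∃ N : ℤ, ∀ (B : LinearMap.BilinForm ℂ 𝔤) (d : ℤ)
    (g : Module.End ℂ (Op 𝔤)), IsGauge 𝒢 B d g → Lowers 𝒢 N g → g = 1 := by
  obtain ⟨M, hbot, htop⟩ := exists_degLE_bounds 𝒢
  refine ⟨2 * M, fun B d g hg hl => hg.eq_one fun u => sub_eq_zero.1 (Loop.ext fun x => ?_)⟩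
  have h1 := hl M u (fun y => by simp [htop]) x
  rw [show (M : ℤ) - 2 * M = -M by ring, hbot] at h1
  exact h1

/-- To first order `exp(-n)` subtracts `[n, ·]`, which is the leading term; all other contributions
have degree at most `i - 2k`, and `2k ≥ k + 1`. -/
theorem lowers_expAd_neg_mul {d : ℤ} {g : Module.End ℂ (Op 𝔤)}
    (hg : IsGauge 𝒢 B d g) {k : ℤ} (hk : 1 ≤ k) {n : Loop 𝔤}
    (hn : n ∈ fil 𝒢 (-k)) (hd : 0 ≤ d)
    (h : ∀ i, ∀ u ∈ fil 𝒢 i, Ad g u - u - loopLie n u ∈ fil 𝒢 (i - k - 1)) :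
    Lowers 𝒢 (k + 1) (expAd (-n) * g) := by
  intro i u hu
  rw [hg.Ad_mul]
  have hm : -n ∈ fil 𝒢 (-k) := neg_mem hn
  have hy := hg.Ad_mem hd hu
  have hX : adOp (-n) (adOp (-n) (0, Ad g u)) ∈ opFil 𝒢 (i - k - 1) := by
    have := (mem_opFil 𝒢).1 (adOp_mem_opFil 𝒢 hm (adOp_mem_opFil 𝒢 hm
      ((mem_opFil 𝒢).2 ⟨rfl, hy⟩ : ((0, Ad g u) : Op 𝔤) ∈ opFil 𝒢 i)))
    exact (mem_opFil 𝒢).2 ⟨this.1, fil_mono 𝒢 (by omega) this.2⟩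
  have h1 := ((mem_opFil 𝒢).1 (expAd_sub_sub_mem 𝒢 hk hm hX)).2
  have h2 : (expAd (-n) (0, Ad g u) - (0, Ad g u) - adOp (-n) (0, Ad g u)).2 =
      Ad (expAd (-n)) (Ad g u) - Ad g u + loopLie n (Ad g u) := by
    rw [adOp_apply]
    simp only [Prod.snd_sub, zero_smul, sub_zero, map_neg, LinearMap.neg_apply, sub_neg_eq_add]
    rfl
  rw [h2] at h1
  have h3 := h i u hu
  have h4 : loopLie n (Ad g u - u) ∈ fil 𝒢 (i - k - 1) := by
    refine lie_mem_fil_of_le 𝒢 (j := i - k) hn ?_ (by omega)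
    have h5 := add_mem (fil_mono 𝒢 (by omega : _ ≤ i - k) h3)
      (lie_mem_fil_of_le 𝒢 hn hu (by omega : _ ≤ i - k))
    rwa [sub_add_cancel] at h5
  have h6 := sub_mem (add_mem h1 h3) h4
  rw [sub_add_eq_sub_sub]
  convert h6 using 1
  rw [map_sub]
  abel

/-- Splitting off exponentials of leading terms writes `g` as a finite product with factors in
degrees `-k, -k-1, …`. This replaces a logarithm: the degree by which `Ad g` lowers determines the
subgroup containing `g`. -/
theorem mem_adjointGroup_of_lowers (hBinv : B.lieInvariant 𝔤) {k : ℤ} (hk : 1 ≤ k)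
    {g : (Module.End ℂ (Op 𝔤))ˣ} (hg : g ∈ adjointGroup (fil 𝒢 (-1))) (hl : Lowers 𝒢 k g.1) :
    g ∈ adjointGroup (fil 𝒢 (-k)) := by
  obtain ⟨N, hN⟩ := exists_lowers_eq_one 𝒢
  suffices h : ∀ (j : ℕ) (k : ℤ), 1 ≤ k → N ≤ k + j → ∀ g ∈ adjointGroup (fil 𝒢 (-1)),
      Lowers 𝒢 k g.1 → g ∈ adjointGroup (fil 𝒢 (-k)) from
    h (N - k).toNat k hk (by omega) g hg hl
  intro j
  induction j with
  | zero =>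
    intro k hk hkN g hg hl
    have : g = 1 := Units.ext <| hN B 1 _ (isGauge_of_mem hBinv le_rfl hg) fun i u hu =>
      fil_mono 𝒢 (by push_cast at hkN; omega) (hl i u hu)
    rw [this]
    exact one_mem _
  | succ j ih =>
    intro k hk hkN g hg hl
    have hgg := isGauge_of_mem hBinv le_rfl hg
    obtain ⟨n, hn, h⟩ := hgg.exists_leading hk hl
    have hnk : n ∈ fil 𝒢 (-k) := fun x => le_degLE 𝒢 le_rfl (hn x)
    have hn1 : n ∈ fil 𝒢 (-1) := fil_mono 𝒢 (by omega) hnk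
    have h1 := ih (k + 1) (by omega) (by push_cast at hkN; omega) ((expUnit 𝒢 n hn1)⁻¹ * g)
      (mul_mem (inv_mem (expUnit_mem 𝒢 hn1 hn1)) hg)
      (lowers_expAd_neg_mul hgg hk hnk (by omega) h)
    have h2 := mul_mem (expUnit_mem 𝒢 hn1 hnk) (adjointGroup_mono (fil_mono 𝒢 (by omega)) h1)
    rwa [mul_inv_cancel_left] at h2

theorem lowers_of_leading_eq_zero {g : Module.End ℂ (Op 𝔤)} {k : ℤ} {n : Loop 𝔤} (hn : n = 0)
    (h : ∀ i, ∀ u ∈ fil 𝒢 i, Ad g u - u - loopLie n u ∈ fil 𝒢 (i - k - 1)) :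
    Lowers 𝒢 (k + 1) g := fun i u hu => by
  have := h i u hu
  rw [hn, map_zero, LinearMap.zero_apply, sub_zero] at this
  rwa [← sub_sub]

variable {e : 𝔤} {C : Submodule ℂ 𝔤} {ρ : 𝔤 →ₗ[ℂ] 𝔤}

theorem constLoop_mem_fil {k : ℤ} {x : 𝔤} (hx : x ∈ degLE 𝒢 k) : constLoop x ∈ fil 𝒢 k := fun _ => hx

/-- The gauge action is free on `e + ⨁_{i ≤ 1} L𝔤_i`, in a strong sense. -/
theorem eq_one_of_act_sub (hBinv : B.lieInvariant 𝔤) (he : IsGoodElement 𝒢 e)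
    (hρ : IsPartialInverse 𝒢 e C ρ)
    {g : (Module.End ℂ (Op 𝔤))ˣ} (hg : g ∈ adjointGroup (fil 𝒢 (-1))) {p : Loop 𝔤}
    (hp : p - constLoop e ∈ fil 𝒢 1) (h : loopMap ρ (act g.1 p - p) = 0) : g = 1 := by
  have hl : ∀ j : ℕ, Lowers 𝒢 (j + 1) g.1 := by
    intro j
    induction j with
    | zero => exact fun i u hu => by simpa using (isGauge_of_mem hBinv le_rfl hg).lowers i u hu
    | succ j ih =>
      set k : ℤ := j + 1 with hk
      have hk1 : 1 ≤ k := by omega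
      -- Membership in the smaller subgroup also bounds the inhomogeneous part `g · p - Ad g p`, on
      -- which the condition on `Ad g` alone says nothing directly.
      have hgk := isGauge_of_mem hBinv hk1 (mem_adjointGroup_of_lowers hBinv hk1 hg ih)
      obtain ⟨n, hn, hlead⟩ := hgk.exists_leading hk1 ih
      have h1 := fil_mono 𝒢 (by omega : -k ≤ 1 - k) (hgk.affine p)
      have h2 := ih 1 _ hp
      have h3 := hlead 2 (constLoop e) (constLoop_mem_fil (le_degLE 𝒢 le_rfl he.mem))
      have h4 : act g.1 p - p - loopLie n (constLoop e) ∈ fil 𝒢 (1 - k) := by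
        have := add_mem (add_mem h1 h2) (fil_mono 𝒢 (by omega : 2 - k - 1 ≤ 1 - k) h3)
        convert this using 1
        rw [Ad_sub]
        abel
      -- Modulo degree `1 - k` the displacement is `[n, e]`, so applying `ρ` returns `-n` modulo
      -- degree `-k - 1`. By hypothesis `ρ` kills the displacement.
      have h5 : n = 0 := by
        refine Loop.ext fun x => eq_zero_of_mem_of_mem_degLE 𝒢 (hn x) (l := -k - 1) ?_ (by omega)
        have h6 := hρ.lowers _ _ (h4 x)
        have h7 : ρ (act g.1 p x - p x) = 0 := congrArg (fun z : Loop 𝔤 => z x) h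
        rw [loop_sub_apply, loop_sub_apply, map_sub, h7, zero_sub, loopLie_apply, constLoop_apply,
          ← lie_skew, map_neg, neg_neg, hρ.lie _ (le_degLE 𝒢 (by omega) (hn x))] at h6
        exact degLE_mono 𝒢 (by omega) h6
      have := lowers_of_leading_eq_zero h5 hlead
      push_cast
      exact this
  obtain ⟨N, hN⟩ := exists_lowers_eq_one 𝒢
  exact Units.ext <| hN B 1 _ (isGauge_of_mem hBinv le_rfl hg) fun i u hu =>
    fil_mono 𝒢 (by omega : i - (N.toNat + 1) ≤ i - N) (hl N.toNat i u hu)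

/-! ### The projection to `𝔫⁺` and the isotropy group -/

theorem projPlus_eq_filterPart : projPlus 𝒢 = filterPart 𝒢 (1 ≤ ·) := rfl

theorem projPlus_eq_zero_iff {x : 𝔤} : projPlus 𝒢 x = 0 ↔ x ∈ degLE 𝒢 0 := by
  rw [projPlus_eq_filterPart]
  refine ⟨fun h => (mem_degLE 𝒢).2 fun i hi => ?_, fun h => eq_zero_of_part 𝒢 fun i => ?_⟩
  · have := part_filterPart 𝒢 (1 ≤ ·) i x
    rw [h, map_zero, if_pos (by omega)] at this
    exact this.symm
  · rw [part_filterPart]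
    split_ifs with hi
    · exact (mem_degLE 𝒢).1 h i (by omega)
    · rfl

theorem projPlus_of_mem_nPlus {x : 𝔤} (hx : x ∈ nPlus 𝒢) : projPlus 𝒢 x = x := by
  rw [← sub_eq_zero]
  refine eq_zero_of_part 𝒢 fun i => ?_
  rw [map_sub, projPlus_eq_filterPart, part_filterPart]
  split_ifs with hi
  · rw [sub_self]
  · rw [(mem_degGE 𝒢).1 hx i (by omega), sub_zero]

theorem projPlus_mem (x : 𝔤) : projPlus 𝒢 x ∈ nPlus 𝒢 := by
  refine (mem_degGE 𝒢).2 fun i hi => ?_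
  rw [projPlus_eq_filterPart, part_filterPart, if_neg (by omega)]

theorem loopMap_projPlus_eq_iff {u v : Loop 𝔤} :
    loopMap (projPlus 𝒢) u = loopMap (projPlus 𝒢) v ↔ u - v ∈ fil 𝒢 0 := by
  rw [← sub_eq_zero, ← map_sub]
  exact ⟨fun h x => projPlus_eq_zero_iff.1 (congrArg (fun z : Loop 𝔤 => z x) h),
    fun h => Loop.ext fun x => projPlus_eq_zero_iff.2 (h x)⟩

theorem loopMap_projPlus_constLoop (he : IsGoodElement 𝒢 e) :
    loopMap (projPlus 𝒢) (constLoop e) = constLoop e :=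
  Loop.ext fun _ => projPlus_of_mem_nPlus (le_degGE 𝒢 (by norm_num) he.mem)

theorem loopMap_projPlus_eq_constLoop (he : IsGoodElement 𝒢 e) {u : Loop 𝔤} :
    loopMap (projPlus 𝒢) u = constLoop e ↔ u - constLoop e ∈ fil 𝒢 0 := by
  have h := loopMap_projPlus_eq_iff (𝒢 := 𝒢) (u := u) (v := constLoop e)
  rwa [loopMap_projPlus_constLoop he] at h

/-- The isotropy group of `e`. -/
theorem mem_adjointGroup_gMinus_iff (hBinv : B.lieInvariant 𝔤) (he : IsGoodElement 𝒢 e)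
    {g : (Module.End ℂ (Op 𝔤))ˣ} :
    g ∈ adjointGroup (fil 𝒢 (-2)) ↔ g ∈ adjointGroup (fil 𝒢 (-1)) ∧
      loopMap (projPlus 𝒢) (Ad g.1 (constLoop e)) = constLoop e := by
  rw [loopMap_projPlus_eq_constLoop he]
  have hef : constLoop e ∈ fil 𝒢 2 := constLoop_mem_fil (le_degLE 𝒢 le_rfl he.mem)
  constructor
  · intro hg
    have := (isGauge_of_mem hBinv (by norm_num) hg).lowers 2 _ hef
    exact ⟨adjointGroup_mono (fil_mono 𝒢 (by norm_num)) hg, by simpa using this⟩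
  · rintro ⟨hg, h⟩
    have hgg := isGauge_of_mem hBinv le_rfl hg
    obtain ⟨n, hn, hlead⟩ := hgg.exists_leading le_rfl hgg.lowers
    have h1 := sub_mem h (hlead 2 _ hef)
    rw [sub_sub_cancel] at h1
    -- Modulo `𝔟⁻`, the element `e` moves by `[n, e]` of degree one; if it is fixed there, goodness
    -- in degree `-1` forces `n = 0`, and `g` lowers by two.
    have h2 : n = 0 := by
      refine Loop.ext fun x => he.injective (-1) le_rfl _ (hn x) ?_
      have h3 : ⁅e, n x⁆ ∈ 𝒢 (2 + -1) := SetLike.GradedBracket.bracket_mem he.mem (hn x)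
      refine eq_zero_of_mem_of_mem_degLE 𝒢 h3 (l := 0) ?_ (by norm_num)
      have h4 := neg_mem (h1 x)
      rwa [loopLie_apply, constLoop_apply, lie_skew] at h4
    have h5 := lowers_of_leading_eq_zero h2 hlead
    rw [show (1 : ℤ) + 1 = 2 from rfl] at h5
    exact mem_adjointGroup_of_lowers hBinv (by norm_num : (1 : ℤ) ≤ 2) hg h5

end LeadingTerm

/-! ### Smooth maps whose derivatives have adjoints -/

section Adjointable

variable {𝔤 : Type*} [LieRing 𝔤] [LieAlgebra ℂ 𝔤] [Module.Finite ℂ 𝔤] [LieAlgebra.IsSimple ℂ 𝔤]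
  {B : LinearMap.BilinForm ℂ 𝔤}

/-- The chain rule for functionals, applied to the evaluations `q ↦ φ(Φ(q)(x))`. -/
theorem SmoothMapOn.hasVelocity_comp {A : AffineSubspace ℂ (Loop 𝔤)} {V : Submodule ℂ 𝔤}
    (hV : A.direction = loopsIn V) {Φ : Loop 𝔤 → Loop 𝔤}
    (hΦ : SmoothMapOn (A : Set (Loop 𝔤)) Φ) {c : ℝ → Loop 𝔤} (hc : IsPlot c) (hA : ∀ t, c t ∈ A)
    {v w : Loop 𝔤} (hv : HasVelocity c v)
    (hw : HasVelocity (fun t : ℝ => Φ (c 0 + (t : ℂ) • v)) w) :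
    HasVelocity (fun t => Φ (c t)) w := fun φ x =>
  SmoothFunctionalOn.hasDerivAt_comp hV (F := fun q => φ (Φ q x))
    (fun k c hc hA => (hΦ k c hc hA φ).comp (by fun_prop : ContDiff ℝ ∞ fun t => (t, x)))
    hc hA hv (hw φ x)

theorem SmoothMapOn.hasVelocity_comp_univ {Φ : Loop 𝔤 → Loop 𝔤}
    (hΦ : SmoothMapOn Set.univ Φ) {c : ℝ → Loop 𝔤} (hc : IsPlot c)
    {v : Loop 𝔤} (hv : HasVelocity c v) :
    HasVelocity (fun t => Φ (c t)) (lineDeriv Φ (c 0) v) :=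
  SmoothMapOn.hasVelocity_comp (A := ⊤) direction_top (by simpa using hΦ) hc
    (fun _ => AffineSubspace.mem_top ℂ _ _) hv (hΦ.hasVelocity _ _)

variable (B) in
/-- `Φ` is smooth, and `Φ'` is the field of the adjoints of its derivatives. -/
structure HasAdjoint (Φ : Loop 𝔤 → Loop 𝔤) (Φ' : Loop 𝔤 → Loop 𝔤 → Loop 𝔤) : Prop where
  smooth : SmoothMapOn Set.univ Φ
  smooth_adjoint : ∀ (k : ℕ) (c d : (Fin k → ℝ) → Loop 𝔤), IsPlot c → IsPlot d →
    IsPlot fun t => Φ' (c t) (d t)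
  adjoint : ∀ q s u, pairing B u (lineDeriv Φ q s) = pairing B (Φ' q u) s

variable (B) in
/-- Smooth maps whose derivatives have smooth adjoints. -/
def Adjointable (Φ : Loop 𝔤 → Loop 𝔤) : Prop := ∃ Φ', HasAdjoint B Φ Φ'

theorem adjointable_const (u : Loop 𝔤) : Adjointable B fun _ => u :=
  ⟨fun _ _ => 0, fun _ _ _ _ => isPlot_const u, fun _ _ _ _ _ => isPlot_const 0, fun q s u => by
    rw [lineDeriv_eq (hasVelocity_const _)]; simp⟩

theorem adjointable_id : Adjointable B fun q : Loop 𝔤 => q :=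
  ⟨fun _ u => u, fun _ _ hc _ => hc, fun _ _ _ _ hd => hd, fun q s u => by
    rw [lineDeriv_eq (hasVelocity_line q s)]⟩

theorem Adjointable.add {Φ Ψ : Loop 𝔤 → Loop 𝔤} (hΦ : Adjointable B Φ) (hΨ : Adjointable B Ψ) :
    Adjointable B fun q => Φ q + Ψ q := by
  obtain ⟨Φ', h⟩ := hΦ
  obtain ⟨Ψ', k⟩ := hΨ
  refine ⟨fun q u => Φ' q u + Ψ' q u, fun n c hc hA => (h.smooth n c hc hA).add (k.smooth n c hc hA),
    fun n c d hc hd => (h.smooth_adjoint n c d hc hd).add (k.smooth_adjoint n c d hc hd),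
    fun q s u => ?_⟩
  rw [lineDeriv_eq ((h.smooth.hasVelocity q s).add (k.smooth.hasVelocity q s)), map_add,
    h.adjoint, k.adjoint, map_add, LinearMap.add_apply]

theorem Adjointable.const_smul {Φ : Loop 𝔤 → Loop 𝔤} (hΦ : Adjointable B Φ) (a : ℂ) :
    Adjointable B fun q => a • Φ q := by
  obtain ⟨Φ', h⟩ := hΦ
  refine ⟨fun q u => a • Φ' q u, fun n c hc hA => (h.smooth n c hc hA).smul contDiff_const,
    fun n c d hc hd => (h.smooth_adjoint n c d hc hd).smul contDiff_const, fun q s u => ?_⟩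
  rw [lineDeriv_eq ((h.smooth.hasVelocity q s).const_smul a), map_smul, h.adjoint, map_smul,
    LinearMap.smul_apply]

theorem Adjointable.sub {Φ Ψ : Loop 𝔤 → Loop 𝔤} (hΦ : Adjointable B Φ) (hΨ : Adjointable B Ψ) :
    Adjointable B fun q => Φ q - Ψ q := by
  have h : (fun q => Φ q - Ψ q) = fun q => Φ q + (-1 : ℂ) • Ψ q := by funext q; module
  exact h ▸ hΦ.add (hΨ.const_smul (-1))

theorem Adjointable.sum {Φ : ℕ → Loop 𝔤 → Loop 𝔤} (h : ∀ k, Adjointable B (Φ k)) (K : ℕ) :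
    Adjointable B fun q => ∑ k ∈ Finset.range K, Φ k q := by
  induction K with
  | zero => simpa using adjointable_const 0
  | succ K ih => simpa only [Finset.sum_range_succ] using ih.add (h K)

theorem Adjointable.map (hB : B.Nondegenerate) {Φ : Loop 𝔤 → Loop 𝔤} (hΦ : Adjointable B Φ)
    (L : 𝔤 →ₗ[ℂ] 𝔤) : Adjointable B fun q => loopMap L (Φ q) := by
  obtain ⟨Φ', h⟩ := hΦ
  obtain ⟨L', hL⟩ := exists_adjoint hB L
  refine ⟨fun q u => Φ' q (loopMap L' u), fun n c hc hA => (h.smooth n c hc hA).map L,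
    fun n c d hc hd => h.smooth_adjoint n c _ hc (hd.map L'), fun q s u => ?_⟩
  rw [lineDeriv_eq ((h.smooth.hasVelocity q s).map L), ← pairing_map hL, h.adjoint]

theorem Adjointable.deriv (hB : B.Nondegenerate) {Φ : Loop 𝔤 → Loop 𝔤} (hΦ : Adjointable B Φ) :
    Adjointable B fun q => loopDeriv (Φ q) := by
  obtain ⟨Φ', h⟩ := hΦ
  refine ⟨fun q u => Φ' q (-loopDeriv u), fun n c hc hA => (h.smooth n c hc hA).deriv,
    fun n c d hc hd => h.smooth_adjoint n c _ hc hd.deriv.neg, fun q s u => ?_⟩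
  rw [lineDeriv_eq ((h.smooth.hasVelocity q s).deriv hB
    (h.smooth.comp_plot (isPlot_line q s) fun _ => Set.mem_univ _)), ← h.adjoint, map_neg,
    LinearMap.neg_apply, pairing_loopDeriv, neg_neg]

theorem Adjointable.lie (hBinv : B.lieInvariant 𝔤) {Φ Ψ : Loop 𝔤 → Loop 𝔤}
    (hΦ : Adjointable B Φ) (hΨ : Adjointable B Ψ) :
    Adjointable B fun q => loopLie (Φ q) (Ψ q) := by
  obtain ⟨Φ', h⟩ := hΦ
  obtain ⟨Ψ', k⟩ := hΨ
  refine ⟨fun q u => Φ' q (loopLie (Ψ q) u) + Ψ' q (loopLie u (Φ q)),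
    fun n c hc hA => (h.smooth n c hc hA).lie (k.smooth n c hc hA),
    fun n c d hc hd => (h.smooth_adjoint n c _ hc ((k.smooth n c hc fun _ => Set.mem_univ _).lie
      hd)).add (k.smooth_adjoint n c _ hc (hd.lie (h.smooth n c hc fun _ => Set.mem_univ _))),
    fun q s u => ?_⟩
  rw [lineDeriv_eq ((h.smooth.hasVelocity q s).lie (k.smooth.hasVelocity q s)), map_add,
    map_add, LinearMap.add_apply, ← h.adjoint, ← k.adjoint, pairing_lie hBinv u, loopLie_skew (Ψ q) u,
    map_neg, LinearMap.neg_apply, pairing_lie hBinv u, loopLie_skew (Ψ q), map_neg, neg_neg]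
  simp

/-- The exponential series has a fixed number of terms, each obtained by iterated brackets and one
`x`-derivative; integration by parts and invariance of the form supply the adjoints. -/
theorem Adjointable.act_expAd {𝒢 : ℤ → Submodule ℂ 𝔤} [GradedLieAlgebra 𝒢] (hB : B.Nondegenerate)
    (hBinv : B.lieInvariant 𝔤) {Φ Ψ : Loop 𝔤 → Loop 𝔤}
    (hΦ : Adjointable B Φ) (hΨ : Adjointable B Ψ) (hm : ∀ q, Φ q ∈ fil 𝒢 (-1)) :
    Adjointable B fun q => act (expAd (Φ q)) (Ψ q) := by
  obtain ⟨K, hK⟩ := exists_adOp_pow_eq_zero 𝒢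
  simp only [fun t => act_expAd_eq (hK (Φ t) (hm t)) (Ψ t)]
  refine Adjointable.sum (fun k => Adjointable.const_smul ?_ _) _
  induction k with
  | zero => simpa using hΨ
  | succ k ih =>
    simp only [adOp_pow_succ_snd]
    exact (hΦ.lie hBinv ih).sub ((hΦ.deriv hB).const_smul _)

/-- The gradient of a pulled back functional. -/
theorem HasAdjoint.hasGradOn_comp {Φ : Loop 𝔤 → Loop 𝔤} {Φ' : Loop 𝔤 → Loop 𝔤 → Loop 𝔤}
    (h : HasAdjoint B Φ Φ') {N : AffineSubspace ℂ (Loop 𝔤)} {V : Submodule ℂ 𝔤}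
    (hV : N.direction = loopsIn V) (hN : ∀ q, Φ q ∈ N) {f : Loop 𝔤 → ℂ} {δf : Loop 𝔤 → Loop 𝔤}
    (hf : HasGradOn B N f δf) :
    HasGradOn B ⊤ (fun q => f (Φ q)) fun q => Φ' q (δf (Φ q)) where
  smooth k c hc _ := hf.smooth k _ (h.smooth k c hc fun _ => Set.mem_univ _) fun _ => hN _
  smooth_grad k c hc _ := h.smooth_adjoint k c _ hc
    (hf.smooth_grad k _ (h.smooth k c hc fun _ => Set.mem_univ _) fun _ => hN _)
  deriv q _ s _ := by
    have := hf.hasDerivAt_comp hV (c := fun θ : ℝ => Φ (q + (θ : ℂ) • s))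
      (h.smooth.comp_plot (isPlot_line q s) fun _ => Set.mem_univ _) (fun _ => hN _)
      (h.smooth.hasVelocity q s)
    simp only [Complex.ofReal_zero, zero_smul, add_zero] at this
    rwa [h.adjoint] at this

end Adjointable

/-! ### Gauge fixing -/

section GaugeFixing

variable {𝔤 : Type*} [LieRing 𝔤] [LieAlgebra ℂ 𝔤] [Module.Finite ℂ 𝔤] [LieAlgebra.IsSimple ℂ 𝔤]

/-- One step towards the gauge `ρ (p - e) = w`. -/
def sweepStep (ρ : 𝔤 →ₗ[ℂ] 𝔤) (e : 𝔤) (w p : Loop 𝔤) : Loop 𝔤 :=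
  act (expAd (loopMap ρ (p - constLoop e) - w)) p

/-- `N` steps towards the gauge `ρ (p - e) = w`. -/
def sweep (ρ : 𝔤 →ₗ[ℂ] 𝔤) (e : 𝔤) (w : Loop 𝔤) (N : ℕ) (p : Loop 𝔤) : Loop 𝔤 :=
  (sweepStep ρ e w)^[N] p

variable {𝒢 : ℤ → Submodule ℂ 𝔤} [GradedLieAlgebra 𝒢] {e : 𝔤} {C : Submodule ℂ 𝔤}
  {ρ : 𝔤 →ₗ[ℂ] 𝔤} {B : LinearMap.BilinForm ℂ 𝔤}

theorem IsPartialInverse.loopMap_lie (hρ : IsPartialInverse 𝒢 e C ρ) {n : Loop 𝔤}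
    (hn : n ∈ fil 𝒢 (-1)) : loopMap ρ (loopLie (constLoop e) n) = n :=
  Loop.ext fun x => hρ.lie _ (hn x)

theorem IsPartialInverse.loopMap_mem (hρ : IsPartialInverse 𝒢 e C ρ) {i : ℤ} {n : Loop 𝔤}
    (hn : n ∈ fil 𝒢 i) : loopMap ρ n ∈ fil 𝒢 (i - 2) := fun x => hρ.lowers i _ (hn x)

theorem IsPartialInverse.loopMap_range (hρ : IsPartialInverse 𝒢 e C ρ) (u : Loop 𝔤) :
    loopMap ρ u ∈ fil 𝒢 (-1) := fun _ => hρ.range _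

/-- Acting by the exponential of the defect `n` changes `p` by `-[e, n]` modulo degree `1 - k`.
Under `ρ` this cancels `n` modulo degree `-k - 1`, so each step pushes the defect one degree down.
-/
theorem sweepStep_spec (he : IsGoodElement 𝒢 e) (hρ : IsPartialInverse 𝒢 e C ρ) {k : ℤ}
    (hk : 1 ≤ k) {w p : Loop 𝔤} (hp : p - constLoop e ∈ fil 𝒢 1)
    (h : loopMap ρ (p - constLoop e) - w ∈ fil 𝒢 (-k)) :
    sweepStep ρ e w p - constLoop e ∈ fil 𝒢 1 ∧
      loopMap ρ (sweepStep ρ e w p - constLoop e) - w ∈ fil 𝒢 (-(k + 1)) := by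
  set n := loopMap ρ (p - constLoop e) - w with hn
  have hef : constLoop e ∈ fil 𝒢 2 := constLoop_mem_fil (le_degLE 𝒢 le_rfl he.mem)
  have hpf : p ∈ fil 𝒢 2 := by
    have := add_mem (fil_mono 𝒢 (by norm_num) hp) hef
    rwa [sub_add_cancel] at this
  have hn' := loopDeriv_mem h
  have h1 : adOp n (1, p) ∈ opFil 𝒢 (2 - k) := (mem_opFil 𝒢).2 ⟨rfl, by
    rw [adOp_apply, one_smul]
    exact sub_mem (lie_mem_fil_of_le 𝒢 h hpf (by omega)) (fil_mono 𝒢 (by omega) hn')⟩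
  have h2 : adOp n (adOp n (1, p)) ∈ opFil 𝒢 (1 - k) := by
    have := (mem_opFil 𝒢).1 (adOp_mem_opFil 𝒢 h h1)
    exact (mem_opFil 𝒢).2 ⟨this.1, fil_mono 𝒢 (by omega) this.2⟩
  have h3 : sweepStep ρ e w p - p - (loopLie n p - loopDeriv n) ∈ fil 𝒢 (1 - k) := by
    have := ((mem_opFil 𝒢).1 (expAd_sub_sub_mem 𝒢 hk h h2)).2
    rw [adOp_apply, one_smul] at this
    exact this
  clear_value n
  have h4 : sweepStep ρ e w p - p + loopLie (constLoop e) n ∈ fil 𝒢 (1 - k) := by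
    have h5 : loopLie n (p - constLoop e) ∈ fil 𝒢 (1 - k) :=
      lie_mem_fil_of_le 𝒢 h hp (by omega)
    have := add_mem (sub_mem h3 (fil_mono 𝒢 (by omega : -k ≤ 1 - k) hn')) h5
    convert this using 1
    rw [map_sub, loopLie_skew (constLoop e)]
    abel
  constructor
  · have h6 : loopLie (constLoop e) n ∈ fil 𝒢 1 := lie_mem_fil_of_le 𝒢 hef h (by omega)
    have := add_mem (sub_mem (fil_mono 𝒢 (by omega) h4) h6) hp
    convert this using 1
    abel
  · have h7 := hρ.loopMap_mem h4
    rw [map_add, hρ.loopMap_lie (fil_mono 𝒢 (by omega) h), hn] at h7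
    have h8 := fil_mono 𝒢 (by omega : _ ≤ -(k + 1)) h7
    convert h8 using 1
    simp only [map_sub]
    abel

/-- The parameter `d` records the initial degree of the defect and hence the subgroup used: `N⁻` for
`d = 1`, `G⁻` for `d = 2`. -/
theorem sweep_spec (hBinv : B.lieInvariant 𝔤) (he : IsGoodElement 𝒢 e)
    (hρ : IsPartialInverse 𝒢 e C ρ) {d : ℤ}
    (hd : 1 ≤ d) {w p : Loop 𝔤} (hp : p - constLoop e ∈ fil 𝒢 1)
    (h : loopMap ρ (p - constLoop e) - w ∈ fil 𝒢 (-d)) (N : ℕ) :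
    sweep ρ e w N p - constLoop e ∈ fil 𝒢 1 ∧
      loopMap ρ (sweep ρ e w N p - constLoop e) - w ∈ fil 𝒢 (-(d + N)) ∧
      ∃ g ∈ adjointGroup (fil 𝒢 (-d)), sweep ρ e w N p = act g.1 p := by
  induction N with
  | zero => exact ⟨hp, by simpa [sweep] using h, 1, one_mem _, rfl⟩
  | succ N ih =>
    obtain ⟨h1, h2, g, hg, h3⟩ := ih
    have h4 := sweepStep_spec he hρ (by omega : 1 ≤ d + N) h1 h2
    have h5 : sweep ρ e w (N + 1) p = sweepStep ρ e w (sweep ρ e w N p) :=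
      Function.iterate_succ_apply' _ _ _
    have h6 := fil_mono 𝒢 (by omega : -(d + N) ≤ -d) h2
    rw [h5]
    refine ⟨h4.1, by push_cast; rw [← add_assoc]; exact h4.2,
      expUnit 𝒢 _ (fil_mono 𝒢 (by omega) h6) * g, mul_mem (expUnit_mem 𝒢 _ h6) hg, ?_⟩
    rw [Units.val_mul, (isGauge_of_mem hBinv hd hg).act_mul, ← h3]
    rfl

theorem isPlot_sweep (hρ : IsPartialInverse 𝒢 e C ρ) {T : Type*} [NormedAddCommGroup T]
    [NormedSpace ℝ T] {w p : T → Loop 𝔤} (hw : IsPlot w) (hp : IsPlot p)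
    (h : ∀ t, w t ∈ fil 𝒢 (-1)) (N : ℕ) : IsPlot fun t => sweep ρ e (w t) N (p t) := by
  induction N with
  | zero => exact hp
  | succ N ih =>
    simp only [sweep, Function.iterate_succ_apply']
    exact isPlot_act_expAd 𝒢 (((ih.sub (isPlot_const _)).map ρ).sub hw) ih fun t =>
      sub_mem (hρ.loopMap_range _) (h t)

theorem Adjointable.sweep (hB : B.Nondegenerate) (hBinv : B.lieInvariant 𝔤)
    (hρ : IsPartialInverse 𝒢 e C ρ) {Φ : Loop 𝔤 → Loop 𝔤} (hΦ : Adjointable B Φ) (N : ℕ) :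
    Adjointable B fun q => sweep ρ e 0 N (Φ q) := by
  induction N with
  | zero => exact hΦ
  | succ N ih =>
    simp only [LoopReduction.sweep, Function.iterate_succ_apply']
    exact Adjointable.act_expAd (𝒢 := 𝒢) hB hBinv
      (((ih.sub (adjointable_const _)).map hB ρ).sub (adjointable_const 0)) ih fun q =>
        sub_mem (hρ.loopMap_range _) (zero_mem _)

variable (𝒢) in
/-- The affine projection of `L𝔤` to `e + ⨁_{i ≤ k} L𝔤_i`. -/
def truncate (e : 𝔤) (k : ℤ) (q : Loop 𝔤) : Loop 𝔤 :=
  constLoop e + loopMap (filterPart 𝒢 (· ≤ k)) q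

theorem truncate_sub_mem (k : ℤ) (q : Loop 𝔤) : truncate 𝒢 e k q - constLoop e ∈ fil 𝒢 k := by
  rw [truncate, add_sub_cancel_left]
  intro x
  refine (mem_degLE 𝒢).2 fun i hi => ?_
  rw [loopMap_apply, part_filterPart, if_neg (by omega)]

theorem filterPart_le_of_mem {k : ℤ} {x : 𝔤} (hx : x ∈ degLE 𝒢 k) :
    filterPart 𝒢 (· ≤ k) x = x := by
  rw [← sub_eq_zero]
  refine eq_zero_of_part 𝒢 fun i => ?_
  rw [map_sub, part_filterPart]
  split_ifs with hi
  · rw [sub_self]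
  · rw [(mem_degLE 𝒢).1 hx i (by omega), sub_zero]

theorem truncate_of_mem (he : IsGoodElement 𝒢 e) {k : ℤ} (hk : k < 2) {q : Loop 𝔤}
    (hq : q - constLoop e ∈ fil 𝒢 k) : truncate 𝒢 e k q = q := by
  refine Loop.ext fun x => ?_
  have h1 : filterPart 𝒢 (· ≤ k) (q x - e) = q x - e := filterPart_le_of_mem (hq x)
  rw [map_sub, filterPart_of_mem 𝒢 _ he.mem, if_neg (by omega), sub_zero] at h1
  show e + filterPart 𝒢 (· ≤ k) (q x) = q x
  rw [h1, add_sub_cancel]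

theorem adjointable_truncate (hB : B.Nondegenerate) (k : ℤ) : Adjointable B (truncate 𝒢 e k) :=
  (adjointable_const _).add (adjointable_id.map hB _)

variable (𝒢) in
/-- The gauge fixing map. -/
def gaugeFix (ρ : 𝔤 →ₗ[ℂ] 𝔤) (e : 𝔤) (N : ℕ) (q : Loop 𝔤) : Loop 𝔤 :=
  sweep ρ e 0 N (truncate 𝒢 e 1 q)

theorem adjointable_gaugeFix (hB : B.Nondegenerate) (hBinv : B.lieInvariant 𝔤)
    (hρ : IsPartialInverse 𝒢 e C ρ) (N : ℕ) : Adjointable B (gaugeFix 𝒢 ρ e N) :=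
  (adjointable_truncate hB 1).sweep hB hBinv hρ N

theorem mem_levelManifold {q : Loop 𝔤} : q ∈ levelManifold 𝒢 e ↔ q - constLoop e ∈ fil 𝒢 0 :=
  AffineSubspace.mem_mk'

theorem mem_transversalManifold {q : Loop 𝔤} :
    q ∈ transversalManifold e C ↔ q - constLoop e ∈ loopsIn C :=
  AffineSubspace.mem_mk'

theorem direction_levelManifold : (levelManifold 𝒢 e).direction = fil 𝒢 0 :=
  AffineSubspace.direction_mk' _ _

theorem direction_transversalManifold : (transversalManifold e C).direction = loopsIn C :=
  AffineSubspace.direction_mk' _ _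

variable {N : ℕ}

/-- In a normal form of sufficient depth the gauge is reached. -/
theorem sweep_gauge (hBinv : B.lieInvariant 𝔤) (hN : degLE 𝒢 (-(N : ℤ)) = ⊥)
    (he : IsGoodElement 𝒢 e)
    (hρ : IsPartialInverse 𝒢 e C ρ) {w p : Loop 𝔤} (hp : p - constLoop e ∈ fil 𝒢 1)
    (h : w ∈ fil 𝒢 (-1)) : loopMap ρ (sweep ρ e w N p - constLoop e) = w := by
  have h1 := (sweep_spec hBinv he hρ le_rfl hp (sub_mem (hρ.loopMap_range _) h) N).2.1
  refine sub_eq_zero.1 (Loop.ext fun x => ?_)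
  have h2 := degLE_mono 𝒢 (by omega : -(1 + (N : ℤ)) ≤ -N) (h1 x)
  rw [hN] at h2
  exact h2

theorem IsPartialInverse.mem_of_loopMap_eq_zero (hρ : IsPartialInverse 𝒢 e C ρ) {u : Loop 𝔤}
    (hu : u ∈ fil 𝒢 1) (h : loopMap ρ u = 0) : u ∈ loopsIn C := fun x => by
  have := hρ.sub_mem _ (hu x)
  rwa [show ρ (u x) = 0 from congrArg (fun z : Loop 𝔤 => z x) h, lie_zero, sub_zero] at this

theorem gaugeFix_mem (hBinv : B.lieInvariant 𝔤) (hN : degLE 𝒢 (-(N : ℤ)) = ⊥)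
    (he : IsGoodElement 𝒢 e) (hρ : IsPartialInverse 𝒢 e C ρ) (q : Loop 𝔤) :
    gaugeFix 𝒢 ρ e N q ∈ transversalManifold e C := by
  have hp := truncate_sub_mem (𝒢 := 𝒢) (e := e) 1 q
  exact mem_transversalManifold.2 (hρ.mem_of_loopMap_eq_zero
    (sweep_spec hBinv he hρ le_rfl hp (sub_mem (hρ.loopMap_range _) (zero_mem _)) N).1
    (sweep_gauge hBinv hN he hρ hp (zero_mem _)))

theorem IsPartialInverse.loopMap_eq_zero (hρ : IsPartialInverse 𝒢 e C ρ) {u : Loop 𝔤}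
    (hu : u ∈ loopsIn C) : loopMap ρ u = 0 := Loop.ext fun x => hρ.zero _ (hu x)

theorem sweep_of_gauge {w p : Loop 𝔤} (h : loopMap ρ (p - constLoop e) = w) (N : ℕ) :
    sweep ρ e w N p = p := by
  refine Function.iterate_fixed ?_ N
  rw [sweepStep, h, sub_self, expAd_zero, act_one]

theorem gaugeFix_of_mem (hC : C ≤ degLE 𝒢 0) (he : IsGoodElement 𝒢 e)
    (hρ : IsPartialInverse 𝒢 e C ρ) {q : Loop 𝔤}
    (hq : q ∈ transversalManifold e C) : gaugeFix 𝒢 ρ e N q = q := by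
  rw [mem_transversalManifold] at hq
  rw [gaugeFix, truncate_of_mem he (by norm_num) fun x => degLE_mono 𝒢 (by norm_num) (hC (hq x))]
  exact sweep_of_gauge (hρ.loopMap_eq_zero hq) N

/-- Stated on `e + ⨁_{i ≤ 1} L𝔤_i` because this is stable under `N⁻`, while `S` is stable only under
`G⁻`. Invariance of the gauge fixing map there controls it along all of `D`, including directions
transversal to `S`. -/
theorem exists_gaugeFix_eq (hBinv : B.lieInvariant 𝔤) (he : IsGoodElement 𝒢 e)
    (hρ : IsPartialInverse 𝒢 e C ρ) {p : Loop 𝔤} (hp : p - constLoop e ∈ fil 𝒢 1) :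
    ∃ g ∈ adjointGroup (fil 𝒢 (-1)), gaugeFix 𝒢 ρ e N p = act g.1 p := by
  rw [gaugeFix, truncate_of_mem he (by norm_num) hp]
  exact (sweep_spec hBinv he hρ le_rfl hp (sub_mem (hρ.loopMap_range _) (zero_mem _)) N).2.2

/-- On `S` the difference `p - e` has degree at most zero, so the defect `ρ(p - e)` starts in `L𝔤⁻`.
-/
theorem exists_gaugeFix_eq_of_mem (hBinv : B.lieInvariant 𝔤) (he : IsGoodElement 𝒢 e)
    (hρ : IsPartialInverse 𝒢 e C ρ) {p : Loop 𝔤} (hp : p ∈ levelManifold 𝒢 e) :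
    ∃ g ∈ adjointGroup (fil 𝒢 (-2)), gaugeFix 𝒢 ρ e N p = act g.1 p := by
  rw [mem_levelManifold] at hp
  have hp1 := fil_mono 𝒢 (by norm_num : (0 : ℤ) ≤ 1) hp
  rw [gaugeFix, truncate_of_mem he (by norm_num) hp1]
  have h := hρ.loopMap_mem hp
  rw [zero_sub] at h
  exact (sweep_spec hBinv he hρ (by norm_num) hp1 (sub_mem h (zero_mem _)) N).2.2

end GaugeFixing

/-! ### The geometry of the level manifold -/

section Geometry

variable {𝔤 : Type*} [LieRing 𝔤] [LieAlgebra ℂ 𝔤] [Module.Finite ℂ 𝔤] [LieAlgebra.IsSimple ℂ 𝔤]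
  {𝒢 : ℤ → Submodule ℂ 𝔤} [GradedLieAlgebra 𝒢] {e : 𝔤} {C : Submodule ℂ 𝔤}
  {ρ : 𝔤 →ₗ[ℂ] 𝔤} {B : LinearMap.BilinForm ℂ 𝔤} {N : ℕ}

theorem poisson₂_apply (q u : Loop 𝔤) : poisson₂ q u = loopDeriv u + loopLie q u := rfl

/-- The perturbation estimate behind the recursions: `ad e` raises degrees by two, while the rest of
`P₂` raises them by at most `i`. -/
theorem poisson₂_sub_mem {i k : ℤ} (hi : 0 ≤ i) {q ξ : Loop 𝔤} (hq : q - constLoop e ∈ fil 𝒢 i)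
    (hξ : ξ ∈ fil 𝒢 k) : poisson₂ q ξ - loopLie (constLoop e) ξ ∈ fil 𝒢 (i + k) := by
  have h := add_mem (fil_mono 𝒢 (by omega : k ≤ i + k) (loopDeriv_mem hξ)) (lie_mem_fil 𝒢 hq hξ)
  rwa [map_sub, LinearMap.sub_apply, ← add_sub_assoc, ← poisson₂_apply] at h

theorem constLoop_mem_two (he : IsGoodElement 𝒢 e) : constLoop e ∈ fil 𝒢 2 :=
  constLoop_mem_fil (le_degLE 𝒢 le_rfl he.mem)

theorem poisson₂_mem (he : IsGoodElement 𝒢 e) {k l : ℤ} (hkl : k + 2 ≤ l) {q ξ : Loop 𝔤}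
    (hq : q - constLoop e ∈ fil 𝒢 1) (hξ : ξ ∈ fil 𝒢 k) : poisson₂ q ξ ∈ fil 𝒢 l := by
  have h := add_mem (fil_mono 𝒢 (by omega : _ ≤ l) (poisson₂_sub_mem (by norm_num) hq hξ))
    (lie_mem_fil_of_le 𝒢 (constLoop_mem_two he) hξ (by omega : _ ≤ l))
  rwa [sub_add_cancel] at h

/-- Applying `ρ` to the perturbation estimate shows that `ξ` lies one degree lower than assumed, and
so on below the grading. -/
theorem eq_zero_of_poisson₂ (hN : degLE 𝒢 (-(N : ℤ)) = ⊥)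
    (hρ : IsPartialInverse 𝒢 e C ρ) {q ξ : Loop 𝔤} (hq : q - constLoop e ∈ fil 𝒢 1)
    (hξ : ξ ∈ fil 𝒢 (-1)) (h : loopMap ρ (poisson₂ q ξ) = 0) : ξ = 0 := by
  have hk : ∀ k : ℕ, ξ ∈ fil 𝒢 (-1 - k) := by
    intro k
    induction k with
    | zero => simpa using hξ
    | succ k ih =>
      have h1 := hρ.loopMap_mem (poisson₂_sub_mem (by norm_num) hq ih)
      rw [map_sub, h, hρ.loopMap_lie hξ, zero_sub] at h1
      have h2 := neg_mem h1
      rw [neg_neg] at h2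
      exact fil_mono 𝒢 (by push_cast; omega) h2
  refine Loop.ext fun x => ?_
  have h1 := degLE_mono 𝒢 (by omega : -1 - (N : ℤ) ≤ -N) (hk N x)
  rw [hN] at h1
  exact h1

/-- Solve with `ad e` in place of `P₂` by means of `ρ`; the error lies one degree lower and is
treated in the same way. -/
theorem exists_sub_poisson₂_mem (hN : degLE 𝒢 (-(N : ℤ)) = ⊥)
    (hρ : IsPartialInverse 𝒢 e C ρ) {q : Loop 𝔤} (hq : q - constLoop e ∈ fil 𝒢 1) {i : ℤ}
    (hi : i ≤ 1) {w : Loop 𝔤} (hw : w ∈ fil 𝒢 i) :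
    ∃ ξ ∈ fil 𝒢 (i - 2), w - poisson₂ q ξ ∈ loopsIn C := by
  suffices h : ∀ (j : ℕ) (i : ℤ), i ≤ 1 → i ≤ j - N → ∀ w ∈ fil 𝒢 i,
      ∃ ξ ∈ fil 𝒢 (i - 2), w - poisson₂ q ξ ∈ loopsIn C from
    h (i + N).toNat i hi (by omega) w hw
  intro j
  induction j with
  | zero =>
    intro i _ hiN w hw
    have hw0 : w = 0 := Loop.ext fun x => by
      have h1 := degLE_mono 𝒢 (by push_cast at hiN; omega : i ≤ -N) (hw x)
      rw [hN] at h1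
      exact h1
    exact ⟨0, zero_mem _, by simp [hw0]⟩
  | succ j ih =>
    intro i hi hiN w hw
    have hm := hρ.loopMap_mem hw
    have hc : w - loopLie (constLoop e) (loopMap ρ w) ∈ loopsIn C := fun x =>
      hρ.sub_mem _ (degLE_mono 𝒢 hi (hw x))
    have hr := neg_mem (poisson₂_sub_mem (by norm_num) hq hm)
    obtain ⟨η, hη, h⟩ := ih (i - 1) (by omega) (by push_cast at hiN; omega) _
      (fil_mono 𝒢 (by omega) hr)
    refine ⟨loopMap ρ w + η, add_mem hm (fil_mono 𝒢 (by omega) hη), ?_⟩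
    have := add_mem hc h
    convert this using 1
    rw [map_add]
    abel

theorem mem_reductionDistribution {q v : Loop 𝔤} :
    v ∈ reductionDistribution 𝒢 q ↔ ∃ ξ ∈ fil 𝒢 (-1), poisson₂ q ξ = v := Iff.rfl

/-- `E = P₂(L𝔤⁻)`. -/
theorem reductionDistribution_inf (he : IsGoodElement 𝒢 e) (hρ : IsPartialInverse 𝒢 e C ρ)
    {q : Loop 𝔤} (hq : q ∈ levelManifold 𝒢 e) :
    reductionDistribution 𝒢 q ⊓ (levelManifold 𝒢 e).direction =
      (fil 𝒢 (-2)).map (poisson₂ q) := by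
  rw [direction_levelManifold]
  rw [mem_levelManifold] at hq
  apply le_antisymm
  · rintro _ ⟨⟨ξ, hξ, rfl⟩, h⟩
    refine ⟨ξ, ?_, rfl⟩
    have h1 := hρ.loopMap_mem (sub_mem h (fil_mono 𝒢 (by norm_num)
      (poisson₂_sub_mem le_rfl hq hξ)))
    rwa [sub_sub_cancel, hρ.loopMap_lie hξ, zero_sub] at h1
  · rintro _ ⟨ξ, hξ, rfl⟩
    exact ⟨⟨ξ, fil_mono 𝒢 (by norm_num) hξ, rfl⟩,
      poisson₂_mem he (by norm_num) (fil_mono 𝒢 (by norm_num) hq) hξ⟩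

theorem transversalManifold_le (hC : C ≤ degLE 𝒢 0) :
    transversalManifold e C ≤ levelManifold 𝒢 e := fun _ hq =>
  mem_levelManifold.2 fun x => hC (mem_transversalManifold.1 hq x)

theorem isTransversalManifold (hN : degLE 𝒢 (-(N : ℤ)) = ⊥) (hC : C ≤ degLE 𝒢 0)
    (he : IsGoodElement 𝒢 e) (hρ : IsPartialInverse 𝒢 e C ρ) :
    IsTransversalManifold (levelManifold 𝒢 e) (reductionDistribution 𝒢)
      (transversalManifold e C) where
  le := transversalManifold_le hC
  sup q hq := by
    have hq' := transversalManifold_le hC hq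
    rw [reductionDistribution_inf he hρ hq', direction_levelManifold,
      direction_transversalManifold]
    have hq1 := fil_mono 𝒢 (by norm_num : (0 : ℤ) ≤ 1) (mem_levelManifold.1 hq')
    apply le_antisymm
    · refine sup_le ?_ fun u hu x => hC (hu x)
      rintro _ ⟨ξ, hξ, rfl⟩
      exact poisson₂_mem he (by norm_num : -2 + 2 ≤ (0 : ℤ)) hq1 hξ
    · intro w hw
      obtain ⟨ξ, hξ, h⟩ := exists_sub_poisson₂_mem hN hρ hq1 (by norm_num) hw
      rw [zero_sub] at hξ
      exact Submodule.mem_sup.2 ⟨_, ⟨ξ, hξ, rfl⟩, _, h, add_sub_cancel _ _⟩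
  disjoint q hq := by
    have hq' := transversalManifold_le hC hq
    rw [reductionDistribution_inf he hρ hq', direction_transversalManifold, Submodule.disjoint_def]
    rintro _ ⟨ξ, hξ, rfl⟩ h
    rw [eq_zero_of_poisson₂ hN hρ (fil_mono 𝒢 (by norm_num) (mem_levelManifold.1 hq'))
      (fil_mono 𝒢 (by norm_num) hξ) (hρ.loopMap_eq_zero h), map_zero]

/-! ### The quotient by the gauge group -/

/-- The element `e` moves only in degrees at most `2 - d`, which explains the bound on `i`. -/
theorem act_sub_mem (hBinv : B.lieInvariant 𝔤) (he : IsGoodElement 𝒢 e) {d i : ℤ} (hd : 1 ≤ d)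
    (hi : 2 - d ≤ i) {g : (Module.End ℂ (Op 𝔤))ˣ} (hg : g ∈ adjointGroup (fil 𝒢 (-d)))
    {p : Loop 𝔤} (hp : p - constLoop e ∈ fil 𝒢 i) : act g.1 p - constLoop e ∈ fil 𝒢 i := by
  have hgg := isGauge_of_mem hBinv hd hg
  have := add_mem (add_mem (fil_mono 𝒢 (by omega : -d ≤ i) (hgg.affine p))
    (fil_mono 𝒢 hi (hgg.lowers 2 _ (constLoop_mem_two he)))) (hgg.Ad_mem (by omega) hp)
  convert this using 1
  rw [Ad_sub]
  abel

theorem act_mem_levelManifold (hBinv : B.lieInvariant 𝔤) (he : IsGoodElement 𝒢 e)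
    {g : (Module.End ℂ (Op 𝔤))ˣ} (hg : g ∈ adjointGroup (fil 𝒢 (-2))) {p : Loop 𝔤}
    (hp : p ∈ levelManifold 𝒢 e) : act g.1 p ∈ levelManifold 𝒢 e :=
  mem_levelManifold.2 (act_sub_mem hBinv he (by norm_num) (by norm_num) hg (mem_levelManifold.1 hp))

theorem act_mul_of_mem (hBinv : B.lieInvariant 𝔤) {d : ℤ} (hd : 1 ≤ d)
    {h : (Module.End ℂ (Op 𝔤))ˣ} (hh : h ∈ adjointGroup (fil 𝒢 (-d)))
    (g : (Module.End ℂ (Op 𝔤))ˣ) (q : Loop 𝔤) : act (g * h).1 q = act g.1 (act h.1 q) := by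
  rw [Units.val_mul, (isGauge_of_mem hBinv hd hh).act_mul]

theorem act_inv_act (hBinv : B.lieInvariant 𝔤) {d : ℤ} (hd : 1 ≤ d)
    {g : (Module.End ℂ (Op 𝔤))ˣ} (hg : g ∈ adjointGroup (fil 𝒢 (-d))) (q : Loop 𝔤) :
    act g⁻¹.1 (act g.1 q) = q := by
  rw [← act_mul_of_mem hBinv hd hg, inv_mul_cancel]; rfl

theorem Ad_inv_Ad (hBinv : B.lieInvariant 𝔤) {d : ℤ} (hd : 1 ≤ d)
    {g : (Module.End ℂ (Op 𝔤))ˣ} (hg : g ∈ adjointGroup (fil 𝒢 (-d))) (q : Loop 𝔤) :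
    Ad g⁻¹.1 (Ad g.1 q) = q := by
  rw [← (isGauge_of_mem hBinv hd hg).Ad_mul, ← Units.val_mul, inv_mul_cancel]; rfl

/-- Two points of an orbit in the same gauge coincide. -/
theorem eq_of_act_eq (hBinv : B.lieInvariant 𝔤) (he : IsGoodElement 𝒢 e)
    (hρ : IsPartialInverse 𝒢 e C ρ) (hC : C ≤ degLE 𝒢 0) {g : (Module.End ℂ (Op 𝔤))ˣ}
    (hg : g ∈ adjointGroup (fil 𝒢 (-1))) {p q : Loop 𝔤} (hp : p ∈ transversalManifold e C)
    (hq : q ∈ transversalManifold e C) (h : act g.1 p = q) : p = q := by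
  -- Both points lie in the gauge `ρ = 0`, so `ρ` kills the displacement and freeness applies.
  have h1 : g = 1 := by
    refine eq_one_of_act_sub hBinv he hρ hg (p := p)
      (fil_mono 𝒢 (by norm_num) (mem_levelManifold.1 (transversalManifold_le hC hp))) ?_
    rw [h, ← sub_sub_sub_cancel_right q p (constLoop e), map_sub,
      hρ.loopMap_eq_zero (mem_transversalManifold.1 hq),
      hρ.loopMap_eq_zero (mem_transversalManifold.1 hp), sub_zero]
  rw [← h, h1]; rfl

/-- The gauge fixing map is invariant. -/
theorem gaugeFix_act (hBinv : B.lieInvariant 𝔤) (hN : degLE 𝒢 (-(N : ℤ)) = ⊥)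
    (he : IsGoodElement 𝒢 e)
    (hρ : IsPartialInverse 𝒢 e C ρ) (hC : C ≤ degLE 𝒢 0) {h : (Module.End ℂ (Op 𝔤))ˣ}
    (hh : h ∈ adjointGroup (fil 𝒢 (-1))) {p : Loop 𝔤} (hp : p - constLoop e ∈ fil 𝒢 1) :
    gaugeFix 𝒢 ρ e N (act h.1 p) = gaugeFix 𝒢 ρ e N p := by
  obtain ⟨g, hg, h1⟩ := exists_gaugeFix_eq (N := N) hBinv he hρ hp
  obtain ⟨g', hg', h2⟩ := exists_gaugeFix_eq (N := N) hBinv he hρ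
    (act_sub_mem hBinv he le_rfl (by norm_num) hh hp)
  refine (eq_of_act_eq hBinv he hρ hC (g := g' * h * g⁻¹)
    (mul_mem (mul_mem hg' hh) (inv_mem hg)) (gaugeFix_mem hBinv hN he hρ p)
    (gaugeFix_mem hBinv hN he hρ _) ?_).symm
  rw [act_mul_of_mem hBinv le_rfl (inv_mem hg), h1, act_inv_act hBinv le_rfl hg,
    act_mul_of_mem hBinv le_rfl hh, h2]

theorem gaugeFix_eq_iff (hBinv : B.lieInvariant 𝔤) (hN : degLE 𝒢 (-(N : ℤ)) = ⊥)
    (he : IsGoodElement 𝒢 e)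
    (hρ : IsPartialInverse 𝒢 e C ρ) (hC : C ≤ degLE 𝒢 0) {p p' : Loop 𝔤}
    (hp : p ∈ levelManifold 𝒢 e) (hp' : p' ∈ levelManifold 𝒢 e) :
    gaugeFix 𝒢 ρ e N p = gaugeFix 𝒢 ρ e N p' ↔
      ∃ g ∈ adjointGroup (fil 𝒢 (-2)), act g.1 p = p' := by
  constructor
  · intro h
    obtain ⟨g, hg, h1⟩ := exists_gaugeFix_eq_of_mem (N := N) hBinv he hρ hp
    obtain ⟨g', hg', h2⟩ := exists_gaugeFix_eq_of_mem (N := N) hBinv he hρ hp'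
    refine ⟨g'⁻¹ * g, mul_mem (inv_mem hg') hg, ?_⟩
    rw [act_mul_of_mem hBinv (by norm_num : (1 : ℤ) ≤ 2) hg, ← h1, h, h2,
      act_inv_act hBinv (by norm_num : (1 : ℤ) ≤ 2) hg']
  · rintro ⟨g, hg, rfl⟩
    exact (gaugeFix_act hBinv hN he hρ hC (adjointGroup_mono (fil_mono 𝒢 (by norm_num)) hg)
      (fil_mono 𝒢 (by norm_num) (mem_levelManifold.1 hp))).symm

/-- The derivative of the gauge fixing map annihilates the distribution. -/
theorem lineDeriv_gaugeFix_poisson₂ (hB : B.Nondegenerate) (hBinv : B.lieInvariant 𝔤)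
    (hN : degLE 𝒢 (-(N : ℤ)) = ⊥) (he : IsGoodElement 𝒢 e) (hρ : IsPartialInverse 𝒢 e C ρ)
    (hC : C ≤ degLE 𝒢 0) {p : Loop 𝔤} (hp : p - constLoop e ∈ fil 𝒢 1) {ξ : Loop 𝔤}
    (hξ : ξ ∈ fil 𝒢 (-1)) : lineDeriv (gaugeFix 𝒢 ρ e N) p (poisson₂ p ξ) = 0 := by
  obtain ⟨Θ', hΘ⟩ := adjointable_gaugeFix (N := N) hB hBinv hρ
  have hm : ∀ t : ℝ, (-t : ℂ) • ξ ∈ fil 𝒢 (-1) := fun t => Submodule.smul_mem _ _ hξ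
  have hc : IsPlot fun t : ℝ => act (expAd ((-t : ℂ) • ξ)) p :=
    isPlot_act_expAd 𝒢 ((isPlot_const ξ).smul Complex.ofRealCLM.contDiff.neg) (isPlot_const p) hm
  have h1 := hΘ.smooth.hasVelocity_comp_univ hc (isFundamental_poisson₂ 𝒢 hξ p)
  -- The fundamental field of `ξ` is tangent to an `N⁻`-orbit, on which the map is constant.
  have h2 : (fun t : ℝ => gaugeFix 𝒢 ρ e N (act (expAd ((-t : ℂ) • ξ)) p)) =
      fun _ => gaugeFix 𝒢 ρ e N p := by
    funext t
    exact gaugeFix_act hBinv hN he hρ hC (expUnit_mem 𝒢 (hm t) (hm t)) hp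
  rw [h2] at h1
  have h3 := h1.unique (hasVelocity_const _)
  simpa [expAd_zero] using h3

theorem lineDeriv_gaugeFix_of_mem (hC : C ≤ degLE 𝒢 0) (he : IsGoodElement 𝒢 e)
    (hρ : IsPartialInverse 𝒢 e C ρ) {q s : Loop 𝔤} (hq : q ∈ transversalManifold e C)
    (hs : s ∈ loopsIn C) : lineDeriv (gaugeFix 𝒢 ρ e N) q s = s := by
  refine lineDeriv_eq ?_
  have : (fun θ : ℝ => gaugeFix 𝒢 ρ e N (q + (θ : ℂ) • s)) = fun θ : ℝ => q + (θ : ℂ) • s := by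
    funext θ
    refine gaugeFix_of_mem hC he hρ (mem_transversalManifold.2 ?_)
    rw [add_sub_right_comm]
    exact add_mem (mem_transversalManifold.1 hq) (Submodule.smul_mem _ _ hs)
  rw [this]
  exact hasVelocity_line q s

theorem HasAdjoint.lineDeriv_add (hB : B.Nondegenerate) (hs : ∀ x y, B x y = B y x)
    {Φ : Loop 𝔤 → Loop 𝔤} {Φ' : Loop 𝔤 → Loop 𝔤 → Loop 𝔤} (h : HasAdjoint B Φ Φ')
    (q s s' : Loop 𝔤) : lineDeriv Φ q (s + s') = lineDeriv Φ q s + lineDeriv Φ q s' :=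
  eq_of_pairing hB fun u => by
    rw [pairing_comm hs, pairing_comm hs (_ + _), map_add, h.adjoint, h.adjoint, h.adjoint, map_add]

theorem HasAdjoint.lineDeriv_smul (hB : B.Nondegenerate) (hs : ∀ x y, B x y = B y x)
    {Φ : Loop 𝔤 → Loop 𝔤} {Φ' : Loop 𝔤 → Loop 𝔤 → Loop 𝔤} (h : HasAdjoint B Φ Φ')
    (q : Loop 𝔤) (c : ℂ) (s : Loop 𝔤) : lineDeriv Φ q (c • s) = c • lineDeriv Φ q s :=
  eq_of_pairing hB fun u => by
    rw [pairing_comm hs, pairing_comm hs (_ • _), map_smul, h.adjoint, h.adjoint, map_smul]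

theorem HasAdjoint.adjoint_add (hB : B.Nondegenerate) {Φ : Loop 𝔤 → Loop 𝔤}
    {Φ' : Loop 𝔤 → Loop 𝔤 → Loop 𝔤} (h : HasAdjoint B Φ Φ') (q u u' : Loop 𝔤) :
    Φ' q (u + u') = Φ' q u + Φ' q u' :=
  eq_of_pairing hB fun s => by
    rw [map_add, LinearMap.add_apply, ← h.adjoint, ← h.adjoint, ← h.adjoint, map_add,
      LinearMap.add_apply]

theorem HasAdjoint.adjoint_smul (hB : B.Nondegenerate) {Φ : Loop 𝔤 → Loop 𝔤}
    {Φ' : Loop 𝔤 → Loop 𝔤 → Loop 𝔤} (h : HasAdjoint B Φ Φ') (q : Loop 𝔤) (c : ℂ) (u : Loop 𝔤) :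
    Φ' q (c • u) = c • Φ' q u :=
  eq_of_pairing hB fun s => by
    rw [map_smul, LinearMap.smul_apply, ← h.adjoint, ← h.adjoint, map_smul, LinearMap.smul_apply]

/-- The kernel of the derivative of the gauge fixing map. -/
theorem lineDeriv_gaugeFix_eq_zero_iff (hB : B.Nondegenerate) (hBinv : B.lieInvariant 𝔤)
    (hN : degLE 𝒢 (-(N : ℤ)) = ⊥) (he : IsGoodElement 𝒢 e) (hρ : IsPartialInverse 𝒢 e C ρ)
    (hC : C ≤ degLE 𝒢 0) {p v : Loop 𝔤} (hp : p ∈ levelManifold 𝒢 e) (hv : v ∈ fil 𝒢 0) :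
    lineDeriv (gaugeFix 𝒢 ρ e N) p v = 0 ↔ v ∈ (fil 𝒢 (-2)).map (poisson₂ p) := by
  have hp1 := fil_mono 𝒢 (by norm_num : (0 : ℤ) ≤ 1) (mem_levelManifold.1 hp)
  constructor
  · intro h
    obtain ⟨Θ', hΘ⟩ := adjointable_gaugeFix (N := N) hB hBinv hρ
    obtain ⟨g, hg, h1⟩ := exists_gaugeFix_eq_of_mem (N := N) hBinv he hρ hp
    have hg1 := adjointGroup_mono (fil_mono 𝒢 (by norm_num : (-2 : ℤ) ≤ -1)) hg
    have hgg := isGauge_of_mem hBinv (by norm_num : (1 : ℤ) ≤ 2) hg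
    have hgi := isGauge_of_mem hBinv (by norm_num : (1 : ℤ) ≤ 2) (inv_mem hg)
    have hq := gaugeFix_mem (N := N) hBinv hN he hρ p
    rw [h1] at hq
    have hq1 := fil_mono 𝒢 (by norm_num : (0 : ℤ) ≤ 1)
      (mem_levelManifold.1 (transversalManifold_le hC hq))
    -- Invariance transports the vanishing derivative to the point of `Q` on the same orbit, where
    -- the derivative is the identity on `LC`.
    have h2 : lineDeriv (gaugeFix 𝒢 ρ e N) (act g.1 p) (Ad g.1 v) = 0 := by
      refine lineDeriv_eq ?_
      have h3 := hΘ.smooth.hasVelocity p v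
      rw [h] at h3
      convert h3 using 2 with θ
      rw [← Ad_smul, ← act_add]
      refine gaugeFix_act hBinv hN he hρ hC hg1 ?_
      rw [add_sub_right_comm]
      exact add_mem hp1 (Submodule.smul_mem _ _ (fil_mono 𝒢 (by norm_num) hv))
    obtain ⟨ξ, hξ, hc⟩ := exists_sub_poisson₂_mem hN hρ hq1 (by norm_num) (hgg.Ad_mem (by norm_num) hv)
    rw [zero_sub] at hξ
    -- The derivative kills the part in `D` and fixes the part in `LC`, so the latter vanishes.
    have h4 : Ad g.1 v = poisson₂ (act g.1 p) ξ := by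
      have h5 := hΘ.lineDeriv_add hB (invariant_isSymm hBinv) (act g.1 p)
        (poisson₂ (act g.1 p) ξ) (Ad g.1 v - poisson₂ (act g.1 p) ξ)
      rw [add_sub_cancel, h2, lineDeriv_gaugeFix_poisson₂ hB hBinv hN he hρ hC hq1
        (fil_mono 𝒢 (by norm_num) hξ), zero_add, lineDeriv_gaugeFix_of_mem hC he hρ hq hc] at h5
      exact sub_eq_zero.1 h5.symm
    refine ⟨Ad g⁻¹.1 ξ, hgi.Ad_mem (by norm_num) hξ, ?_⟩
    have h6 := hgi.poisson₂_act (act g.1 p) ξ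
    rwa [act_inv_act hBinv (by norm_num : (1 : ℤ) ≤ 2) hg, ← h4,
      Ad_inv_Ad hBinv (by norm_num : (1 : ℤ) ≤ 2) hg] at h6
  · rintro ⟨ξ, hξ, rfl⟩
    exact lineDeriv_gaugeFix_poisson₂ hB hBinv hN he hρ hC hp1 (fil_mono 𝒢 (by norm_num) hξ)

theorem isLeafSpace_gaugeFix (hB : B.Nondegenerate) (hBinv : B.lieInvariant 𝔤)
    (hN : degLE 𝒢 (-(N : ℤ)) = ⊥) (he : IsGoodElement 𝒢 e) (hρ : IsPartialInverse 𝒢 e C ρ)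
    (hC : C ≤ degLE 𝒢 0) :
    IsLeafSpace (levelManifold 𝒢 e)
      (fun q => reductionDistribution 𝒢 q ⊓ (levelManifold 𝒢 e).direction)
      (transversalManifold e C) (gaugeFix 𝒢 ρ e N) := by
  obtain ⟨Θ', hΘ⟩ := adjointable_gaugeFix (N := N) hB hBinv hρ
  refine ⟨fun k c hc _ => hΘ.smooth k c hc fun _ => Set.mem_univ _,
    fun p _ => gaugeFix_mem hBinv hN he hρ p, fun p hp => ?_, fun p hp v hv => ?_,
    fun p hp p' hp' h => ?_⟩
  · obtain ⟨g, hg, h1⟩ := exists_gaugeFix_eq_of_mem (N := N) hBinv he hρ hp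
    -- The translate of `Q` by the element inverse to the gauge transformation of `p` is a section
    -- through `p`.
    refine ⟨act g⁻¹.1, fun k c hc _ => (isGauge_of_mem hBinv (by norm_num : (1 : ℤ) ≤ 2)
      (inv_mem hg)).smooth k c hc fun _ => Set.mem_univ _, fun y hy => ⟨?_, ?_⟩, ?_⟩
    · exact act_mem_levelManifold hBinv he (inv_mem hg) (transversalManifold_le hC hy)
    · rw [← (gaugeFix_eq_iff hBinv hN he hρ hC (transversalManifold_le hC hy)
        (act_mem_levelManifold hBinv he (inv_mem hg) (transversalManifold_le hC hy))).2
        ⟨_, inv_mem hg, rfl⟩]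
      exact gaugeFix_of_mem hC he hρ hy
    · rw [h1, act_inv_act hBinv (by norm_num : (1 : ℤ) ≤ 2) hg]
  · have hv' := direction_levelManifold (𝒢 := 𝒢) (e := e) ▸ hv
    rw [reductionDistribution_inf he hρ hp,
      ← lineDeriv_gaugeFix_eq_zero_iff (N := N) hB hBinv hN he hρ hC hp hv']
    exact ⟨fun h => lineDeriv_eq h, fun h => h ▸ hΘ.smooth.hasVelocity p v⟩
  · obtain ⟨g, hg, rfl⟩ := (gaugeFix_eq_iff hBinv hN he hρ hC hp hp').1 h
    obtain ⟨γ, h1, h2, h3, h4⟩ := exists_path hBinv (by norm_num : (1 : ℤ) ≤ 2) hg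
    have hm := fun t => act_mem_levelManifold hBinv he (h1 t) hp
    exact ⟨fun t => act (γ t).1 p, h4 _ (isPlot_const p), by simp [h2], by simp [h3], fun t =>
      ⟨hm t, ((gaugeFix_eq_iff hBinv hN he hρ hC hp (hm t)).2 ⟨_, h1 t, rfl⟩).symm⟩⟩

theorem isIntegrableOn_levelManifold (hB : B.Nondegenerate) (hBinv : B.lieInvariant 𝔤)
    (hN : degLE 𝒢 (-(N : ℤ)) = ⊥) (he : IsGoodElement 𝒢 e) (hρ : IsPartialInverse 𝒢 e C ρ)
    (hC : C ≤ degLE 𝒢 0) :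
    IsIntegrableOn (levelManifold 𝒢 e)
      (fun q => reductionDistribution 𝒢 q ⊓ (levelManifold 𝒢 e).direction) := by
  obtain ⟨Θ', hΘ⟩ := adjointable_gaugeFix (N := N) hB hBinv hρ
  intro p hp
  have hp0 := mem_levelManifold.1 hp
  have hp1 := fil_mono 𝒢 (by norm_num : (0 : ℤ) ≤ 1) hp0
  set w₀ := loopMap ρ (p - constLoop e) with hw₀
  have hw₀m : w₀ ∈ fil 𝒢 (-2) := by
    have := hρ.loopMap_mem hp0
    rwa [zero_sub] at this
  -- The leaf is parametrised by the gauge: `φ(w)` is the point of the orbit of `p` with `ρ(φ(w) -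
  -- e) = w + w₀`. The shift by `w₀`, the gauge of `p` itself, makes `φ(0) = p`.
  let φ : Loop 𝔤 → Loop 𝔤 := fun w => sweep ρ e (w + w₀) N p
  have hsm : ∀ w ∈ fil 𝒢 (-2), w + w₀ ∈ fil 𝒢 (-1) := fun w hw =>
    fil_mono 𝒢 (by norm_num) (add_mem hw hw₀m)
  have hgauge : ∀ w ∈ fil 𝒢 (-2), loopMap ρ (φ w - constLoop e) = w + w₀ := fun w hw =>
    sweep_gauge hBinv hN he hρ hp1 (hsm w hw)
  have horb : ∀ w ∈ fil 𝒢 (-2), ∃ g ∈ adjointGroup (fil 𝒢 (-2)), φ w = act g.1 p := fun w hw => by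
    refine (sweep_spec hBinv he hρ (by norm_num : (1 : ℤ) ≤ 2) hp1 ?_ N).2.2
    rw [← hw₀, sub_add_cancel_right]
    exact neg_mem hw
  have hS : ∀ w ∈ fil 𝒢 (-2), φ w ∈ levelManifold 𝒢 e := fun w hw => by
    obtain ⟨g, hg, h⟩ := horb w hw
    exact h ▸ act_mem_levelManifold hBinv he hg hp
  have hvel : ∀ w ∈ fil 𝒢 (-2), ∀ s ∈ fil 𝒢 (-2),
      ∃ v ∈ (fil 𝒢 (-2)).map (poisson₂ (φ w)), HasVelocity (fun t : ℝ => φ (w + (t : ℂ) • s)) v := by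
    intro w hw s hs
    have hm : ∀ t : ℝ, w + (t : ℂ) • s ∈ fil 𝒢 (-2) := fun t =>
      add_mem hw (Submodule.smul_mem _ _ hs)
    have hc : IsPlot fun t : ℝ => φ (w + (t : ℂ) • s) :=
      isPlot_sweep hρ ((isPlot_line w s).add (isPlot_const w₀)) (isPlot_const p)
        (fun t => hsm _ (hm t)) N
    obtain ⟨v, hv⟩ := hc.exists_hasVelocity
    refine ⟨v, ?_, hv⟩
    have hv0 := direction_of_velocity (direction_levelManifold (𝒢 := 𝒢) (e := e))
      (fun t => hS _ (hm t)) hv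
    rw [direction_levelManifold] at hv0
    rw [← lineDeriv_gaugeFix_eq_zero_iff (N := N) hB hBinv hN he hρ hC (hS w hw) hv0]
    have h1 := hΘ.smooth.hasVelocity_comp_univ hc hv
    have h2 : (fun t : ℝ => gaugeFix 𝒢 ρ e N (φ (w + (t : ℂ) • s))) =
        fun _ => gaugeFix 𝒢 ρ e N p := by
      funext t
      obtain ⟨g, hg, h⟩ := horb _ (hm t)
      exact ((gaugeFix_eq_iff hBinv hN he hρ hC hp (hS _ (hm t))).2 ⟨g, hg, h.symm⟩).symm
    rw [h2] at h1
    simpa using h1.unique (hasVelocity_const _)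
  have hρv : ∀ w ∈ fil 𝒢 (-2), ∀ s ∈ fil 𝒢 (-2), ∀ v,
      HasVelocity (fun t : ℝ => φ (w + (t : ℂ) • s)) v → loopMap ρ v = s := by
    intro w hw s hs v hv
    have h1 := (hv.add (hasVelocity_const (-constLoop e))).map ρ
    have h2 : (fun t : ℝ => loopMap ρ (φ (w + (t : ℂ) • s) + -constLoop e)) =
        fun t : ℝ => (w + w₀) + (t : ℂ) • s := by
      funext t
      rw [← sub_eq_add_neg, hgauge _ (add_mem hw (Submodule.smul_mem _ _ hs))]
      abel
    rw [h2, add_zero] at h1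
    exact h1.unique (hasVelocity_line _ _)
  refine ⟨fil 𝒢 (-2), φ, fun k c hc hA => isPlot_sweep hρ (hc.add (isPlot_const w₀))
    (isPlot_const p) (fun t => hsm _ (hA t)) N, ?_, fun w hw => ⟨hS w hw, ?_, ?_⟩⟩
  · exact sweep_of_gauge (by rw [zero_add]) N
  · simp only [reductionDistribution_inf he hρ (hS w hw)]
    exact hvel w hw
  · simp only [reductionDistribution_inf he hρ (hS w hw)]
    intro v hv
    have hq1 := fil_mono 𝒢 (by norm_num : (0 : ℤ) ≤ 1) (mem_levelManifold.1 (hS w hw))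
    have hs : loopMap ρ v ∈ fil 𝒢 (-2) := by
      obtain ⟨ξ, hξ, rfl⟩ := hv
      have := hρ.loopMap_mem (poisson₂_mem he (by norm_num : -2 + 2 ≤ (0 : ℤ)) hq1 hξ)
      simpa using this
    refine ⟨loopMap ρ v, ⟨hs, ?_⟩, fun s h => (hρv w hw s h.1 v h.2).symm⟩
    obtain ⟨v', hv', h⟩ := hvel w hw _ hs
    -- Both vectors lie in `E` and have the same image under `ρ`, which is injective on `E`.
    suffices hvv : v - v' = 0 by
      obtain rfl := sub_eq_zero.1 hvv
      exact h
    obtain ⟨ξ, hξ, hξv⟩ := sub_mem hv hv'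
    rw [← hξv, eq_zero_of_poisson₂ hN hρ hq1 (fil_mono 𝒢 (by norm_num) hξ), map_zero]
    rw [hξv, map_sub, hρv w hw _ hs v' h, sub_self]

end Geometry

/-! ### The two reductions -/

section Reduction

variable {𝔤 : Type*} [LieRing 𝔤] [LieAlgebra ℂ 𝔤] [Module.Finite ℂ 𝔤] [LieAlgebra.IsSimple ℂ 𝔤]
  {𝒢 : ℤ → Submodule ℂ 𝔤} [GradedLieAlgebra 𝒢] {e : 𝔤} {C : Submodule ℂ 𝔤}
  {ρ : 𝔤 →ₗ[ℂ] 𝔤} {B : LinearMap.BilinForm ℂ 𝔤} {N : ℕ}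

theorem mem_fil_iff_pairing (hB : B.Nondegenerate) (hBinv : B.lieInvariant 𝔤) {k l : ℤ}
    (hkl : l = -k - 1) {u : Loop 𝔤} : u ∈ fil 𝒢 k ↔ ∀ ξ ∈ fil 𝒢 l, pairing B u ξ = 0 := by
  subst hkl
  constructor
  · intro hu ξ hξ
    rw [pairing_apply]
    simp only [fun x => (mem_degLE_iff_form hB hBinv).1 (hu x) _ (hξ x)]
    simp
  · exact fun h x => (mem_degLE_iff_form hB hBinv).2 fun y hy => form_eq_zero_of_pairing B h x hy

theorem hasGradOn_linear (hs : ∀ x y, B x y = B y x) (A : AffineSubspace ℂ (Loop 𝔤)) (ξ : Loop 𝔤) :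
    HasGradOn B A (fun q => pairing B q ξ) fun _ => ξ where
  smooth k c hc _ := hc.pairing B (isPlot_const ξ)
  smooth_grad k c _ _ := isPlot_const ξ
  deriv q _ s _ := by
    have h := HasVelocity.pairing B (isPlot_line q s) (isPlot_const ξ) (hasVelocity_line q s)
      (hasVelocity_const ξ)
    rw [map_zero, add_zero] at h
    exact pairing_comm hs s ξ ▸ h

theorem poisson₁_eq (a : 𝔤) : (poisson₁ a : Tensor 𝔤) = affineTensor 0 (constLoop a) := by
  funext q
  refine LinearMap.ext fun u => ?_
  rw [affineTensor_apply, zero_smul, zero_add]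
  rfl

theorem pencil_eq (a : 𝔤) (l : ℂ) :
    (poisson₂ + l • poisson₁ a : Tensor 𝔤) = affineTensor 1 (l • constLoop a) := by
  funext q
  refine LinearMap.ext fun u => ?_
  rw [affineTensor_apply, one_smul, map_smul]
  rfl

/-- The pencil agrees with the second structure on `L𝔫⁻`. -/
theorem affineTensor_of_lie_eq_zero {w : Loop 𝔤} (hw : ∀ ξ ∈ fil 𝒢 (-1), loopLie w ξ = 0) (k : ℂ)
    (q : Loop 𝔤) {ξ : Loop 𝔤} (hξ : ξ ∈ fil 𝒢 (-1)) :
    affineTensor k w q ξ = k • poisson₂ q ξ := by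
  rw [affineTensor_apply, hw ξ hξ, add_zero]; rfl

/-- By skewness, pairing the image with `ξ ∈ L𝔫⁻` is pairing `v` with a multiple of `P₂ ξ ∈ D`;
being orthogonal to `L𝔫⁻` means lying in `L𝔟⁻`. -/
theorem affineTensor_mem (hB : B.Nondegenerate) (hBinv : B.lieInvariant 𝔤) {w : Loop 𝔤}
    (hw : ∀ ξ ∈ fil 𝒢 (-1), loopLie w ξ = 0) (k : ℂ) {q v : Loop 𝔤}
    (hv : ∀ d ∈ reductionDistribution 𝒢 q, pairing B v d = 0) :
    affineTensor k w q v ∈ fil 𝒢 0 := by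
  have hs := invariant_isSymm hBinv
  refine (mem_fil_iff_pairing hB hBinv (l := -1) (by norm_num)).2 fun ξ hξ => ?_
  rw [pairing_comm hs, affineTensor_skew hs hBinv, affineTensor_of_lie_eq_zero hw k q hξ, map_smul,
    hv _ ⟨ξ, hξ, rfl⟩, smul_zero, neg_zero]

/-- The bracket with a function that is constant along `D` only depends on the restriction of the
differentials to `TQ`. -/
theorem pairing_affineTensor_eq (hB : B.Nondegenerate) (hBinv : B.lieInvariant 𝔤)
    (hN : degLE 𝒢 (-(N : ℤ)) = ⊥) (hC : C ≤ degLE 𝒢 0)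
    (hρ : IsPartialInverse 𝒢 e C ρ) {w : Loop 𝔤}
    (hw : ∀ ξ ∈ fil 𝒢 (-1), loopLie w ξ = 0) (k : ℂ) {q : Loop 𝔤}
    (hq : q ∈ transversalManifold e C) {u u' v v' : Loop 𝔤}
    (hu : ∀ d ∈ reductionDistribution 𝒢 q, pairing B u d = 0)
    (hu' : ∀ d ∈ reductionDistribution 𝒢 q, pairing B u' d = 0)
    (hv : ∀ d ∈ reductionDistribution 𝒢 q, pairing B v d = 0)
    (hv' : ∀ d ∈ reductionDistribution 𝒢 q, pairing B v' d = 0)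
    (huu : ∀ s ∈ loopsIn C, pairing B u s = pairing B u' s)
    (hvv : ∀ s ∈ loopsIn C, pairing B v s = pairing B v' s) :
    pairing B u (affineTensor k w q v) = pairing B u' (affineTensor k w q v') := by
  have hs := invariant_isSymm hBinv
  have hq1 := fil_mono 𝒢 (by norm_num : (0 : ℤ) ≤ 1)
    (mem_levelManifold.1 (transversalManifold_le hC hq))
  -- On `TS = E ⊕ TQ` both covectors vanish on `E`, so agreement on `TQ` suffices. Hamiltonian
  -- vectors lie in `TS`, and skewness lets the argument be used in each slot.
  have key : ∀ {u u' : Loop 𝔤}, (∀ d ∈ reductionDistribution 𝒢 q, pairing B u d = 0) →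
      (∀ d ∈ reductionDistribution 𝒢 q, pairing B u' d = 0) →
      (∀ s ∈ loopsIn C, pairing B u s = pairing B u' s) → ∀ s ∈ fil 𝒢 0,
      pairing B u s = pairing B u' s := by
    intro u u' hu hu' h s hs0
    obtain ⟨ξ, hξ, hc⟩ := exists_sub_poisson₂_mem hN hρ hq1 (by norm_num) hs0
    have hd : poisson₂ q ξ ∈ reductionDistribution 𝒢 q :=
      ⟨ξ, fil_mono 𝒢 (by norm_num) hξ, rfl⟩
    have h1 := h _ hc
    rwa [map_sub, map_sub, hu _ hd, hu' _ hd, sub_zero, sub_zero] at h1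
  rw [key hu hu' huu _ (affineTensor_mem hB hBinv hw k hv), affineTensor_skew hs hBinv,
    key hv hv' hvv _ (affineTensor_mem hB hBinv hw k hu'), affineTensor_skew hs hBinv, neg_neg]

theorem HasGradOn.pairing_eq_zero {U : Set (Loop 𝔤)} {V : Submodule ℂ (Loop 𝔤)}
    (hU : ∀ q ∈ U, ∀ v ∈ V, q + v ∈ U) {F : Loop 𝔤 → ℂ} {δF : Loop 𝔤 → Loop 𝔤}
    (hF : HasGradOn B ⊤ F δF) (h : ∀ q ∈ U, F q = 0) {q : Loop 𝔤} (hq : q ∈ U) {v : Loop 𝔤}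
    (hv : v ∈ V) : pairing B (δF q) v = 0 := by
  have h1 := hF.deriv q (AffineSubspace.mem_top ℂ _ _) v (by simp)
  have h2 : (fun θ : ℝ => F (q + (θ : ℂ) • v)) = fun _ => 0 :=
    funext fun θ => h _ (hU q hq _ (V.smul_mem _ hv))
  rw [h2] at h1
  exact h1.unique (hasDerivAt_const _ _)

/-- The bracket of functionals that are constant along `D` is constant along `D`, for the tensors
with second component `d/dx + ad q`. -/
theorem constAlongOn_bracket_one (hB : B.Nondegenerate) (hBinv : B.lieInvariant 𝔤)
    {w : Loop 𝔤} (hw : ∀ ξ ∈ fil 𝒢 (-1), loopLie w ξ = 0) {U : Set (Loop 𝔤)}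
    (hU : ∀ q ∈ U, ∀ v ∈ fil 𝒢 0, q + v ∈ U) {F G : Loop 𝔤 → ℂ} {δF δG δ : Loop 𝔤 → Loop 𝔤}
    (hF : HasGradOn B ⊤ F δF) (hG : HasGradOn B ⊤ G δG)
    (hFU : ConstAlongOn B (reductionDistribution 𝒢) U δF)
    (hGU : ConstAlongOn B (reductionDistribution 𝒢) U δG)
    (hδ : HasGradOn B ⊤ (bracket B (affineTensor 1 w) δF δG) δ) :
    ConstAlongOn B (reductionDistribution 𝒢) U δ := by
  rintro q hq _ ⟨ξ, hξ, rfl⟩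
  have hs := invariant_isSymm hBinv
  have hK := hasGradOn_linear hs ⊤ ξ
  have hGK := hasGradOn_bracket hB hs hBinv 1 w hG hK
  have hKF := hasGradOn_bracket hB hs hBinv 1 w hK hF
  -- Jacobi identity with the linear functional of `ξ`, whose Hamiltonian field is `P₂ ξ`: the
  -- derivative of `{F, G}` along `D` becomes a sum of two brackets.
  have hJ := (isPoissonOn_affineTensor hB hs hBinv 1 w).jacobi _ _ _ _ _ _ hF hG hK _ _ _ hδ hGK hKF
    q (AffineSubspace.mem_top ℂ _ _)
  have hP : ∀ q, affineTensor 1 w q ξ = poisson₂ q ξ := fun q => by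
    rw [affineTensor_of_lie_eq_zero hw 1 q hξ, one_smul]
  -- The functional `{G, K_ξ}` vanishes on `U`, and the Hamiltonian vector of `F` lies in `L𝔟⁻`,
  -- along which `U` is invariant. Hence constancy at the points of `S` is enough.
  have h1 : bracket B (affineTensor 1 w) (bracketGrad 1 w δG fun _ => ξ) δF q = 0 := by
    refine hGK.pairing_eq_zero hU (fun p hp => ?_) hq (affineTensor_mem hB hBinv hw 1 (hFU q hq))
    show pairing B (δG p) (affineTensor 1 w p ξ) = 0
    rw [hP]
    exact hGU p hp _ ⟨ξ, hξ, rfl⟩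
  have h2 : bracket B (affineTensor 1 w) (bracketGrad 1 w (fun _ => ξ) δF) δG q = 0 := by
    refine hKF.pairing_eq_zero hU (fun p hp => ?_) hq (affineTensor_mem hB hBinv hw 1 (hGU q hq))
    show pairing B ξ (affineTensor 1 w p (δF p)) = 0
    rw [affineTensor_skew hs hBinv, hP, hFU p hp _ ⟨ξ, hξ, rfl⟩, neg_zero]
  rw [h1, h2, add_zero, add_zero] at hJ
  change pairing B (δ q) (affineTensor 1 w q ξ) = 0 at hJ
  rwa [hP] at hJ

/-- For `k = 0` the linear functionals are Casimirs and generate nothing. The bracket is instead a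
combination of two brackets with `k = 1`, namely those for `w` and for `0`, with coefficients `1`
and `k - 1`. -/
theorem constAlongOn_bracket (hB : B.Nondegenerate) (hBinv : B.lieInvariant 𝔤)
    {w : Loop 𝔤} (hw : ∀ ξ ∈ fil 𝒢 (-1), loopLie w ξ = 0) (k : ℂ) {U : Set (Loop 𝔤)}
    (hU : ∀ q ∈ U, ∀ v ∈ fil 𝒢 0, q + v ∈ U) {F G : Loop 𝔤 → ℂ} {δF δG δ : Loop 𝔤 → Loop 𝔤}
    (hF : HasGradOn B ⊤ F δF) (hG : HasGradOn B ⊤ G δG)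
    (hFU : ConstAlongOn B (reductionDistribution 𝒢) U δF)
    (hGU : ConstAlongOn B (reductionDistribution 𝒢) U δG)
    (hδ : HasGradOn B ⊤ (bracket B (affineTensor k w) δF δG) δ) :
    ConstAlongOn B (reductionDistribution 𝒢) U δ := by
  have hs := invariant_isSymm hBinv
  have h1 := hasGradOn_bracket hB hs hBinv 1 w hF hG
  have h0 := hasGradOn_bracket hB hs hBinv 1 0 hF hG
  have c1 := constAlongOn_bracket_one hB hBinv hw hU hF hG hFU hGU h1
  have c0 := constAlongOn_bracket_one hB hBinv (fun ξ _ => by simp) hU hF hG hFU hGU h0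
  intro q hq d hd
  have htop := AffineSubspace.mem_top ℂ (Loop 𝔤) q
  have hd1 := h1.deriv q htop d (by simp)
  have hd0 := h0.deriv q htop d (by simp)
  rw [c1 q hq d hd] at hd1
  rw [c0 q hq d hd] at hd0
  have h2 := hd1.add (hd0.const_mul (k - 1))
  rw [mul_zero, add_zero] at h2
  refine (hδ.deriv q htop d (by simp)).unique (h2.congr_of_eventuallyEq (.of_forall fun θ => ?_))
  simp only [bracket, affineTensor_apply, map_add, map_smul, Pi.add_apply, map_zero,
    LinearMap.zero_apply, smul_eq_mul]
  ring

/-! ### The reduced tensors -/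

/-- The image of a tensor under a smooth map. -/
def HasAdjoint.pushTensor (hB : B.Nondegenerate) (hs : ∀ x y, B x y = B y x)
    {Φ : Loop 𝔤 → Loop 𝔤} {Φ' : Loop 𝔤 → Loop 𝔤 → Loop 𝔤} (h : HasAdjoint B Φ Φ')
    (P : Tensor 𝔤) : Tensor 𝔤 := fun q =>
  { toFun := fun u => lineDeriv Φ q (P q (Φ' q u))
    map_add' := fun u v => by rw [h.adjoint_add hB, map_add, h.lineDeriv_add hB hs]
    map_smul' := fun c u => by
      rw [h.adjoint_smul hB, map_smul, h.lineDeriv_smul hB hs, RingHom.id_apply] }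

theorem HasAdjoint.pushTensor_apply (hB : B.Nondegenerate) (hs : ∀ x y, B x y = B y x)
    {Φ : Loop 𝔤 → Loop 𝔤} {Φ' : Loop 𝔤 → Loop 𝔤 → Loop 𝔤} (h : HasAdjoint B Φ Φ')
    (P : Tensor 𝔤) (q u : Loop 𝔤) :
    h.pushTensor hB hs P q u = lineDeriv Φ q (P q (Φ' q u)) := rfl

theorem HasAdjoint.pushTensor_add_smul (hB : B.Nondegenerate) (hs : ∀ x y, B x y = B y x)
    {Φ : Loop 𝔤 → Loop 𝔤} {Φ' : Loop 𝔤 → Loop 𝔤 → Loop 𝔤} (h : HasAdjoint B Φ Φ')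
    (P P' : Tensor 𝔤) (l : ℂ) :
    h.pushTensor hB hs P + l • h.pushTensor hB hs P' = h.pushTensor hB hs (P + l • P') := by
  funext q
  refine LinearMap.ext fun u => ?_
  show lineDeriv Φ q (P q (Φ' q u)) + l • lineDeriv Φ q (P' q (Φ' q u)) =
    lineDeriv Φ q (P q (Φ' q u) + l • P' q (Φ' q u))
  rw [h.lineDeriv_add hB hs, h.lineDeriv_smul hB hs]

variable {Θ' : Loop 𝔤 → Loop 𝔤 → Loop 𝔤}

theorem gaugeFix_adjoint_annihilates (hB : B.Nondegenerate) (hBinv : B.lieInvariant 𝔤)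
    (hN : degLE 𝒢 (-(N : ℤ)) = ⊥) (he : IsGoodElement 𝒢 e) (hρ : IsPartialInverse 𝒢 e C ρ)
    (hC : C ≤ degLE 𝒢 0) (hΘ : HasAdjoint B (gaugeFix 𝒢 ρ e N) Θ') {q : Loop 𝔤}
    (hq : q ∈ levelManifold 𝒢 e) (u : Loop 𝔤) :
    ∀ d ∈ reductionDistribution 𝒢 q, pairing B (Θ' q u) d = 0 := by
  rintro _ ⟨ξ, hξ, rfl⟩
  rw [← hΘ.adjoint, lineDeriv_gaugeFix_poisson₂ hB hBinv hN he hρ hC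
    (fil_mono 𝒢 (by norm_num) (mem_levelManifold.1 hq)) hξ, map_zero]

/-- Extensions are `f ∘ π`. The push-forward tensor is by construction the bracket of the covectors
`dπ*(δf)`, which annihilate `D` and have the prescribed restriction to `TQ`; any other extension
gives the same value. -/
theorem isTransversalReduction_gaugeFix (hB : B.Nondegenerate) (hBinv : B.lieInvariant 𝔤)
    (hN : degLE 𝒢 (-(N : ℤ)) = ⊥) (he : IsGoodElement 𝒢 e) (hρ : IsPartialInverse 𝒢 e C ρ)
    (hC : C ≤ degLE 𝒢 0) (hΘ : HasAdjoint B (gaugeFix 𝒢 ρ e N) Θ') {w : Loop 𝔤}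
    (hw : ∀ ξ ∈ fil 𝒢 (-1), loopLie w ξ = 0) (k : ℂ) :
    IsTransversalReduction B (affineTensor k w) (levelManifold 𝒢 e) (reductionDistribution 𝒢)
      (transversalManifold e C)
      (hΘ.pushTensor hB (invariant_isSymm hBinv) (affineTensor k w)) where
  extend f δf hf := ⟨_, _, hΘ.hasGradOn_comp direction_transversalManifold
      (gaugeFix_mem hBinv hN he hρ) hf,
    fun q hq => gaugeFix_adjoint_annihilates hB hBinv hN he hρ hC hΘ hq _,
    fun q hq => by rw [gaugeFix_of_mem hC he hρ hq]⟩
  bracket_eq f δf g δg hf hg F δF G δG hF hG hFS hGS hFf hGg q hq := by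
    have hqS := transversalManifold_le hC hq
    have key : ∀ {f F : Loop 𝔤 → ℂ} {δf δF : Loop 𝔤 → Loop 𝔤},
        HasGradOn B (transversalManifold e C) f δf → HasGradOn B ⊤ F δF →
        (∀ q ∈ transversalManifold e C, F q = f q) → ∀ s ∈ loopsIn C,
        pairing B (δF q) s = pairing B (Θ' q (δf q)) s := by
      intro f F δf δF hf hF h s hs
      rw [← hΘ.adjoint, lineDeriv_gaugeFix_of_mem hC he hρ hq hs]
      exact hF.pairing_unique hf le_top h hq (direction_transversalManifold (C := C) ▸ hs)
    rw [bracket, bracket, HasAdjoint.pushTensor_apply, hΘ.adjoint]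
    exact pairing_affineTensor_eq hB hBinv hN hC hρ hw k hq (hFS q hqS)
      (gaugeFix_adjoint_annihilates hB hBinv hN he hρ hC hΘ hqS _) (hGS q hqS)
      (gaugeFix_adjoint_annihilates hB hBinv hN he hρ hC hΘ hqS _) (key hf hF hFf) (key hg hG hGg)

theorem add_mem_levelManifold {q v : Loop 𝔤} (hq : q ∈ (levelManifold 𝒢 e : Set (Loop 𝔤)))
    (hv : v ∈ fil 𝒢 0) : q + v ∈ (levelManifold 𝒢 e : Set (Loop 𝔤)) := by
  refine mem_levelManifold.2 ?_
  rw [add_sub_right_comm]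
  exact add_mem (mem_levelManifold.1 hq) hv

/-- Closedness and the Jacobi identity are inherited from `L𝔤`: the ambient bracket of two
extensions is again constant along `D` on `S`, hence an extension of the reduced bracket. -/
theorem isPoissonOn_pushTensor (hB : B.Nondegenerate) (hBinv : B.lieInvariant 𝔤)
    (hN : degLE 𝒢 (-(N : ℤ)) = ⊥) (he : IsGoodElement 𝒢 e) (hρ : IsPartialInverse 𝒢 e C ρ)
    (hC : C ≤ degLE 𝒢 0) (hΘ : HasAdjoint B (gaugeFix 𝒢 ρ e N) Θ') {w : Loop 𝔤}
    (hw : ∀ ξ ∈ fil 𝒢 (-1), loopLie w ξ = 0) (k : ℂ) :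
    IsPoissonOn B (transversalManifold e C)
      (hΘ.pushTensor hB (invariant_isSymm hBinv) (affineTensor k w)) := by
  have hs := invariant_isSymm hBinv
  have hT := isTransversalReduction_gaugeFix hB hBinv hN he hρ hC hΘ hw k
  refine ⟨fun q hq v => ?_, fun q hq v u => ?_, ?_, ?_⟩
  · exact direction_of_velocity direction_transversalManifold
      (fun t => gaugeFix_mem hBinv hN he hρ _) (hΘ.smooth.hasVelocity q _)
  · rw [HasAdjoint.pushTensor_apply, HasAdjoint.pushTensor_apply, hΘ.adjoint, hΘ.adjoint,
      affineTensor_skew hs hBinv]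
  · intro F δF G δG hF hG
    obtain ⟨F', δF', hF', hFS, hFF⟩ := hT.extend F δF hF
    obtain ⟨G', δG', hG', hGS, hGG⟩ := hT.extend G δG hG
    exact ⟨_, ((hasGradOn_bracket hB hs hBinv k w hF' hG').mono (le_top (a := transversalManifold e C))).congr
      (hT.bracket_eq F δF G δG hF hG _ _ _ _ hF' hG' hFS hGS hFF hGG)⟩
  · intro F δF G δG H δH hF hG hH δFG δGH δHF hFG hGH hHF q hq
    obtain ⟨F', δF', hF', hFS, hFF⟩ := hT.extend F δF hF
    obtain ⟨G', δG', hG', hGS, hGG⟩ := hT.extend G δG hG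
    obtain ⟨H', δH', hH', hHS, hHH⟩ := hT.extend H δH hH
    have key : ∀ {F G H F' G' H' : Loop 𝔤 → ℂ} {δF δG δH δF' δG' δH' δFG : Loop 𝔤 → Loop 𝔤},
        HasGradOn B (transversalManifold e C) F δF → HasGradOn B (transversalManifold e C) G δG →
        HasGradOn B (transversalManifold e C) H δH →
        HasGradOn B ⊤ F' δF' → HasGradOn B ⊤ G' δG' → HasGradOn B ⊤ H' δH' →
        ConstAlongOn B (reductionDistribution 𝒢) (levelManifold 𝒢 e) δF' →
        ConstAlongOn B (reductionDistribution 𝒢) (levelManifold 𝒢 e) δG' →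
        ConstAlongOn B (reductionDistribution 𝒢) (levelManifold 𝒢 e) δH' →
        (∀ q ∈ transversalManifold e C, F' q = F q) → (∀ q ∈ transversalManifold e C, G' q = G q) →
        (∀ q ∈ transversalManifold e C, H' q = H q) →
        HasGradOn B (transversalManifold e C)
          (bracket B (hΘ.pushTensor hB hs (affineTensor k w)) δF δG) δFG →
        bracket B (affineTensor k w) (bracketGrad k w δF' δG') δH' q =
          bracket B (hΘ.pushTensor hB hs (affineTensor k w)) δFG δH q := by
      intro F G H F' G' H' δF δG δH δF' δG' δH' δFG hF hG hH hF' hG' hH' hFS hGS hHS hFF hGG hHH hFG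
      have hFG' := hasGradOn_bracket hB hs hBinv k w hF' hG'
      exact hT.bracket_eq _ _ _ _ hFG hH _ _ _ _ hFG' hH'
        (constAlongOn_bracket hB hBinv hw k (fun q hq v hv => add_mem_levelManifold hq hv) hF' hG'
          hFS hGS hFG') hHS
        (hT.bracket_eq F δF G δG hF hG _ _ _ _ hF' hG' hFS hGS hFF hGG) hHH q hq
    rw [← key hF hG hH hF' hG' hH' hFS hGS hHS hFF hGG hHH hFG,
      ← key hG hH hF hG' hH' hF' hGS hHS hFS hGG hHH hFF hGH,
      ← key hH hF hG hH' hF' hG' hHS hFS hGS hHH hFF hGG hHF]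
    exact (isPoissonOn_affineTensor hB hs hBinv k w).jacobi _ _ _ _ _ _ hF' hG' hH' _ _ _
      (hasGradOn_bracket hB hs hBinv k w hF' hG') (hasGradOn_bracket hB hs hBinv k w hG' hH')
      (hasGradOn_bracket hB hs hBinv k w hH' hF') q (AffineSubspace.mem_top ℂ _ _)

/-- A functional whose differential annihilates `E` is constant on the leaves. -/
theorem IsLeafSpace.eq_of_constAlong {S Q : AffineSubspace ℂ (Loop 𝔤)}
    {D : Loop 𝔤 → Submodule ℂ (Loop 𝔤)} {V : Submodule ℂ 𝔤} (hV : S.direction = loopsIn V)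
    {π : Loop 𝔤 → Loop 𝔤} (hπ : IsLeafSpace S (fun q => D q ⊓ S.direction) Q π)
    (hsm : SmoothMapOn Set.univ π) {H : Loop 𝔤 → ℂ} {δ : Loop 𝔤 → Loop 𝔤}
    (hH : HasGradOn B ⊤ H δ) (hc : ConstAlongOn B D S δ) {p p' : Loop 𝔤} (hp : p ∈ S)
    (hp' : p' ∈ S) (h : π p = π p') : H p = H p' := by
  obtain ⟨c, hcp, h0, h1, hcS⟩ := hπ.connected p hp p' hp' h
  -- Along a curve in a fibre the velocity is in the kernel of the derivative of `π`, that is, in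
  -- `E`.
  have hd : ∀ t₀ : ℝ, HasDerivAt (fun t => H (c t)) 0 t₀ := by
    intro t₀
    have hct : IsPlot fun t : ℝ => c (t₀ + t) := hcp.comp (by fun_prop)
    obtain ⟨v, hv⟩ := hct.exists_hasVelocity
    have hvS := direction_of_velocity hV (fun t => (hcS (t₀ + t)).1) hv
    have h2 := hsm.hasVelocity_comp_univ hct hv
    simp only [fun t => (hcS (t₀ + t)).2] at h2
    have h3 := h2.unique (hasVelocity_const _)
    have hvE := (hπ.ker (c (t₀ + 0)) (hcS _).1 v hvS).1 (h3 ▸ hsm.hasVelocity _ v)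
    have h4 := hH.hasDerivAt_comp direction_top hct (fun _ => AffineSubspace.mem_top ℂ _ _) hv
    rw [hc _ (hcS _).1 v hvE.1] at h4
    have h5 := HasDerivAt.comp_sub_const t₀ t₀ (f := fun t => H (c (t₀ + t))) (f' := 0)
      (by rwa [sub_self])
    simpa using h5
  rw [← h0, ← h1]
  exact is_const_of_deriv_eq_zero (fun t => (hd t).differentiableAt) (fun t => (hd t).deriv) 0 1

/-- The bracket `{F, G}` is constant along `D`, hence on fibres of `π`, so its value at `p` may be
computed at `π(p) ∈ Q`, where the transversal reduction gives it. -/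
theorem isQuotientReduction_gaugeFix (hB : B.Nondegenerate) (hBinv : B.lieInvariant 𝔤)
    (hN : degLE 𝒢 (-(N : ℤ)) = ⊥) (he : IsGoodElement 𝒢 e) (hρ : IsPartialInverse 𝒢 e C ρ)
    (hC : C ≤ degLE 𝒢 0) (hΘ : HasAdjoint B (gaugeFix 𝒢 ρ e N) Θ') {w : Loop 𝔤}
    (hw : ∀ ξ ∈ fil 𝒢 (-1), loopLie w ξ = 0) (k : ℂ) :
    IsQuotientReduction B (affineTensor k w) (levelManifold 𝒢 e) (reductionDistribution 𝒢)
      (transversalManifold e C) (gaugeFix 𝒢 ρ e N)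
      (hΘ.pushTensor hB (invariant_isSymm hBinv) (affineTensor k w)) where
  extend f δf hf := ⟨_, _, hΘ.hasGradOn_comp direction_transversalManifold
      (gaugeFix_mem hBinv hN he hρ) hf,
    fun q hq => gaugeFix_adjoint_annihilates hB hBinv hN he hρ hC hΘ hq _, fun _ _ => rfl⟩
  bracket_eq f δf g δg hf hg F δF G δG hF hG hFS hGS hFf hGg p hp := by
    have hs := invariant_isSymm hBinv
    have hq := gaugeFix_mem (N := N) hBinv hN he hρ p
    have hFG := hasGradOn_bracket hB hs hBinv k w hF hG
    have hres : ∀ q ∈ transversalManifold e C, gaugeFix 𝒢 ρ e N q = q := fun q hq =>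
      gaugeFix_of_mem hC he hρ hq
    rw [(isLeafSpace_gaugeFix hB hBinv hN he hρ hC).eq_of_constAlong direction_levelManifold
      hΘ.smooth hFG (constAlongOn_bracket hB hBinv hw k
        (fun q hq v hv => add_mem_levelManifold hq hv) hF hG hFS hGS hFG) hp
      (transversalManifold_le hC hq) (hres _ hq).symm]
    refine (isTransversalReduction_gaugeFix hB hBinv hN he hρ hC hΘ hw k).bracket_eq f δf g δg hf hg
      F δF G δG hF hG hFS hGS (fun q hq => ?_) (fun q hq => ?_) _ hq
    · rw [hFf q (transversalManifold_le hC hq), hres q hq]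
    · rw [hGg q (transversalManifold_le hC hq), hres q hq]

theorem marsdenRatiuHyp_gaugeFix (hB : B.Nondegenerate) (hBinv : B.lieInvariant 𝔤)
    (hN : degLE 𝒢 (-(N : ℤ)) = ⊥) (he : IsGoodElement 𝒢 e) (hρ : IsPartialInverse 𝒢 e C ρ)
    (hC : C ≤ degLE 𝒢 0) {w : Loop 𝔤} (hw : ∀ ξ ∈ fil 𝒢 (-1), loopLie w ξ = 0) (k : ℂ) :
    MarsdenRatiuHyp B (affineTensor k w) (levelManifold 𝒢 e) (reductionDistribution 𝒢)
      (transversalManifold e C) (gaugeFix 𝒢 ρ e N) where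
  poisson := isPoissonOn_affineTensor hB (invariant_isSymm hBinv) hBinv k w
  integrable := isIntegrableOn_levelManifold hB hBinv hN he hρ hC
  regular := isLeafSpace_gaugeFix hB hBinv hN he hρ hC
  invariant U hU F δF G δG δ hF hG hFU hGU hδ := by
    refine constAlongOn_bracket hB hBinv hw k ?_ hF hG hFU hGU hδ
    rcases hU with rfl | rfl
    · exact fun _ _ _ _ => Set.mem_univ _
    · exact fun q hq v hv => add_mem_levelManifold hq hv
  annihilator q _ v hv := Submodule.mem_sup_left <| by
    rw [direction_levelManifold]
    exact affineTensor_mem hB hBinv hw k hv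

end Reduction

/-! ### The input of the reductions -/

section Input

variable {𝔤 : Type*} [LieRing 𝔤] [LieAlgebra ℂ 𝔤] [Module.Finite ℂ 𝔤] [LieAlgebra.IsSimple ℂ 𝔤]
  {𝒢 : ℤ → Submodule ℂ 𝔤} [GradedLieAlgebra 𝒢] {e : 𝔤} {C : Submodule ℂ 𝔤}
  {ρ : 𝔤 →ₗ[ℂ] 𝔤} {B : LinearMap.BilinForm ℂ 𝔤} {N : ℕ}

theorem bihamiltonianReductionData (hB : B.Nondegenerate) (hBinv : B.lieInvariant 𝔤) {a : 𝔤}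
    (ha : ∀ ξ ∈ fil 𝒢 (-1), loopLie (constLoop a) ξ = 0) :
    BihamiltonianReductionData B (poisson₁ a) poisson₂ (linearFunctionals B (fil 𝒢 (-1)))
      (levelManifold 𝒢 e) (reductionDistribution 𝒢) := by
  have hs := invariant_isSymm hBinv
  have hgrad : ∀ {K : Loop 𝔤 → ℂ} {ξ : Loop 𝔤}, (∀ q, K q = pairing B q ξ) →
      HasGradOn B ⊤ K fun _ => ξ := fun h => (hasGradOn_linear hs ⊤ _).congr fun q _ => (h q).symm
  refine ⟨?_, ?_, ?_, ⟨constLoop e, fun q => ?_⟩, fun q v => ?_⟩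
  · rintro K ⟨ξ, hξ, h⟩
    exact ⟨_, hgrad h, fun q => ha ξ hξ⟩
  · rintro K ⟨ξ, hξ, h⟩ κ hκ q hq
    have h1 := (hgrad h).unique hB hκ q
    funext p
    rw [h p, h1, hq, map_zero]; rfl
  · rintro K ⟨ξ, hξ, h⟩ K' ⟨ξ', hξ', h'⟩ κ κ' hκ hκ'
    -- The bracket of the functionals of `ξ` and `ξ'` is that of `[ξ', ξ]`; the central term
    -- `(ξ|ξ'_x)` is zero because `𝔫⁻` is isotropic.
    refine ⟨loopLie ξ' ξ, lie_mem_fil_of_le 𝒢 hξ' hξ (by norm_num), fun q => ?_⟩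
    rw [bracket, ← (hgrad h).unique hB hκ q, ← (hgrad h').unique hB hκ' q, poisson₂_apply, map_add,
      (mem_fil_iff_pairing hB hBinv (l := 0) (by norm_num)).1 hξ _
        (fil_mono 𝒢 (by norm_num) (loopDeriv_mem hξ')), zero_add, pairing_comm hs, pairing_lie hBinv]
  · rw [mem_levelManifold, mem_fil_iff_pairing hB hBinv (l := -1) (by norm_num)]
    constructor
    · rintro h K ⟨ξ, hξ, hK⟩
      rw [hK, hK, ← sub_eq_zero, ← LinearMap.sub_apply, ← map_sub]
      exact h ξ hξ
    · intro h ξ hξ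
      have := h (fun q => pairing B q ξ) ⟨ξ, hξ, fun _ => rfl⟩
      rw [map_sub, LinearMap.sub_apply, sub_eq_zero]
      exact this
  · rw [mem_reductionDistribution]
    constructor
    · rintro ⟨ξ, hξ, rfl⟩
      exact ⟨_, ⟨ξ, hξ, fun _ => rfl⟩, _, hgrad fun _ => rfl, rfl⟩
    · rintro ⟨K, ⟨ξ, hξ, h⟩, κ, hκ, rfl⟩
      exact ⟨ξ, hξ, by rw [(hgrad h).unique hB hκ q]⟩

theorem sub_projPlus_mem (q : Loop 𝔤) : q - loopMap (projPlus 𝒢) q ∈ fil 𝒢 0 :=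
  loopMap_projPlus_eq_iff.1
    (Loop.ext fun x => (projPlus_of_mem_nPlus (projPlus_mem (𝒢 := 𝒢) (q x))).symm)

theorem marsdenWeinsteinData (hB : B.Nondegenerate) (hBinv : B.lieInvariant 𝔤)
    (he : IsGoodElement 𝒢 e) {w : Loop 𝔤} (hw : ∀ ξ ∈ fil 𝒢 (-1), loopLie w ξ = 0) :
    MarsdenWeinsteinData B (affineTensor 1 w) (fil 𝒢 (-1)) (loopsIn (nPlus 𝒢))
      (loopMap (projPlus 𝒢)) (constLoop e) (levelManifold 𝒢 e) (reductionDistribution 𝒢) := by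
  have hs := invariant_isSymm hBinv
  have horth : ∀ {u ξ : Loop 𝔤}, u ∈ fil 𝒢 0 → ξ ∈ fil 𝒢 (-1) → pairing B u ξ = 0 :=
    fun hu hξ => (mem_fil_iff_pairing hB hBinv (by norm_num)).1 hu _ hξ
  -- Projecting along `L𝔟⁻` does not change the pairing with `L𝔫⁻`, so the components of the
  -- momentum map are the linear functionals of the bi-Hamiltonian reduction.
  have hJ : ∀ (q : Loop 𝔤) {ξ : Loop 𝔤}, ξ ∈ fil 𝒢 (-1) →
      pairing B (loopMap (projPlus 𝒢) q) ξ = pairing B q ξ := fun q ξ hξ => by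
    have := horth (sub_projPlus_mem q) hξ
    rw [map_sub, LinearMap.sub_apply, sub_eq_zero] at this
    exact this.symm
  have hg : ∀ {g : (Module.End ℂ (Op 𝔤))ˣ}, g ∈ adjointGroup (fil 𝒢 (-1)) →
      IsGauge 𝒢 B 1 g.1 := fun hg => isGauge_of_mem hBinv le_rfl hg
  have hJn : ∀ {η : Loop 𝔤}, η ∈ loopsIn (nPlus 𝒢) → loopMap (projPlus 𝒢) η = η :=
    fun hη => Loop.ext fun x => projPlus_of_mem_nPlus (hη x)
  refine
    { poisson := isPoissonOn_affineTensor hB hs hBinv 1 w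
      exp_mem := fun ξ hξ => ⟨expUnit 𝒢 ξ hξ, expUnit_mem 𝒢 hξ hξ, rfl⟩
      action := fun g h q => (hg h).apply_one q
      smooth := fun g h => (hg h).smooth
      dual_left := fun η hη h => ?_
      dual_right := fun ξ hξ h => ?_
      momentum := fun q x => projPlus_mem _
      hamiltonian := fun ξ hξ => ⟨fun _ => ξ,
        (hasGradOn_linear hs ⊤ ξ).congr fun q _ => (hJ q hξ).symm, fun q => ?_⟩
      adjoint_mem := fun g h ξ hξ => (hg h).Ad_mem (by norm_num) hξ
      coadjoint := fun g h η _ ξ hξ => ?_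
      equivariant := fun g h q => ?_
      value_mem := fun _ => le_degGE 𝒢 (by norm_num) he.mem
      regular := fun q _ η hη => ⟨η, ?_⟩
      level := fun q => ?_
      distribution := fun q v => ?_ }
  · have h1 := (mem_fil_iff_pairing hB hBinv (k := 0) (by norm_num)).2 h
    rw [← hJn hη]
    exact Loop.ext fun x => projPlus_eq_zero_iff.2 (h1 x)
  · refine eq_zero_of_pairing hB fun u => ?_
    rw [pairing_comm hs, ← hJ u hξ]
    exact h _ fun x => projPlus_mem _
  · have h1 := affineTensor_of_lie_eq_zero hw 1 q hξ
    rw [one_smul] at h1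
    exact h1 ▸ isFundamental_poisson₂ 𝒢 hξ q
  · rw [hJ _ ((hg h).Ad_mem (by norm_num) hξ), (hg h).pairing]
  · refine loopMap_projPlus_eq_iff.2 ?_
    have := add_mem (fil_mono 𝒢 (by norm_num) ((hg h).affine q))
      ((hg h).Ad_mem (by norm_num) (sub_projPlus_mem q))
    rwa [Ad_sub, sub_add_sub_cancel] at this
  · have h1 := (hasVelocity_line q η).map (projPlus 𝒢)
    rwa [hJn hη] at h1
  · rw [mem_levelManifold, loopMap_projPlus_eq_constLoop he]
  · rw [mem_reductionDistribution]
    constructor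
    · rintro ⟨ξ, hξ, rfl⟩
      exact ⟨ξ, hξ, isFundamental_poisson₂ 𝒢 hξ q⟩
    · rintro ⟨ξ, hξ, h⟩
      exact ⟨ξ, hξ, (isFundamental_poisson₂ 𝒢 hξ q).unique h⟩

theorem reductionDistribution_eq {w : Loop 𝔤} (hw : ∀ ξ ∈ fil 𝒢 (-1), loopLie w ξ = 0)
    (q : Loop 𝔤) :
    reductionDistribution 𝒢 q = (fil 𝒢 (-1)).map (affineTensor 1 w q) := by
  have h : ∀ ξ ∈ fil 𝒢 (-1), affineTensor 1 w q ξ = poisson₂ q ξ := fun ξ hξ => by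
    rw [affineTensor_of_lie_eq_zero hw 1 q hξ, one_smul]
  ext v
  exact ⟨fun ⟨ξ, hξ, hv⟩ => ⟨ξ, hξ, (h ξ hξ).trans hv⟩,
    fun ⟨ξ, hξ, hv⟩ => ⟨ξ, hξ, (h ξ hξ).symm.trans hv⟩⟩

/-- The reduced tensor is determined by its brackets. -/
theorem eq_of_reductions (hB : B.Nondegenerate) (hs : ∀ x y, B x y = B y x) {P P' P'' : Tensor 𝔤}
    {S Q : AffineSubspace ℂ (Loop 𝔤)} {D : Loop 𝔤 → Submodule ℂ (Loop 𝔤)} {π : Loop 𝔤 → Loop 𝔤}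
    (hQS : Q ≤ S) (hπ : ∀ q ∈ Q, π q = q) (h' : IsQuotientReduction B P S D Q π P')
    (h'' : IsTransversalReduction B P S D Q P'') {q : Loop 𝔤} (hq : q ∈ Q) : P' q = P'' q := by
  refine LinearMap.ext fun u => eq_of_pairing hB fun v => ?_
  rw [pairing_comm hs, pairing_comm hs _ v]
  -- Linear functionals realise every covector, and an extension for the quotient is also one for
  -- the transversal submanifold, because `π` is the identity on `Q`.
  have hv := hasGradOn_linear hs Q v
  have hu := hasGradOn_linear hs Q u
  obtain ⟨F, δF, hF, hFS, hFv⟩ := h'.extend _ _ hv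
  obtain ⟨G, δG, hG, hGS, hGu⟩ := h'.extend _ _ hu
  have h1 := h'.bracket_eq _ _ _ _ hv hu _ _ _ _ hF hG hFS hGS hFv hGu q (hQS hq)
  rw [hπ q hq] at h1
  exact h1.symm.trans (h''.bracket_eq _ _ _ _ hv hu _ _ _ _ hF hG hFS hGS
    (fun q hq => by rw [hFv q (hQS hq), hπ q hq]) (fun q hq => by rw [hGu q (hQS hq), hπ q hq]) q hq)

/-! ### Invariant functionals on the level manifold -/

theorem truncate_mem_levelManifold (q : Loop 𝔤) : truncate 𝒢 e 0 q ∈ levelManifold 𝒢 e :=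
  mem_levelManifold.2 (truncate_sub_mem 0 q)

/-- A functional on `S` with gradient in `L𝔟⁺` extends to `L𝔤` with the same gradient along
`S`. -/
theorem exists_extension_of_mem_bPlus (hB : B.Nondegenerate) (hBinv : B.lieInvariant 𝔤)
    (he : IsGoodElement 𝒢 e) {F : Loop 𝔤 → ℂ} {δF : Loop 𝔤 → Loop 𝔤}
    (hF : HasGradOn B (levelManifold 𝒢 e) F δF)
    (hb : ∀ p ∈ levelManifold 𝒢 e, δF p ∈ loopsIn (bPlus 𝒢)) :
    ∃ F' δF', HasGradOn B ⊤ F' δF' ∧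
      ∀ p ∈ levelManifold 𝒢 e, F' p = F p ∧ δF' p = δF p := by
  obtain ⟨T', hT⟩ := adjointable_truncate (𝒢 := 𝒢) (e := e) hB 0
  refine ⟨_, _, hT.hasGradOn_comp direction_levelManifold truncate_mem_levelManifold hF,
    fun p hp => ?_⟩
  have hp' := truncate_of_mem he (by norm_num) (mem_levelManifold.1 hp)
  simp only [hp', true_and]
  refine eq_of_pairing hB fun s => ?_
  have h1 : lineDeriv (truncate 𝒢 e 0) p s = loopMap (filterPart 𝒢 (· ≤ 0)) s := by
    have h2 := (hasVelocity_const (constLoop e)).add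
      ((hasVelocity_line p s).map (filterPart 𝒢 (· ≤ 0)))
    rw [zero_add] at h2
    exact lineDeriv_eq h2
  rw [← hT.adjoint, h1, ← sub_eq_zero, ← map_sub, pairing_apply]
  -- Truncation alters `s` only in positive degrees, which are orthogonal to `𝔟⁺`. So composing with
  -- the truncation keeps a gradient taken in `L𝔟⁺`.
  have h3 : ∀ x, B (δF p x) ((loopMap (filterPart 𝒢 (· ≤ 0)) s - s) x) = 0 := fun x => by
    have hd : (loopMap (filterPart 𝒢 (· ≤ 0)) s - s) x ∈ degGE 𝒢 1 := by
      refine (mem_degGE 𝒢).2 fun i hi => ?_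
      rw [loop_sub_apply, loopMap_apply, map_sub, part_filterPart, if_pos (by omega), sub_self]
    exact form_degGE 𝒢 hBinv (by norm_num : (0 : ℤ) < 0 + 1) (hb p hp x) hd
  simp only [h3, intervalIntegral.integral_zero]

theorem nMinus_eq_gMinus (h : 𝒢 (-1) = ⊥) : degLE 𝒢 (-1) = degLE 𝒢 (-2) := by
  refine le_antisymm ((degLE_le 𝒢).2 fun i hi => ?_) (degLE_mono 𝒢 (by norm_num))
  rcases eq_or_lt_of_le hi with rfl | hi
  · rw [h]; exact bot_le
  · exact le_degLE 𝒢 (by omega)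

theorem pairing_poisson₂_eq_zero_of_invariant (hBinv : B.lieInvariant 𝔤) (he : IsGoodElement 𝒢 e)
    {F : Loop 𝔤 → ℂ} {δF : Loop 𝔤 → Loop 𝔤} (hF : HasGradOn B (levelManifold 𝒢 e) F δF)
    (hinv : ∀ g ∈ adjointGroup (fil 𝒢 (-2)), ∀ p ∈ levelManifold 𝒢 e, F (act g.1 p) = F p)
    {p ξ : Loop 𝔤} (hp : p ∈ levelManifold 𝒢 e) (hξ : ξ ∈ fil 𝒢 (-2)) :
    pairing B (δF p) (poisson₂ p ξ) = 0 := by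
  have hm : ∀ t : ℝ, (-t : ℂ) • ξ ∈ fil 𝒢 (-2) := fun t => Submodule.smul_mem _ _ hξ
  have hm1 : ∀ t : ℝ, (-t : ℂ) • ξ ∈ fil 𝒢 (-1) := fun t => fil_mono 𝒢 (by norm_num) (hm t)
  have hc : IsPlot fun t : ℝ => act (expAd ((-t : ℂ) • ξ)) p :=
    isPlot_act_expAd 𝒢 ((isPlot_const ξ).smul Complex.ofRealCLM.contDiff.neg) (isPlot_const p) hm1
  have h1 := hF.hasDerivAt_comp direction_levelManifold hc
    (fun t => act_mem_levelManifold hBinv he (expUnit_mem 𝒢 (hm1 t) (hm t)) hp)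
    (isFundamental_poisson₂ 𝒢 (fil_mono 𝒢 (by norm_num) hξ) p)
  have h2 : (fun t : ℝ => F (act (expAd ((-t : ℂ) • ξ)) p)) = fun _ => F p :=
    funext fun t => hinv _ (expUnit_mem 𝒢 (hm1 t) (hm t)) p hp
  rw [h2] at h1
  have h3 := h1.unique (hasDerivAt_const _ _)
  simpa [expAd_zero] using h3

/-- Without `𝔤_{-1}` one has `𝔫⁻ = 𝔤⁻`, so `D` is tangent to `S` along `S` and is exhausted by
`G⁻`-orbit directions. Invariance then makes the truncated extension constant along `D`, with
unchanged gradient on `S`. -/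
theorem bracket_invariant_eq (hB : B.Nondegenerate) (hBinv : B.lieInvariant 𝔤)
    (he : IsGoodElement 𝒢 e) (hρ : IsPartialInverse 𝒢 e C ρ)
    (hC : C ≤ degLE 𝒢 0) {P PN : Tensor 𝔤} (hP : IsQuotientReduction B P (levelManifold 𝒢 e)
      (reductionDistribution 𝒢) (transversalManifold e C) (gaugeFix 𝒢 ρ e N) PN)
    (h1 : 𝒢 (-1) = ⊥) {F G : Loop 𝔤 → ℂ} {δF δG : Loop 𝔤 → Loop 𝔤}
    (hF : HasGradOn B (levelManifold 𝒢 e) F δF) (hG : HasGradOn B (levelManifold 𝒢 e) G δG)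
    (hFb : ∀ p ∈ levelManifold 𝒢 e, δF p ∈ loopsIn (bPlus 𝒢))
    (hGb : ∀ p ∈ levelManifold 𝒢 e, δG p ∈ loopsIn (bPlus 𝒢))
    (hFi : ∀ g ∈ adjointGroup (fil 𝒢 (-2)), ∀ p ∈ levelManifold 𝒢 e, F (act g.1 p) = F p)
    (hGi : ∀ g ∈ adjointGroup (fil 𝒢 (-2)), ∀ p ∈ levelManifold 𝒢 e, G (act g.1 p) = G p)
    {p : Loop 𝔤} (hp : p ∈ levelManifold 𝒢 e) :
    bracket B P δF δG p = bracket B PN δF δG (gaugeFix 𝒢 ρ e N p) := by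
  have key : ∀ {F : Loop 𝔤 → ℂ} {δF : Loop 𝔤 → Loop 𝔤}, HasGradOn B (levelManifold 𝒢 e) F δF →
      (∀ p ∈ levelManifold 𝒢 e, δF p ∈ loopsIn (bPlus 𝒢)) →
      (∀ g ∈ adjointGroup (fil 𝒢 (-2)), ∀ p ∈ levelManifold 𝒢 e, F (act g.1 p) = F p) →
      ∃ F' δF', HasGradOn B ⊤ F' δF' ∧
        ConstAlongOn B (reductionDistribution 𝒢) (levelManifold 𝒢 e) δF' ∧
        (∀ p ∈ levelManifold 𝒢 e, F' p = F (gaugeFix 𝒢 ρ e N p)) ∧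
        ∀ p ∈ levelManifold 𝒢 e, δF' p = δF p := by
    intro F δF hF hFb hFi
    obtain ⟨F', δF', hF', h⟩ := exists_extension_of_mem_bPlus hB hBinv he hF hFb
    refine ⟨F', δF', hF', ?_, fun p hp => ?_, fun p hp => (h p hp).2⟩
    · rintro p hp _ ⟨ξ, hξ, rfl⟩
      rw [(h p hp).2]
      exact pairing_poisson₂_eq_zero_of_invariant hBinv he hF hFi hp
        fun x => (nMinus_eq_gMinus h1).le (hξ x)
    · obtain ⟨g, hg, hgp⟩ := exists_gaugeFix_eq_of_mem (N := N) hBinv he hρ hp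
      rw [(h p hp).1, hgp, hFi g hg p hp]
  obtain ⟨F', δF', hF', hFS, hFF, hδF⟩ := key hF hFb hFi
  obtain ⟨G', δG', hG', hGS, hGG, hδG⟩ := key hG hGb hGi
  have hQS := transversalManifold_le (e := e) hC
  have h2 := hP.bracket_eq F δF G δG (hF.mono hQS) (hG.mono hQS) _ _ _ _ hF' hG' hFS hGS hFF hGG p hp
  rw [← h2, bracket, bracket, hδF p hp, hδG p hp]

end Input

end LoopReduction

end

/-! ### The main theorem -/

open LoopReduction in
theorem mainTheorem1 {𝔤 : Type*} [LieRing 𝔤] [LieAlgebra ℂ 𝔤] [Module.Finite ℂ 𝔤]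
    [LieAlgebra.IsSimple ℂ 𝔤]
    (B : LinearMap.BilinForm ℂ 𝔤) (hB : B.Nondegenerate) (hBinv : B.lieInvariant 𝔤)
    (𝒢 : ℤ → Submodule ℂ 𝔤) [GradedLieAlgebra 𝒢]
    (e : 𝔤) (he : IsGoodElement 𝒢 e)
    (C : Submodule ℂ 𝔤) (hC : IsTransversalSubspace 𝒢 e C)
    (a : 𝔤) (m : ℤ) (haC : a ∈ C) (ham : a ∈ 𝒢 m) (hm : IsLeast {i : ℤ | C ⊓ 𝒢 i ≠ ⊥} m) :
    let P : ℂ → Tensor 𝔤 := fun l => poisson₂ + l • poisson₁ a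
    let S := levelManifold 𝒢 e
    let D := reductionDistribution 𝒢
    let Q := transversalManifold e C
    let Nm := adjointGroup (loopsIn (nMinus 𝒢))
    let Gm := adjointGroup (loopsIn (gMinus 𝒢))
    let J := loopMap (projPlus 𝒢)
    -- the bi-Hamiltonian manifold
    IsBihamiltonianOn B ⊤ (poisson₁ a) poisson₂ ∧
    -- the bi-Hamiltonian reduction has submanifold `S` and distribution `D`
    BihamiltonianReductionData B (poisson₁ a) poisson₂
      (linearFunctionals B (loopsIn (nMinus 𝒢))) S D ∧
    -- the Drinfeld-Sokolov reduction, as a Marsden-Weinstein reduction, has the same `S` and `D`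
    (∀ l, MarsdenWeinsteinData B (P l) (loopsIn (nMinus 𝒢)) (loopsIn (nPlus 𝒢)) J
      (constLoop e) S D) ∧
    (∀ l q, D q = (loopsIn (nMinus 𝒢)).map (P l q)) ∧
    -- the isotropy group of `e` is the adjoint group of `L𝔤⁻`
    (∀ g, g ∈ Gm ↔ g ∈ Nm ∧ J (Ad g.1 (constLoop e)) = constLoop e) ∧
    -- `E = D ∩ TS = P₂(L𝔤⁻)` and `Q` is transversal to it
    (∀ q ∈ S, D q ⊓ S.direction = (loopsIn (gMinus 𝒢)).map (poisson₂ q)) ∧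
    IsTransversalManifold S D Q ∧
    -- the quotient `π : S → S / G⁻ ≅ Q`, and the Marsden-Ratiu hypotheses
    ∃ π : Loop 𝔤 → Loop 𝔤,
      (∀ q ∈ Q, π q = q) ∧
      (∀ p ∈ S, ∀ p' ∈ S, π p = π p' ↔ ∃ g ∈ Gm, act g.1 p = p') ∧
      (∀ l, MarsdenRatiuHyp B (P l) S D Q π) ∧
      -- the common reduced bi-Hamiltonian structure
      (∃ P₁Q P₂Q : Tensor 𝔤, IsBihamiltonianOn B Q P₁Q P₂Q ∧
        (∀ l : ℂ, IsQuotientReduction B (P l) S D Q π (P₂Q + l • P₁Q)) ∧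
        (∀ l : ℂ, IsTransversalReduction B (P l) S D Q (P₂Q + l • P₁Q)) ∧
        -- if `𝔤₋₁ = 0`, it is the bracket of `G⁻`-invariant functionals on `S` computed with
        -- their gradients in `L𝔟⁺`
        (𝒢 (-1) = ⊥ → ∀ (l : ℂ) (F G : Loop 𝔤 → ℂ) (δF δG : Loop 𝔤 → Loop 𝔤),
          HasGradOn B S F δF → HasGradOn B S G δG →
          (∀ p ∈ S, δF p ∈ loopsIn (bPlus 𝒢)) → (∀ p ∈ S, δG p ∈ loopsIn (bPlus 𝒢)) →
          (∀ g ∈ Gm, ∀ p ∈ S, F (act g.1 p) = F p) → (∀ g ∈ Gm, ∀ p ∈ S, G (act g.1 p) = G p) →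
          ∀ p ∈ S, bracket B (P l) δF δG p = bracket B (P₂Q + l • P₁Q) δF δG (π p))) ∧
      -- any two tensors obtained from the two reductions coincide
      (∀ (l : ℂ) (P' P'' : Tensor 𝔤), IsPoissonOn B Q P' → IsPoissonOn B Q P'' →
        IsQuotientReduction B (P l) S D Q π P' → IsTransversalReduction B (P l) S D Q P'' →
        ∀ q ∈ Q, P' q = P'' q) := by
  have hs := invariant_isSymm hBinv
  obtain ⟨ρ, hρ⟩ := hC.exists_partialInverse he hB hBinv
  obtain ⟨N, hN, -⟩ := exists_degLE_bounds 𝒢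
  have hCle := hC.le
  have ha : ∀ ξ ∈ fil 𝒢 (-1), loopLie (constLoop a) ξ = 0 := fun ξ hξ =>
    Loop.ext fun x => hC.lie_eq_zero he ham hm (hξ x)
  have hal : ∀ l : ℂ, ∀ ξ ∈ fil 𝒢 (-1), loopLie (l • constLoop a) ξ = 0 := fun l ξ hξ => by
    rw [map_smul, LinearMap.smul_apply, ha ξ hξ, smul_zero]
  obtain ⟨Θ', hΘ⟩ := adjointable_gaugeFix (N := N) hB hBinv hρ
  -- Pushing forward by one fixed map is linear in the tensor, so the reduced tensors again form a
  -- pencil with the same parameter.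
  have hpush : ∀ l : ℂ, hΘ.pushTensor hB hs poisson₂ + l • hΘ.pushTensor hB hs (poisson₁ a) =
      hΘ.pushTensor hB hs (affineTensor 1 (l • constLoop a)) := fun l => by
    rw [hΘ.pushTensor_add_smul, pencil_eq]
  have hquot := fun l => isQuotientReduction_gaugeFix hB hBinv hN he hρ hCle hΘ (hal l) 1
  have hfix : ∀ q ∈ transversalManifold e C, gaugeFix 𝒢 ρ e N q = q := fun q hq =>
    gaugeFix_of_mem hCle he hρ hq
  intro P S D Q Nm Gm J
  have hP : ∀ l, P l = affineTensor 1 (l • constLoop a) := pencil_eq a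
  refine ⟨⟨poisson₁_eq a ▸ isPoissonOn_affineTensor hB hs hBinv 0 _,
      fun l => pencil_eq a l ▸ isPoissonOn_affineTensor hB hs hBinv 1 _⟩,
    bihamiltonianReductionData hB hBinv ha, fun l => hP l ▸ marsdenWeinsteinData hB hBinv he (hal l),
    fun l q => hP l ▸ reductionDistribution_eq (hal l) q,
    fun g => mem_adjointGroup_gMinus_iff hBinv he,
    fun q hq => reductionDistribution_inf he hρ hq, isTransversalManifold hN hCle he hρ,
    gaugeFix 𝒢 ρ e N, hfix, fun p hp p' hp' => gaugeFix_eq_iff hBinv hN he hρ hCle hp hp',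
    fun l => hP l ▸ marsdenRatiuHyp_gaugeFix hB hBinv hN he hρ hCle (hal l) 1,
    ⟨hΘ.pushTensor hB hs (poisson₁ a), hΘ.pushTensor hB hs poisson₂, ⟨?_, fun l => ?_⟩,
      fun l => ?_, fun l => ?_, fun h1 l F G δF δG hF hG hFb hGb hFi hGi p hp => ?_⟩,
    fun l P' P'' _ _ h' h'' q hq =>
      eq_of_reductions hB hs (transversalManifold_le hCle) hfix h' h'' hq⟩
  -- The first structure is the case `k = 0` of the family, with `w` the constant loop `a`.
  · rw [poisson₁_eq]
    exact isPoissonOn_pushTensor hB hBinv hN he hρ hCle hΘ ha 0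
  · rw [hpush]
    exact isPoissonOn_pushTensor hB hBinv hN he hρ hCle hΘ (hal l) 1
  · rw [hpush, hP]
    exact hquot l
  · rw [hpush, hP]
    exact isTransversalReduction_gaugeFix hB hBinv hN he hρ hCle hΘ (hal l) 1
  · rw [hpush, hP]
    exact bracket_invariant_eq hB hBinv he hρ hCle (hquot l) h1 hF hG hFb hGb hFi hGi hp
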